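/- For a complex number $q$ with $|q|<1$ and an integer $s\ge 1$ put $$\zeta_q(s)=\sum_{k=1}^{\infty}\sigma_{s-1}(k)\,q^k,\qquad \sigma_{s-1}(k)=\sum_{d\mid k}d^{\,s-1}.$$ Fix a nonzero complex number $q\neq\pm1$ such that $1/q\in\mathbb{Z}$ (so that $q$ is real and $|q|<1$). Then, for every even integer $A\ge 0$, $$\dim_{\mathbb{Q}}\bigl(\mathbb{Q}+\mathbb{Q}\,\zeta_q(3)+\mathbb{Q}\,\zeta_q(5)+\cdots+\mathbb{Q}\,\zeta_q(A-1)\bigr)\ \ge\ \frac{\pi+o(1)}{2\sqrt{\pi^2+12}}\,\sqrt{A}$$ and $$\dim_{\mathbb{Q}}\bigl(\mathbb{Q}+\mathbb{Q}\,\zeta_q(2)+\mathbb{Q}\,\zeta_q(4)+\cdots+\mathbb{Q}\,\zeta_q(A)\bigr)\ \ge\ \frac{\pi+o(1)}{2\sqrt{\pi^2+12}}\,\sqrt{A},$$ where in each inequality $o(1)$ denotes a real quantity, depending on $q$ and $A$, that tends to $0$ as $A\to\infty$ with $q$ fixed. -/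

import Mathlib

/-- The normalised `q`-analogue of the zeta value at the integer `s ≥ 1`:
`ζ_q(s) = ∑_{k ≥ 1} σ_{s-1}(k) q ^ k`, for complex `q` with `|q| < 1`. -/
noncomputable def qZeta (q : ℂ) (s : ℕ) : ℂ :=
  ∑' k : ℕ+, (ArithmeticFunction.sigma (s - 1) (k : ℕ) : ℂ) * q ^ (k : ℕ)

/-- The series defining `qZeta q s` converges absolutely when `|q| < 1`. -/
theorem qZeta_summable {q : ℂ} (hq : ‖q‖ < 1) (s : ℕ) :
    Summable fun k : ℕ+ => (ArithmeticFunction.sigma (s - 1) (k : ℕ) : ℂ) * q ^ (k : ℕ) := by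
  have h := (summable_norm_pow_mul_geometric_of_norm_lt_one (s - 1 + 1) hq).comp_injective
    PNat.coe_injective
  refine Summable.of_norm_bounded h fun k => ?_
  simp only [Function.comp, norm_mul, norm_pow, Complex.norm_natCast]
  gcongr
  exact_mod_cast ArithmeticFunction.sigma_le_pow_succ (s - 1) (k : ℕ)

/-- The `ℚ`-subspace of `ℂ` spanned by `1, ζ_q(3), ζ_q(5), …, ζ_q(A - 1)` (`A` even). -/
noncomputable def oddQZetaSpan (q : ℂ) (A : ℕ) : Submodule ℚ ℂ :=
  Submodule.span ℚ (insert 1 (qZeta q '' {s : ℕ | Odd s ∧ 3 ≤ s ∧ s ≤ A - 1}))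

/-- The `ℚ`-subspace of `ℂ` spanned by `1, ζ_q(2), ζ_q(4), …, ζ_q(A)` (`A` even). -/
noncomputable def evenQZetaSpan (q : ℂ) (A : ℕ) : Submodule ℚ ℂ :=
  Submodule.span ℚ (insert 1 (qZeta q '' {s : ℕ | Even s ∧ 2 ≤ s ∧ s ≤ A}))

/-- The spanning families are finite, so the two spaces are finite-dimensional. -/
instance oddQZetaSpan_finite (q : ℂ) (A : ℕ) : Module.Finite ℚ (oddQZetaSpan q A) :=
  Module.Finite.span_of_finite ℚ
    ((((Set.finite_Iic (A - 1)).subset fun _ h => h.2.2).image _).insert _)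

instance evenQZetaSpan_finite (q : ℂ) (A : ℕ) : Module.Finite ℚ (evenQZetaSpan q A) :=
  Module.Finite.span_of_finite ℚ
    ((((Set.finite_Iic A).subset fun _ h => h.2.2).image _).insert _)

/-!
Write `q = 1 / p` with `p` an integer, `|p| ≥ 2`.  The dimension is bounded below by Nesterenko's
criterion (`nesterenko_criterion`): if integer linear forms in given real numbers have size
`exp (-α m ^ 2)` and coefficients at most `exp (β m ^ 2)`, up to `o(m ^ 2)` in the exponents, then
the span of `1` and these numbers has dimension at least `1 + α / β`.  It is proved here by
evaluating the forms at the numerators and the common denominator of good simultaneous rational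
approximations.

The forms come from the rational function `kernelFun`, a product of `A = G + 1 + 2 r` factors
`(p - 1) ⋯ (p ^ n - 1) N(X) / ∏_{j ≤ n} (p ^ j X - 1)` with `n = 2 m + 1`.  Expanding it in partial
fractions and summing over `X = p, p ^ 2, …` gives a linear form in `1` and the `q`-zeta values,
because `∑_{l ≥ 1} g_k (1 / (p ^ l - 1)) = ζ_q(k + 1)`, where the polynomial `g_k` is defined by
`g_k (x / (1 - x)) = ∑_{m ≥ 1} m ^ k x ^ m`.  The kernel is symmetric or antisymmetric under
`X ↦ p ^ (-n) / X`, depending on its first numerator, and this symmetry keeps only the `q`-zeta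
values of one parity (`exists_linear_form`).

Three sizes have to be compared, on the scale `m ^ 2 log |p|`.
* Denominators: besides powers of `p`, they divide the `A`-th power of
  `∏_{k ≤ n} Φ_k(p)`, of size `|p| ^ (3 n ^ 2 / π ^ 2)`, the constant being the mean value of
  Euler's function (`tendsto_log_cyclotomicProd_div_sq`).
* Coefficients: partial fractions of products are computed factor by factor, without loss of
  powers of `p` (`hasPartialFractions_kernelFun`).
* Values: the kernel vanishes at `p, …, p ^ (2 m r)`, and the next term, of size about
  `|p| ^ (-2 r G m ^ 2)`, dominates the series (`log_kernelFun`, `exists_hasSum_of_dominant`).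

The outcome is the explicit bound `le_finrank_sub_one_mul`, whose quotient behaves for large `A`
like `2 r A / (A + 4 r ^ 2 + 12 A / π ^ 2)`; the optimal choice `r ∼ √(π ^ 2 + 12) / (2 π) * √A`
gives the constant `π / (2 √(π ^ 2 + 12))`.
-/

open Filter Topology

/-! ### A linear independence criterion -/

/-- Dirichlet's simultaneous approximation theorem, by the pigeonhole principle for the points
`(k ξ₁, …, k ξ_d)` modulo `1`. -/
theorem exists_simultaneous_approx {d : ℕ} (ξ : Fin d → ℝ) {Q : ℕ} (hQ : 0 < Q) :
    ∃ x : ℕ, 0 < x ∧ x ≤ Q ^ d ∧ ∃ y : Fin d → ℤ, ∀ i, |(x : ℝ) * ξ i - y i| < 1 / Q := by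
  have hQ' : (0 : ℝ) < Q := by exact_mod_cast hQ
  have hlt : ∀ (k : ℕ) (i : Fin d), ⌊Int.fract ((k : ℝ) * ξ i) * Q⌋₊ < Q := fun k i => by
    rw [Nat.floor_lt (by positivity)]
    have := Int.fract_lt_one ((k : ℝ) * ξ i)
    nlinarith
  obtain ⟨k, hk, l, hl, hne, hkl⟩ := Finset.exists_ne_map_eq_of_card_lt_of_maps_to
    (s := Finset.range (Q ^ d + 1)) (t := (Finset.univ : Finset (Fin d → Fin Q)))
    (by simp) (f := fun k i => ⟨_, hlt k i⟩) (fun _ _ => Finset.mem_coe.2 (Finset.mem_univ _))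
  wlog h : k < l generalizing k l
  · exact this l hl k hk hne.symm hkl.symm (by omega)
  refine ⟨l - k, by omega, by simp at hl; omega, fun i => ⌊(l : ℝ) * ξ i⌋ - ⌊(k : ℝ) * ξ i⌋, fun i => ?_⟩
  have h1 := congrArg Fin.val (congrFun hkl i)
  simp only at h1
  have e1 := Nat.floor_le (a := Int.fract ((k : ℝ) * ξ i) * Q) (by positivity)
  have e2 := Nat.floor_le (a := Int.fract ((l : ℝ) * ξ i) * Q) (by positivity)
  have e3 := Nat.lt_floor_add_one (Int.fract ((k : ℝ) * ξ i) * Q)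
  have e4 := Nat.lt_floor_add_one (Int.fract ((l : ℝ) * ξ i) * Q)
  rw [h1] at e1 e3
  rw [lt_div_iff₀ hQ', Nat.cast_sub h.le]
  rw [show ∀ z : ℝ, |z| * Q = |z * Q| from fun z => by rw [abs_mul, abs_of_pos hQ'], abs_lt]
  push_cast
  have f1 := Int.self_sub_floor ((k : ℝ) * ξ i)
  have f2 := Int.self_sub_floor ((l : ℝ) * ξ i)
  have : (((l : ℝ) - k) * ξ i - (⌊(l : ℝ) * ξ i⌋ - ⌊(k : ℝ) * ξ i⌋)) * Q
    = Int.fract ((l : ℝ) * ξ i) * Q - Int.fract ((k : ℝ) * ξ i) * Q := by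
    rw [← f1, ← f2]; ring
  rw [this]
  constructor <;> linarith

/-- The criterion for a family already reduced to `1, ξ₁, …, ξ_d`.  A common denominator `x` of
good simultaneous approximations to the `ξᵢ`, combined with the first form that is small against
`x`, would give an integer strictly between `0` and `1` if `α > d β`. -/
theorem le_mul_of_linear_forms {d : ℕ} (ξ : Fin d → ℝ) (a : ℕ → ℤ) (b : ℕ → Fin d → ℤ)
    {α β : ℝ} (hα : 0 < α) (hβ : 0 ≤ β)
    (hv : Tendsto (fun m : ℕ => Real.log |(a m : ℝ) + ∑ i, (b m i : ℝ) * ξ i| / (m : ℝ) ^ 2)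
      atTop (𝓝 (-α)))
    (hb : ∀ᶠ m : ℕ in atTop, ∀ i, |(b m i : ℝ)| ≤ Real.exp (β * (m : ℝ) ^ 2)) :
    α ≤ d * β := by
  by_contra! hlt
  set v : ℕ → ℝ := fun m => (a m : ℝ) + ∑ i, (b m i : ℝ) * ξ i with hvdef
  -- the value of the form at the integer point `(x, y)`
  have key : ∀ (m x : ℕ) (y : Fin d → ℤ) (Q : ℝ), (∀ i, |(x : ℝ) * ξ i - y i| < 1 / Q) → 0 < Q →
      (∀ i, |(b m i : ℝ)| ≤ Real.exp (β * (m : ℝ) ^ 2)) →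
      d * Real.exp (β * (m : ℝ) ^ 2) < Q * (x * |v m|) → x * |v m| < 1 / 2 → False := by
    intro m x y Q hy hQ hbm h1 h2
    have hint : ((a m * x + ∑ i, b m i * y i : ℤ) : ℝ)
        = x * v m - ∑ i, (b m i : ℝ) * (x * ξ i - y i) := by
      simp only [hvdef]; push_cast
      simp only [mul_sub, Finset.sum_sub_distrib, mul_add, Finset.mul_sum]
      have : ∀ i, (x : ℝ) * (b m i * ξ i) = b m i * (x * ξ i) := fun i => by ring
      simp only [this]; ring
    have herr : |∑ i, (b m i : ℝ) * (x * ξ i - y i)| < x * |v m| := by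
      calc |∑ i, (b m i : ℝ) * (x * ξ i - y i)| ≤ ∑ i, |(b m i : ℝ) * (x * ξ i - y i)| :=
            Finset.abs_sum_le_sum_abs _ _
        _ ≤ ∑ i : Fin d, Real.exp (β * (m : ℝ) ^ 2) * (1 / Q) := by
            refine Finset.sum_le_sum fun i _ => ?_
            rw [abs_mul]
            exact mul_le_mul (hbm i) (hy i).le (abs_nonneg _) (Real.exp_pos _).le
        _ = d * Real.exp (β * (m : ℝ) ^ 2) / Q := by simp; ring
        _ < x * |v m| := by rw [div_lt_iff₀ hQ]; linarith
    have hx : |(x : ℝ) * v m| = x * |v m| := by rw [abs_mul, Nat.abs_cast]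
    have hlt1 : |((a m * x + ∑ i, b m i * y i : ℤ) : ℝ)| < 1 := by
      rw [hint]; have := abs_sub (x * v m) (∑ i, (b m i : ℝ) * (x * ξ i - y i)); linarith
    have h0 : a m * x + ∑ i, b m i * y i = 0 := by
      rw [← Int.abs_lt_one_iff]; exact_mod_cast hlt1
    rw [h0] at hint
    have : (x : ℝ) * v m = ∑ i, (b m i : ℝ) * (x * ξ i - y i) := by push_cast at hint; linarith
    rw [← hx, this] at herr
    exact lt_irrefl _ herr
  -- the margin `ε`
  obtain ⟨ε, hε, hεα, hεd⟩ : ∃ ε : ℝ, 0 < ε ∧ ε < α ∧ 0 < α - ε - d * (β + 2 * ε) := by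
    refine ⟨(α - d * β) / (2 * (2 + 2 * d)), div_pos (by linarith) (by positivity), ?_, ?_⟩
    · have hd : (0:ℝ) ≤ d := by positivity
      rw [div_lt_iff₀ (by positivity)]
      have := mul_nonneg hd hβ
      have := mul_nonneg hd hα.le
      linarith
    · have hd : (0:ℝ) ≤ d := by positivity
      have h2 : (0:ℝ) < 2 * (2 + 2 * d) := by positivity
      have : (α - d * β) / (2 * (2 + 2 * d)) * (2 * (2 + 2 * d)) = α - d * β :=
        div_mul_cancel₀ _ h2.ne'
      nlinarith [div_pos (sub_pos.2 hlt) h2]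
  have hev1 := hv.eventually (Ioo_mem_nhds (show -α - ε < -α by linarith)
    (show -α < -α + ε by linarith))
  -- from some index on, all the estimates hold
  set g : ℝ → ℝ := fun t => ((α - ε) * (t - 1) ^ 2 - Real.log 2)
    - d * (Real.log d + (β + (α + ε)) * t ^ 2 - (α - ε) * (t - 1) ^ 2 + Real.log 2) with hg
  have hev2 : ∀ᶠ m : ℕ in atTop, 0 < g m := by
    have hκ := hεd
    set κ := α - ε - d * (β + 2 * ε)
    set c1 := 2 * (α - ε) * (1 + d)
    set c2 := Real.log 2 + d * (Real.log d + Real.log 2)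
    have hgk : ∀ t : ℝ, g t = κ * t ^ 2 - c1 * t + ((α - ε) * (1 + d) - c2) := by
      intro t; simp only [hg, κ, c1, c2]; ring
    obtain ⟨M, hM⟩ := exists_nat_gt ((|c1| + |(α - ε) * (1 + d) - c2|) / κ)
    filter_upwards [eventually_ge_atTop (max M 1)] with m hm
    have hm1 : (1 : ℝ) ≤ m := by exact_mod_cast le_trans (le_max_right _ _) hm
    have hmM : (M : ℝ) ≤ m := by exact_mod_cast le_trans (le_max_left _ _) hm
    rw [div_lt_iff₀ hκ] at hM
    rw [hgk]
    have a1 := le_abs_self c1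
    have a2 := neg_abs_le ((α - ε) * (1 + d) - c2)
    have a3 := abs_nonneg ((α - ε) * (1 + d) - c2)
    have : |c1| + |(α - ε) * (1 + d) - c2| < m * κ := by nlinarith
    nlinarith
  obtain ⟨m₀, hm₀⟩ := eventually_atTop.1 ((hev1.and hev2).and (hb.and (eventually_ge_atTop 1)))
  have hvlog : ∀ m ≥ m₀, v m ≠ 0 ∧ -(α + ε) * (m : ℝ) ^ 2 < Real.log |v m| ∧
      Real.log |v m| < -(α - ε) * (m : ℝ) ^ 2 := by
    intro m hm
    obtain ⟨⟨⟨h1, h2⟩, -⟩, -, h4⟩ := hm₀ m hm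
    have hmp : (0 : ℝ) < (m : ℝ) ^ 2 := by
      have : (0 : ℝ) < m := by exact_mod_cast h4
      positivity
    rw [lt_div_iff₀ hmp] at h1
    rw [div_lt_iff₀ hmp] at h2
    refine ⟨fun h => ?_, by linarith, by linarith⟩
    have : Real.log |v m| = 0 := by rw [h]; simp
    simp only [hvdef] at this
    rw [this] at h2
    nlinarith
  -- a large box for the approximation
  obtain ⟨Q, hQ⟩ := exists_nat_gt (max 1 (d * Real.exp (β * (m₀ : ℝ) ^ 2) / |v m₀|))
  have hQ1 : (1 : ℝ) < Q := lt_of_le_of_lt (le_max_left _ _) hQ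
  have hQ0 : (0 : ℝ) < Q := by linarith
  obtain ⟨x, hx0, hxQ, y, hy⟩ := exists_simultaneous_approx ξ (Q := Q) (by exact_mod_cast hQ0)
  have hxpos : (0 : ℝ) < x := by exact_mod_cast hx0
  have hxone : (1 : ℝ) ≤ x := by exact_mod_cast hx0
  have hex : ∃ m, m₀ ≤ m ∧ x * |v m| < 1 / 2 := by
    have : Tendsto (fun m : ℕ => -(α - ε) * (m : ℝ) ^ 2) atTop atBot := by
      apply Tendsto.const_mul_atTop_of_neg (by linarith)
      exact (tendsto_pow_atTop two_ne_zero).comp tendsto_natCast_atTop_atTop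
    obtain ⟨m, h1, h2⟩ := ((this.eventually (eventually_lt_atBot (Real.log (1 / 2 / x)))).and
      (eventually_ge_atTop m₀)).exists
    refine ⟨m, h2, ?_⟩
    obtain ⟨hne, -, h4⟩ := hvlog m h2
    have := (Real.log_lt_log_iff (abs_pos.2 hne) (by positivity)).1 (h4.trans h1)
    rw [lt_div_iff₀ hxpos] at this
    linarith
  classical
  obtain ⟨hm1, hm2⟩ := Nat.find_spec hex
  set m := Nat.find hex with hm
  have hbm := (hm₀ m hm1).2.1
  refine key m x y Q hy hQ0 hbm ?_ hm2
  rcases hm1.eq_or_lt with heq | hlt'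
  · rw [← heq]
    have h1 := (le_max_right _ _).trans_lt hQ
    rw [div_lt_iff₀ (abs_pos.2 (hvlog m₀ le_rfl).1)] at h1
    have h2 : |v m₀| ≤ x * |v m₀| := le_mul_of_one_le_left (abs_nonneg _) hxone
    nlinarith
  · -- minimality of `m` bounds `x`, hence `Q`, from below
    have hpred := Nat.find_min hex (m := m - 1) (by omega)
    simp only [not_and, not_lt] at hpred
    have h1 := hpred (by omega)
    obtain ⟨hne', -, hup⟩ := hvlog (m - 1) (by omega)
    obtain ⟨hne, hlow, -⟩ := hvlog m hm1
    rw [Nat.cast_sub (by omega), Nat.cast_one] at hup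
    have hlogx : (α - ε) * ((m : ℝ) - 1) ^ 2 - Real.log 2 ≤ Real.log x := by
      have := Real.log_le_log (by norm_num) h1
      rw [Real.log_mul hxpos.ne' (abs_ne_zero.2 hne'), one_div, Real.log_inv] at this
      linarith
    have hlogQ : Real.log x ≤ d * Real.log Q := by
      rw [← Real.log_pow]
      exact Real.log_le_log hxpos (by exact_mod_cast hxQ)
    have hgm := (hm₀ m hm1).1.2
    rcases Nat.eq_zero_or_pos d with hd | hd
    · subst hd
      have : 0 < x * |v m| := mul_pos hxpos (abs_pos.2 hne)
      simp only [Nat.cast_zero, zero_mul]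
      positivity
    have hdpos : (0 : ℝ) < d := by exact_mod_cast hd
    have hvm : 0 < |v m| := abs_pos.2 hne
    rw [← Real.log_lt_log_iff (by positivity) (by positivity), Real.log_mul (by positivity)
      (by positivity), Real.log_exp, Real.log_mul (by positivity) (by positivity),
      Real.log_mul (by positivity) (by positivity)]
    have h3 : d * (Real.log d + (β + (α + ε)) * (m : ℝ) ^ 2 - (α - ε) * ((m : ℝ) - 1) ^ 2
        + Real.log 2) < d * Real.log Q := by
      simp only [hg] at hgm; linarith
    have h4 := lt_of_mul_lt_mul_left h3 hdpos.le
    linarith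

/-- A `ℚ`-basis of the span of `1` and the `z t` of the form `1, ξ₁, …, ξ_d`. -/
theorem exists_rational_coordinates (s : Finset ℕ) (z : ℕ → ℝ) :
    ∃ d : ℕ, d + 1 = Module.finrank ℚ (Submodule.span ℚ (insert 1 (z '' (s : Set ℕ)))) ∧
      ∃ ξ : Fin d → ℝ, ∀ t ∈ s, ∃ c₀ : ℚ, ∃ c : Fin d → ℚ,
        z t = (c₀ : ℝ) + ∑ i, (c i : ℝ) * ξ i := by
  set E := Submodule.span ℚ (insert (1 : ℝ) (z '' (s : Set ℕ))) with hE
  have : Module.Finite ℚ E := Module.Finite.span_of_finite ℚ ((s.finite_toSet.image _).insert _)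
  let u : E := ⟨1, Submodule.subset_span (Set.mem_insert _ _)⟩
  have hu : u ≠ 0 := fun h => one_ne_zero (congrArg Subtype.val h)
  set N := Submodule.span ℚ {u}
  have h1 : Module.finrank ℚ N = 1 := finrank_span_singleton hu
  have h2 := Submodule.finrank_quotient_add_finrank N
  refine ⟨Module.finrank ℚ (E ⧸ N), by rw [← h2, h1], ?_⟩
  let b := Module.finBasis ℚ (E ⧸ N)
  let e : Fin (Module.finrank ℚ (E ⧸ N)) → E := fun i =>
    Function.surjInv (Submodule.mkQ_surjective N) (b i)
  have he : ∀ i, N.mkQ (e i) = b i := fun i => Function.surjInv_eq _ _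
  refine ⟨fun i => (e i : ℝ), fun t ht => ?_⟩
  let w : E := ⟨z t, Submodule.subset_span (Set.mem_insert_of_mem _ ⟨t, ht, rfl⟩)⟩
  have hw : w - ∑ i, b.repr (N.mkQ w) i • e i ∈ N := by
    rw [← Submodule.Quotient.mk_eq_zero, ← Submodule.mkQ_apply, map_sub, map_sum]
    simp only [map_smul, he]
    rw [b.sum_repr, sub_self]
  obtain ⟨c₀, hc₀⟩ := Submodule.mem_span_singleton.1 hw
  refine ⟨c₀, fun i => b.repr (N.mkQ w) i, ?_⟩
  have := congrArg Subtype.val hc₀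
  simp only [Submodule.coe_smul, Submodule.coe_sub, Submodule.coe_sum, u, w, Rat.smul_def] at this
  simp only [mul_one] at this
  rw [this]; simp [w]

theorem exists_common_denominator {ι : Type*} (s : Finset ι) (c : ι → ℚ) :
    ∃ W : ℤ, 0 < W ∧ ∀ i ∈ s, ∃ k : ℤ, (W : ℝ) * (c i : ℝ) = k := by
  classical
  refine ⟨∏ i ∈ s, ((c i).den : ℤ), Finset.prod_pos fun i _ => by exact_mod_cast (c i).pos,
    fun i hi => ⟨(∏ j ∈ s.erase i, ((c j).den : ℤ)) * (c i).num, ?_⟩⟩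
  rw [← Finset.mul_prod_erase s _ hi]
  have h : ((c i).den : ℝ) * (c i : ℝ) = (c i).num := by
    exact_mod_cast Rat.den_mul_eq_num (c i)
  push_cast
  linear_combination (∏ j ∈ s.erase i, ((c j).den : ℝ)) * h

/-- **Nesterenko's linear independence criterion**, for linear forms whose logarithmic size is of
order `m ^ 2`. -/
theorem nesterenko_criterion (s : Finset ℕ) (z : ℕ → ℝ) (a : ℕ → ℤ) (b : ℕ → ℕ → ℤ) {α β : ℝ}
    (hα : 0 < α) (hβ : 0 ≤ β)
    (hv : Tendsto (fun m : ℕ => Real.log |(a m : ℝ) + ∑ t ∈ s, (b m t : ℝ) * z t| / (m : ℝ) ^ 2)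
      atTop (𝓝 (-α)))
    (hb : ∀ η > 0, ∀ᶠ m : ℕ in atTop, ∀ t ∈ s, |(b m t : ℝ)| ≤ Real.exp ((β + η) * (m : ℝ) ^ 2)) :
    α ≤ ((Module.finrank ℚ (Submodule.span ℚ (insert 1 (z '' (s : Set ℕ)))) : ℝ) - 1) * β := by
  obtain ⟨d, hd, ξ, hξ⟩ := exists_rational_coordinates s z
  choose! c₀ c hc using hξ
  obtain ⟨W₀, hW₀, hW₀'⟩ := exists_common_denominator s c₀
  obtain ⟨W₁, hW₁, hW₁'⟩ := exists_common_denominator (s ×ˢ Finset.univ)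
    (fun x : ℕ × Fin d => c x.1 x.2)
  choose! k₀ hk₀ using hW₀'
  choose! k₁ hk₁ using hW₁'
  rw [← hd]
  push_cast
  rw [add_sub_cancel_right]
  set W := W₀ * W₁
  have hWpos : (0 : ℝ) < W := by exact_mod_cast mul_pos hW₀ hW₁
  -- the forms in the coordinates `1, ξ₁, …, ξ_d`, with the common denominator `W` cleared
  set a' : ℕ → ℤ := fun m => W * a m + ∑ t ∈ s, b m t * (W₁ * k₀ t)
  set b' : ℕ → Fin d → ℤ := fun m i => ∑ t ∈ s, b m t * (W₀ * k₁ (t, i))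
  have hval : ∀ m, (a' m : ℝ) + ∑ i, (b' m i : ℝ) * ξ i
      = W * ((a m : ℝ) + ∑ t ∈ s, (b m t : ℝ) * z t) := by
    intro m
    simp only [a', b', W]
    push_cast
    simp only [Finset.sum_mul]
    rw [Finset.sum_comm, add_assoc, ← Finset.sum_add_distrib, mul_add, Finset.mul_sum]
    congr 1
    refine Finset.sum_congr rfl fun t ht => ?_
    have h1 : ∑ i, (b m t : ℝ) * (W₀ * k₁ (t, i)) * ξ i
        = (b m t : ℝ) * (W₀ * (W₁ * ∑ i, (c t i : ℝ) * ξ i)) := by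
      simp only [Finset.mul_sum]
      refine Finset.sum_congr rfl fun i _ => ?_
      rw [← hk₁ (t, i) (by simp [ht])]; ring
    rw [h1, ← hk₀ t ht, hc t ht]; ring
  have hv' : Tendsto (fun m : ℕ => Real.log |(a' m : ℝ) + ∑ i, (b' m i : ℝ) * ξ i| / (m : ℝ) ^ 2)
      atTop (𝓝 (-α)) := by
    have h1 : Tendsto (fun m : ℕ => Real.log W / (m : ℝ) ^ 2) atTop (𝓝 0) :=
      ((tendsto_pow_atTop two_ne_zero).comp tendsto_natCast_atTop_atTop).const_div_atTop _
    have h2 := h1.add hv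
    rw [zero_add] at h2
    refine h2.congr' ?_
    filter_upwards [hv.eventually (gt_mem_nhds (show -α < 0 by linarith))] with m hm
    have hne : (a m : ℝ) + ∑ t ∈ s, (b m t : ℝ) * z t ≠ 0 := fun h => by
      rw [h] at hm; simp at hm
    rw [hval, abs_mul, Real.log_mul (abs_ne_zero.2 hWpos.ne') (abs_ne_zero.2 hne),
      abs_of_pos hWpos, add_div]
  refine le_of_forall_pos_le_add fun η hη => ?_
  set η' := η / (d + 1)
  have hη' : 0 < η' := by positivity
  have hmain := le_mul_of_linear_forms ξ a' b' hα (β := β + η') (by linarith) hv' ?_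
  · have : (d : ℝ) * η' ≤ η := by
      simp only [η']; rw [mul_div_assoc', div_le_iff₀ (by positivity)]; nlinarith
    linarith
  · set C : ℝ := ∑ t ∈ s, ∑ i, |(W₀ : ℝ) * k₁ (t, i)|
    have hC : 0 ≤ C := Finset.sum_nonneg fun t _ => Finset.sum_nonneg fun i _ => abs_nonneg _
    have h1 : ∀ᶠ m : ℕ in atTop, C ≤ Real.exp (η' / 2 * (m : ℝ) ^ 2) := by
      have : Tendsto (fun m : ℕ => Real.exp (η' / 2 * (m : ℝ) ^ 2)) atTop atTop :=
        Real.tendsto_exp_atTop.comp (((tendsto_pow_atTop two_ne_zero).comp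
          tendsto_natCast_atTop_atTop).const_mul_atTop (by positivity))
      exact this.eventually_ge_atTop C
    filter_upwards [h1, hb (η' / 2) (by positivity)] with m hm1 hm2 i
    simp only [b']
    push_cast
    calc |∑ t ∈ s, (b m t : ℝ) * (W₀ * k₁ (t, i))|
        ≤ ∑ t ∈ s, |(b m t : ℝ) * (W₀ * k₁ (t, i))| := Finset.abs_sum_le_sum_abs _ _
      _ ≤ ∑ t ∈ s, Real.exp ((β + η' / 2) * (m : ℝ) ^ 2) * ∑ i, |(W₀ : ℝ) * k₁ (t, i)| := by
          refine Finset.sum_le_sum fun t ht => ?_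
          rw [abs_mul]
          exact mul_le_mul (hm2 t ht) (Finset.single_le_sum (f := fun i => |(W₀ : ℝ) * k₁ (t, i)|)
            (fun _ _ => abs_nonneg _) (Finset.mem_univ i)) (abs_nonneg _) (Real.exp_pos _).le
      _ = Real.exp ((β + η' / 2) * (m : ℝ) ^ 2) * C := by rw [← Finset.mul_sum]
      _ ≤ Real.exp ((β + η' / 2) * (m : ℝ) ^ 2) * Real.exp (η' / 2 * (m : ℝ) ^ 2) :=
          mul_le_mul_of_nonneg_left hm1 (Real.exp_pos _).le
      _ = Real.exp ((β + η') * (m : ℝ) ^ 2) := by rw [← Real.exp_add]; ring_nf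

/-! ### The common multiple of the `p ^ i - 1` -/

theorem abs_log_abs_one_sub_le {x : ℝ} (hx : |x| ≤ 1 / 2) : |Real.log (|1 - x|)| ≤ 2 * |x| := by
  obtain ⟨h1, h2⟩ := abs_le.1 hx
  have hpos : 0 < 1 - x := by linarith
  rw [abs_of_pos hpos, abs_le]
  constructor
  · have h3 := Real.one_sub_inv_le_log_of_pos hpos
    refine le_trans ?_ h3
    have : 1 - (1 - x)⁻¹ = -x / (1 - x) := by field_simp; ring
    rw [this, le_div_iff₀ hpos]
    rcases abs_cases x with ⟨h, _⟩ | ⟨h, _⟩ <;> rw [h] <;> nlinarith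
  · have h3 := Real.log_le_sub_one_of_pos hpos
    have := neg_abs_le x
    have := abs_nonneg x
    linarith

/-- The infinite product `∏ (1 - q ^ k)` stays between two absolute constants for `|q| ≤ 1/2`, and
so do all its subproducts. -/
theorem sum_abs_log_abs_one_sub_pow_le {ι : Type*} (s : Finset ι) {e : ι → ℕ}
    (he : Set.InjOn e s) (he1 : ∀ i ∈ s, 1 ≤ e i) {q : ℝ} (hq : |q| ≤ 1 / 2) :
    ∑ i ∈ s, |Real.log (|1 - q ^ e i|)| ≤ 4 := by
  classical
  calc ∑ i ∈ s, |Real.log (|1 - q ^ e i|)| ≤ ∑ i ∈ s, 2 * (1 / 2 : ℝ) ^ e i := by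
        refine Finset.sum_le_sum fun i hi => ?_
        have h1 : |q ^ e i| ≤ (1 / 2 : ℝ) ^ e i := by
          rw [abs_pow]; exact pow_le_pow_left₀ (abs_nonneg _) hq _
        have h2 : (1 / 2 : ℝ) ^ e i ≤ 1 / 2 :=
          pow_le_of_le_one (by norm_num) (by norm_num) (by have := he1 i hi; omega)
        exact (abs_log_abs_one_sub_le (h1.trans h2)).trans (by linarith)
    _ = 2 * ∑ k ∈ s.image e, (1 / 2 : ℝ) ^ k := by
        rw [Finset.sum_image he, Finset.mul_sum]
    _ ≤ 2 * 2 := by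
        gcongr
        exact sum_le_hasSum _ (fun _ _ => by positivity) hasSum_geometric_two
    _ = 4 := by norm_num

theorem sum_range_id_Ioc (N : ℕ) : ∑ m ∈ Finset.Ioc 0 N, (m : ℝ) = (N : ℝ) * (N + 1) / 2 := by
  induction N with
  | zero => simp
  | succ k ih => rw [Finset.sum_Ioc_succ_top (Nat.zero_le k), ih]; push_cast; ring

/-- Summation over `k` of the Möbius inversion formula for `φ(k)`. -/
theorem sum_totient_eq (n : ℕ) : ∑ k ∈ Finset.Ioc 0 n, (Nat.totient k : ℝ)
    = ∑ d ∈ Finset.Ioc 0 n, (ArithmeticFunction.moebius d : ℝ)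
        * (((n / d : ℕ) : ℝ) * (((n / d : ℕ) : ℝ) + 1) / 2) := by
  let F : ArithmeticFunction ℝ := ⟨fun k => (k : ℝ), by simp⟩
  have h := ArithmeticFunction.sum_Ioc_mul_eq_sum_sum
    (ArithmeticFunction.moebius : ArithmeticFunction ℝ) F n
  have htot := (ArithmeticFunction.sum_eq_iff_sum_mul_moebius_eq (R := ℝ)
    (f := fun k => (Nat.totient k : ℝ)) (g := fun k => (k : ℝ))).1
      (fun k _ => by exact_mod_cast Nat.sum_totient k)
  have h1 : ∑ k ∈ Finset.Ioc 0 n, (Nat.totient k : ℝ)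
      = ∑ k ∈ Finset.Ioc 0 n, ((ArithmeticFunction.moebius : ArithmeticFunction ℝ) * F) k := by
    refine Finset.sum_congr rfl fun k hk => ?_
    rw [← htot k (Finset.mem_Ioc.1 hk).1, ArithmeticFunction.mul_apply]
    rfl
  rw [h1, h]
  refine Finset.sum_congr rfl fun d _ => ?_
  have : ∑ m ∈ Finset.Ioc 0 (n / d), F m = ∑ m ∈ Finset.Ioc 0 (n / d), (m : ℝ) := rfl
  rw [this, sum_range_id_Ioc]
  rfl

/-- The Dirichlet series of the Möbius function at `2` is `1 / ζ(2)`. -/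
theorem hasSum_moebius_div_sq :
    HasSum (fun d : ℕ => (ArithmeticFunction.moebius d : ℝ) / (d : ℝ) ^ 2) (6 / Real.pi ^ 2) := by
  have h2 : (1 : ℝ) < (2 : ℂ).re := by norm_num
  have hs := (ArithmeticFunction.LSeriesSummable_moebius_iff.2 h2).LSeriesHasSum
  have hz := LSeries_one_mul_Lseries_moebius h2
  rw [LSeries_one_eq_riemannZeta h2, riemannZeta_two] at hz
  have hπ : (Real.pi : ℂ) ≠ 0 := by exact_mod_cast Real.pi_ne_zero
  have hval : LSeries (fun n => (ArithmeticFunction.moebius n : ℂ)) 2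
      = ((6 / Real.pi ^ 2 : ℝ) : ℂ) := by
    push_cast
    field_simp at hz ⊢
    linear_combination hz
  rw [hval] at hs
  refine Complex.hasSum_ofReal.1 (hs.congr_fun ?_)
  intro d
  rcases Nat.eq_zero_or_pos d with rfl | hd
  · simp
  · rw [LSeries.term_of_ne_zero hd.ne']
    push_cast
    congr 1
    exact_mod_cast (Complex.cpow_natCast (d : ℂ) 2).symm

/-- The mean value of Euler's function: the terms of `sum_totient_eq`, divided by `n ^ 2`, converge
to those of `(1 / 2) ∑ μ(d) / d ^ 2` and are dominated by `1 / d ^ 2`. -/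
theorem tendsto_sum_totient_div_sq :
    Tendsto (fun n : ℕ => (∑ k ∈ Finset.Ioc 0 n, (Nat.totient k : ℝ)) / (n : ℝ) ^ 2) atTop
      (𝓝 (3 / Real.pi ^ 2)) := by
  set f : ℕ → ℕ → ℝ := fun n d => (ArithmeticFunction.moebius d : ℝ)
        * (((n / d : ℕ) : ℝ) * (((n / d : ℕ) : ℝ) + 1) / 2) / (n : ℝ) ^ 2 with hf
  have hlim : ∀ d : ℕ, Tendsto (f · d) atTop
      (𝓝 ((ArithmeticFunction.moebius d : ℝ) / (d : ℝ) ^ 2 / 2)) := by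
    intro d
    have h1 : Tendsto (fun n : ℕ => ((n / d : ℕ) : ℝ) / n) atTop (𝓝 (1 / (d : ℝ))) := by
      have := (tendsto_nat_floor_mul_div_atTop (R := ℝ) (a := 1 / (d : ℝ)) (by positivity)).comp
        tendsto_natCast_atTop_atTop
      refine this.congr fun n => ?_
      simp only [Function.comp]
      rw [show 1 / (d : ℝ) * n = (n : ℝ) / d by ring, Nat.floor_div_eq_div]
    have h2 := tendsto_one_div_atTop_nhds_zero_nat (𝕜 := ℝ)
    have h3 := ((h1.mul (h1.add h2)).div_const 2).const_mul (ArithmeticFunction.moebius d : ℝ)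
    refine Tendsto.congr' ?_ (h3.trans (le_of_eq ?_))
    · filter_upwards [eventually_gt_atTop 0] with n hn
      have : (n : ℝ) ≠ 0 := by exact_mod_cast hn.ne'
      simp only [hf]
      field_simp
    · congr 1; rcases eq_or_ne (d : ℝ) 0 with h | h
      · simp [h]
      · field_simp; ring
  have hbound : ∀ n d : ℕ, ‖f n d‖ ≤ 1 / (d : ℝ) ^ 2 := by
    intro n d
    have hμ : |(ArithmeticFunction.moebius d : ℝ)| ≤ 1 := by
      exact_mod_cast ArithmeticFunction.abs_moebius_le_one (n := d)
    rcases Nat.eq_zero_or_pos d with rfl | hd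
    · simp [hf]
    rcases Nat.eq_zero_or_pos n with rfl | hn
    · simp [hf]
    have hn' : (0 : ℝ) < n := by exact_mod_cast hn
    have hd' : (0 : ℝ) < d := by exact_mod_cast hd
    have h1 : ((n / d : ℕ) : ℝ) ≤ n / d := Nat.cast_div_le
    have h2 : ((n / d : ℕ) : ℝ) ≤ ((n / d : ℕ) : ℝ) ^ 2 := by
      exact_mod_cast Nat.le_self_pow two_ne_zero (n / d)
    have h3 : ((n / d : ℕ) : ℝ) ^ 2 ≤ ((n : ℝ) / d) ^ 2 := by gcongr
    simp only [hf, Real.norm_eq_abs, abs_div, abs_mul, abs_pow, Nat.abs_cast]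
    rw [div_le_div_iff₀ (by positivity) (by positivity)]
    rw [abs_of_nonneg (by positivity : (0:ℝ) ≤ ((n / d : ℕ) : ℝ) + 1), abs_two]
    have h4 : ((n / d : ℕ) : ℝ) * (((n / d : ℕ) : ℝ) + 1) / 2 ≤ ((n : ℝ) / d) ^ 2 := by nlinarith
    calc _ ≤ 1 * (((n : ℝ) / d) ^ 2) * (d : ℝ) ^ 2 := by gcongr
      _ = 1 * (n : ℝ) ^ 2 := by field_simp
  have hsum : Summable fun d : ℕ => 1 / (d : ℝ) ^ 2 := Real.summable_one_div_nat_pow.2 one_lt_two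
  have h := tendsto_tsum_of_dominated_convergence hsum hlim (Eventually.of_forall hbound)
  rw [(hasSum_moebius_div_sq.div_const 2).tsum_eq] at h
  refine Tendsto.congr ?_ (h.trans (le_of_eq (by congr 1; ring)))
  intro n
  rw [sum_totient_eq, Finset.sum_div]
  refine tsum_eq_sum fun d hd => ?_
  simp only [hf]
  rcases Nat.eq_zero_or_pos d with rfl | hd0
  · simp
  · rw [Nat.div_eq_of_lt (by simp only [Finset.mem_Ioc] at hd; omega)]; simp

/-- `∏ Φ_k(p)` over `1 ≤ k ≤ n`: a common multiple of `p - 1, …, p ^ n - 1`. -/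
noncomputable def cyclotomicProd (p : ℤ) (n : ℕ) : ℤ :=
  ∏ k ∈ Finset.Ioc 0 n, (Polynomial.cyclotomic k ℤ).eval p

theorem prod_eval_cyclotomic (p : ℤ) {i : ℕ} (hi : 0 < i) :
    ∏ k ∈ i.divisors, (Polynomial.cyclotomic k ℤ).eval p = p ^ i - 1 := by
  rw [← Polynomial.eval_prod, Polynomial.prod_cyclotomic_eq_X_pow_sub_one hi]; simp

theorem pow_sub_one_dvd_cyclotomicProd (p : ℤ) {i n : ℕ} (hi : 0 < i) (hin : i ≤ n) :
    p ^ i - 1 ∣ cyclotomicProd p n := by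
  rw [← prod_eval_cyclotomic p hi]
  refine Finset.prod_dvd_prod_of_subset _ _ _ fun k hk => ?_
  have h1 := Nat.pos_of_mem_divisors hk
  have h2 := Nat.divisor_le hk
  exact Finset.mem_Ioc.2 ⟨h1, by omega⟩

theorem inv_abs_le_half {p : ℤ} (hp : 2 ≤ |p|) : |((p : ℝ))⁻¹| ≤ 1 / 2 := by
  have : (2 : ℝ) ≤ |(p : ℝ)| := by exact_mod_cast hp
  rw [abs_inv, one_div]
  exact inv_anti₀ two_pos this

theorem ne_zero_of_two_le_abs {p : ℤ} (hp : 2 ≤ |p|) : (p : ℝ) ≠ 0 := by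
  have : (2 : ℝ) ≤ |(p : ℝ)| := by exact_mod_cast hp
  intro h; rw [h, abs_zero] at this; linarith

theorem pow_sub_one_ne_zero {p : ℤ} (hp : 2 ≤ |p|) {i : ℕ} (hi : 0 < i) : (p : ℝ) ^ i - 1 ≠ 0 := by
  intro h
  have h2 : (2 : ℝ) ≤ |(p : ℝ)| := by exact_mod_cast hp
  have h1 : |(p : ℝ)| ^ i = 1 := by rw [← abs_pow, sub_eq_zero.1 h, abs_one]
  have := one_lt_pow₀ (show 1 < |(p : ℝ)| by linarith) hi.ne'
  linarith

theorem log_abs_pow_sub_one {p : ℤ} (hp : 2 ≤ |p|) {i : ℕ} (hi : 0 < i) :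
    Real.log |(p : ℝ) ^ i - 1|
      = i * Real.log |(p : ℝ)| + Real.log |1 - ((p : ℝ)⁻¹) ^ i| := by
  have h0 := ne_zero_of_two_le_abs hp
  have h1 : (p : ℝ) ^ i - 1 = (p : ℝ) ^ i * (1 - ((p : ℝ)⁻¹) ^ i) := by
    rw [mul_sub, ← mul_pow, mul_inv_cancel₀ h0]; simp
  have h2 := pow_sub_one_ne_zero hp hi
  rw [h1] at h2 ⊢
  rw [abs_mul, Real.log_mul (abs_ne_zero.2 (left_ne_zero_of_mul h2))
    (abs_ne_zero.2 (right_ne_zero_of_mul h2)), abs_pow, Real.log_pow]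

theorem eval_cyclotomic_ne_zero {p : ℤ} (hp : 2 ≤ |p|) {k : ℕ} (hk : 0 < k) :
    (Polynomial.cyclotomic k ℤ).eval p ≠ 0 := by
  intro h
  have h1 := prod_eval_cyclotomic p hk
  rw [Finset.prod_eq_zero (Nat.mem_divisors_self k hk.ne') h] at h1
  exact pow_sub_one_ne_zero hp hk (by exact_mod_cast h1.symm)

theorem cyclotomicProd_ne_zero {p : ℤ} (hp : 2 ≤ |p|) (n : ℕ) : cyclotomicProd p n ≠ 0 :=
  Finset.prod_ne_zero_iff.2 fun _ hk => eval_cyclotomic_ne_zero hp (Finset.mem_Ioc.1 hk).1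

/-- `Φ_k(p)` is `p ^ φ(k)` up to an absolute constant, by Möbius inversion of
`∏_{d ∣ k} Φ_d(p) = p ^ k - 1`. -/
theorem abs_log_eval_cyclotomic_sub_le {p : ℤ} (hp : 2 ≤ |p|) {k : ℕ} (hk : 0 < k) :
    |Real.log |(((Polynomial.cyclotomic k ℤ).eval p : ℤ) : ℝ)|
      - Nat.totient k * Real.log (|(p : ℝ)|)| ≤ 4 := by
  have h := (ArithmeticFunction.sum_eq_iff_sum_mul_moebius_eq (R := ℝ)
    (f := fun k => Real.log |(((Polynomial.cyclotomic k ℤ).eval p : ℤ) : ℝ)|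
      - Nat.totient k * Real.log |(p : ℝ)|)
    (g := fun k => Real.log |1 - ((p : ℝ)⁻¹) ^ k|)).1 (fun i hi => ?_) k hk
  · rw [← h, Nat.sum_divisorsAntidiagonal'
      (f := fun x y => (ArithmeticFunction.moebius x : ℝ) * Real.log |1 - ((p : ℝ)⁻¹) ^ y|)]
    refine (Finset.abs_sum_le_sum_abs _ _).trans (le_trans (Finset.sum_le_sum fun d _ => ?_)
      (sum_abs_log_abs_one_sub_pow_le k.divisors (e := id) (Set.injOn_id _)
        (fun d hd => Nat.pos_of_mem_divisors hd) (inv_abs_le_half hp)))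
    rw [abs_mul]
    refine mul_le_of_le_one_left (abs_nonneg _) ?_
    exact_mod_cast ArithmeticFunction.abs_moebius_le_one
  · rw [Finset.sum_sub_distrib, ← Finset.sum_mul, ← Nat.cast_sum, Nat.sum_totient,
      ← Real.log_prod, ← Finset.abs_prod, ← Int.cast_prod, prod_eval_cyclotomic p hi]
    · push_cast; rw [log_abs_pow_sub_one hp hi]; ring
    · intro d hd
      exact abs_ne_zero.2 (by exact_mod_cast
        eval_cyclotomic_ne_zero hp (Nat.pos_of_mem_divisors hd))

theorem tendsto_log_cyclotomicProd_div_sq {p : ℤ} (hp : 2 ≤ |p|) :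
    Tendsto (fun n : ℕ => Real.log |(cyclotomicProd p n : ℝ)| / (n : ℝ) ^ 2) atTop
      (𝓝 (3 / Real.pi ^ 2 * Real.log |(p : ℝ)|)) := by
  have h1 := tendsto_sum_totient_div_sq.mul_const (Real.log |(p : ℝ)|)
  have h2 : Tendsto (fun n : ℕ => (Real.log |(cyclotomicProd p n : ℝ)|
      - (∑ k ∈ Finset.Ioc 0 n, (Nat.totient k : ℝ)) * Real.log |(p : ℝ)|) / (n : ℝ) ^ 2) atTop
      (𝓝 0) := by
    refine squeeze_zero_norm (a := fun n : ℕ => 4 * (1 / (n : ℝ))) (fun n => ?_) ?_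
    · rcases Nat.eq_zero_or_pos n with rfl | hn
      · simp
      have hn' : (0 : ℝ) < n := by exact_mod_cast hn
      have : |Real.log |(cyclotomicProd p n : ℝ)|
          - (∑ k ∈ Finset.Ioc 0 n, (Nat.totient k : ℝ)) * Real.log (|(p : ℝ)|)| ≤ 4 * n := by
        rw [cyclotomicProd, Int.cast_prod, Finset.abs_prod, Real.log_prod, Finset.sum_mul,
          ← Finset.sum_sub_distrib]
        · refine (Finset.abs_sum_le_sum_abs _ _).trans ((Finset.sum_le_sum fun k hk =>
            abs_log_eval_cyclotomic_sub_le hp (Finset.mem_Ioc.1 hk).1).trans ?_)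
          simp; linarith
        · intro k hk
          exact abs_ne_zero.2 (by exact_mod_cast
            eval_cyclotomic_ne_zero hp (Finset.mem_Ioc.1 hk).1)
      rw [Real.norm_eq_abs, abs_div, abs_of_pos (by positivity : (0 : ℝ) < (n : ℝ) ^ 2),
        div_le_iff₀ (by positivity)]
      refine this.trans (le_of_eq ?_)
      field_simp
    · simpa using (tendsto_one_div_atTop_nhds_zero_nat (𝕜 := ℝ)).const_mul 4
  have h3 := h2.add h1
  rw [zero_add] at h3
  refine h3.congr fun n => ?_
  ring

/-! ### Partial fractions with simple poles at powers of `p` -/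

/-- The function `X ↦ 1 / (p ^ j X - 1)`, with a simple pole at `p ^ (-j)`. -/
noncomputable def simplePole (p : ℤ) (j : ℕ) (X : ℝ) : ℝ := ((p : ℝ) ^ j * X - 1)⁻¹

/-- `F` is, away from the poles `p ^ (-j)` with `j ≤ n`, a combination of the functions
`(p ^ j X - 1) ^ (-s)` with `1 ≤ s ≤ σ` and `j ≤ n`; the coefficients have absolute sum at most
`B`, and the one of index `(s, j)` becomes an integer after multiplication by `P D ^ (σ - s)`. -/
def HasPartialFractions (p D : ℤ) (n σ : ℕ) (P : ℤ) (B : ℝ) (F : ℝ → ℝ) : Prop :=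
  ∃ b : ℕ → ℕ → ℝ,
    (∀ s ∈ Finset.Icc 1 σ, ∀ j ∈ Finset.range (n + 1),
      ∃ z : ℤ, (P : ℝ) * (D : ℝ) ^ (σ - s) * b s j = z) ∧
    ∑ s ∈ Finset.Icc 1 σ, ∑ j ∈ Finset.range (n + 1), |b s j| ≤ B ∧
    ∀ X : ℝ, (∀ j ≤ n, (p : ℝ) ^ j * X ≠ 1) →
      F X = ∑ s ∈ Finset.Icc 1 σ, ∑ j ∈ Finset.range (n + 1), b s j * simplePole p j X ^ s

namespace HasPartialFractions

variable {p D : ℤ} {n σ τ : ℕ} {P Q : ℤ} {B B' : ℝ} {F G : ℝ → ℝ}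

theorem mono (h : HasPartialFractions p D n σ P B F) (hB : B ≤ B') :
    HasPartialFractions p D n σ P B' F := by
  obtain ⟨b, h1, h2, h3⟩ := h
  exact ⟨b, h1, h2.trans hB, h3⟩

theorem congr (h : HasPartialFractions p D n σ P B F)
    (hG : ∀ X : ℝ, (∀ j ≤ n, (p : ℝ) ^ j * X ≠ 1) → G X = F X) :
    HasPartialFractions p D n σ P B G := by
  obtain ⟨b, h1, h2, h3⟩ := h
  exact ⟨b, h1, h2, fun X hX => (hG X hX).trans (h3 X hX)⟩

theorem zero : HasPartialFractions p D n σ P 0 (fun _ => 0) :=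
  ⟨fun _ _ => 0, fun _ _ _ _ => ⟨0, by simp⟩, by simp, fun _ _ => by simp⟩

theorem add (hF : HasPartialFractions p D n σ P B F) (hG : HasPartialFractions p D n σ P B' G) :
    HasPartialFractions p D n σ P (B + B') (fun X => F X + G X) := by
  obtain ⟨b, h1, h2, h3⟩ := hF
  obtain ⟨c, k1, k2, k3⟩ := hG
  refine ⟨fun s j => b s j + c s j, fun s hs j hj => ?_, ?_, fun X hX => ?_⟩
  · obtain ⟨z, hz⟩ := h1 s hs j hj
    obtain ⟨w, hw⟩ := k1 s hs j hj
    exact ⟨z + w, by push_cast; rw [← hz, ← hw]; ring⟩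
  · refine le_trans ?_ (add_le_add h2 k2)
    simp only [← Finset.sum_add_distrib]
    exact Finset.sum_le_sum fun s _ => Finset.sum_le_sum fun j _ => abs_add_le _ _
  · beta_reduce
    rw [h3 X hX, k3 X hX]
    simp only [← Finset.sum_add_distrib, add_mul]

theorem sum {ι : Type*} (s : Finset ι) {B : ι → ℝ} {F : ι → ℝ → ℝ}
    (h : ∀ i ∈ s, HasPartialFractions p D n σ P (B i) (F i)) :
    HasPartialFractions p D n σ P (∑ i ∈ s, B i) (fun X => ∑ i ∈ s, F i X) := by
  classical
  induction s using Finset.induction_on with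
  | empty => simpa using zero
  | insert a s ha ih =>
    simp only [Finset.sum_insert ha]
    exact (h a (Finset.mem_insert_self _ _)).add
      (ih fun i hi => h i (Finset.mem_insert_of_mem hi))

theorem smul (h : HasPartialFractions p D n σ P B F) {c : ℝ} (hστ : σ ≤ τ)
    (hc : ∃ z : ℤ, (Q : ℝ) * (D : ℝ) ^ (τ - σ) * c = z) :
    HasPartialFractions p D n τ (P * Q) (|c| * B) (fun X => c * F X) := by
  obtain ⟨b, h1, h2, h3⟩ := h
  obtain ⟨w, hw⟩ := hc
  have hsub : Finset.Icc 1 σ ⊆ Finset.Icc 1 τ := Finset.Icc_subset_Icc_right hστ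
  have hnot : ∀ s ∈ Finset.Icc 1 τ, s ∉ Finset.Icc 1 σ → ¬ s ≤ σ := by
    intro s hs hs' h; simp only [Finset.mem_Icc] at hs hs'; omega
  refine ⟨fun s j => if s ≤ σ then c * b s j else 0, fun s hs j hj => ?_, ?_, fun X hX => ?_⟩
  · by_cases hsσ : s ≤ σ
    · obtain ⟨z, hz⟩ := h1 s (by simp only [Finset.mem_Icc] at hs ⊢; omega) j hj
      refine ⟨w * z, ?_⟩
      beta_reduce
      rw [if_pos hsσ]
      push_cast
      rw [← hz, ← hw, show τ - s = (τ - σ) + (σ - s) by omega, pow_add]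
      ring
    · exact ⟨0, by simp [hsσ]⟩
  · rw [← Finset.sum_subset hsub fun s hs hs' => by simp [hnot s hs hs']]
    refine le_trans (le_of_eq ?_) (mul_le_mul_of_nonneg_left h2 (abs_nonneg c))
    simp only [Finset.mul_sum]
    refine Finset.sum_congr rfl fun s hs => Finset.sum_congr rfl fun j _ => ?_
    rw [if_pos (Finset.mem_Icc.1 hs).2, abs_mul]
  · beta_reduce
    rw [← Finset.sum_subset hsub fun s hs hs' => by simp [hnot s hs hs'], h3 X hX]
    simp only [Finset.mul_sum]
    refine Finset.sum_congr rfl fun s hs => Finset.sum_congr rfl fun j _ => ?_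
    rw [if_pos (Finset.mem_Icc.1 hs).2, mul_assoc]

theorem simplePole_pow {j s : ℕ} (hj : j ≤ n) (hs : 1 ≤ s) :
    HasPartialFractions p D n s 1 1 (fun X => simplePole p j X ^ s) := by
  have hmem : s ∈ Finset.Icc 1 s := Finset.mem_Icc.2 ⟨hs, le_rfl⟩
  have hjmem : j ∈ Finset.range (n + 1) := Finset.mem_range.2 (by omega)
  refine ⟨fun s' j' => if s' = s then (if j' = j then 1 else 0) else 0, fun s' hs' j' _ => ?_, ?_,
    fun X _ => ?_⟩
  · rcases eq_or_ne s' s with rfl | h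
    · rcases eq_or_ne j' j with rfl | h'
      · exact ⟨1, by simp⟩
      · exact ⟨0, by simp [h']⟩
    · exact ⟨0, by simp [h]⟩
  · rw [Finset.sum_eq_single_of_mem s hmem fun b _ hb => by simp [hb],
      Finset.sum_eq_single_of_mem j hjmem fun b _ hb => by simp [hb]]
    simp
  · rw [Finset.sum_eq_single_of_mem s hmem fun b _ hb => by simp [hb],
      Finset.sum_eq_single_of_mem j hjmem fun b _ hb => by simp [hb]]
    simp

/-- The partial fractions of a product of two simple poles have coefficients bounded by `2`, whose
denominators divide some `p ^ i - 1` with `1 ≤ i ≤ n`: no power of `p` is lost. -/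
theorem exists_simplePole_mul (hp : 2 ≤ |p|) (hD : ∀ i, 0 < i → i ≤ n → p ^ i - 1 ∣ D)
    {i j : ℕ} (hi : i ≤ n) (hj : j ≤ n) (hij : i ≠ j) :
    ∃ α β : ℝ, (∃ z : ℤ, (D : ℝ) * α = z) ∧ (∃ z : ℤ, (D : ℝ) * β = z) ∧ |α| ≤ 2 ∧ |β| ≤ 2 ∧
      ∀ X : ℝ, (∀ j ≤ n, (p : ℝ) ^ j * X ≠ 1) →
        simplePole p j X * simplePole p i X = α * simplePole p i X + β * simplePole p j X := by
  -- by symmetry it is enough to treat `i < j`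
  wlog h : i < j generalizing i j
  · obtain ⟨α, β, h1, h2, h3, h4, h5⟩ := this hj hi hij.symm (by omega)
    exact ⟨β, α, h2, h1, h4, h3, fun X hX => by rw [mul_comm, h5 X hX, add_comm]⟩
  obtain ⟨d, rfl⟩ := Nat.exists_eq_add_of_lt h
  have hne : (p : ℝ) ^ (d + 1) - 1 ≠ 0 := pow_sub_one_ne_zero hp (Nat.succ_pos d)
  have hlow : (1 : ℝ) ≤ |(p : ℝ) ^ (d + 1) - 1| := by
    have : 1 ≤ |p ^ (d + 1) - 1| := Int.one_le_abs (by exact_mod_cast hne)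
    exact_mod_cast this
  obtain ⟨e, he⟩ := hD (d + 1) (Nat.succ_pos d) (by omega)
  have heR : (D : ℝ) = ((p : ℝ) ^ (d + 1) - 1) * e := by exact_mod_cast he
  have hβ : |1 / ((p : ℝ) ^ (d + 1) - 1)| ≤ 1 := by
    rw [abs_div, abs_one]; exact div_le_one_of_le₀ hlow (abs_nonneg _)
  refine ⟨1 / ((p : ℝ) ^ (d + 1) - 1), -(1 + 1 / ((p : ℝ) ^ (d + 1) - 1)), ⟨e, ?_⟩,
    ⟨-(D + e), ?_⟩, hβ.trans one_le_two, ?_, fun X hX => ?_⟩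
  · rw [heR]; field_simp
  · push_cast; rw [heR]; field_simp
  · rw [abs_neg]; exact (abs_add_le _ _).trans (by rw [abs_one]; linarith)
  · have hXi : (p : ℝ) ^ i * X - 1 ≠ 0 := sub_ne_zero.2 (hX i hi)
    have hXj : (p : ℝ) ^ (i + d + 1) * X - 1 ≠ 0 := sub_ne_zero.2 (hX _ hj)
    rw [add_assoc, pow_add] at hXj
    simp only [simplePole]
    rw [add_assoc, pow_add]
    generalize (p : ℝ) ^ i = a at *
    generalize (p : ℝ) ^ (d + 1) = b at *
    have hu := mul_inv_cancel₀ hXi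
    have hv := mul_inv_cancel₀ hXj
    have hw := mul_inv_cancel₀ hne
    rw [one_div]
    generalize (a * X - 1)⁻¹ = u at *
    generalize (a * b * X - 1)⁻¹ = v at *
    generalize (b - 1)⁻¹ = w at *
    linear_combination (-(u * v) - u * v * (a * X - 1)) * hw + (w * u) * hv - (v * (1 + w)) * hu

/-- The bound `4 ^ s` comes from `s` applications of `exists_simplePole_mul`: each one replaces a
product by two terms with coefficients at most `2`. -/
theorem simplePole_pow_mul (hp : 2 ≤ |p|) (hD : ∀ i, 0 < i → i ≤ n → p ^ i - 1 ∣ D)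
    {i j : ℕ} (hi : i ≤ n) (hj : j ≤ n) (s : ℕ) :
    HasPartialFractions p D n (s + 1) 1 (4 ^ s)
      (fun X => simplePole p j X ^ s * simplePole p i X) := by
  rcases eq_or_ne i j with rfl | hij
  · simp only [← pow_succ]
    exact (simplePole_pow hi (Nat.succ_pos s)).mono (one_le_pow₀ (by norm_num))
  obtain ⟨α, β, hα, hβ, hα2, hβ2, hmul⟩ := exists_simplePole_mul hp hD hi hj hij
  induction s with
  | zero => simpa using simplePole_pow (p := p) (D := D) hi le_rfl
  | succ s ih =>
    have h1 := ih.smul (Q := 1) (c := α) (Nat.le_succ (s + 1)) (by simpa using hα)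
    have h2 := (simplePole_pow (p := p) (D := D) hj (Nat.succ_pos s)).smul (Q := 1) (c := β)
      (Nat.le_succ (s + 1)) (by simpa using hβ)
    refine ((h1.add h2).congr fun X hX => ?_).mono ?_
    · rw [pow_succ]; linear_combination simplePole p j X ^ s * hmul X hX
    · have : (1 : ℝ) ≤ 4 ^ s := one_le_pow₀ (by norm_num)
      rw [pow_succ]
      nlinarith

/-- Multiplication by a combination of simple poles. -/
theorem mul_simplePoles (hp : 2 ≤ |p|) (hD : ∀ i, 0 < i → i ≤ n → p ^ i - 1 ∣ D)
    (hF : HasPartialFractions p D n σ P B F) {g : ℕ → ℝ}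
    (hg : ∀ i ∈ Finset.range (n + 1), ∃ z : ℤ, (Q : ℝ) * g i = z)
    (hgB : ∑ i ∈ Finset.range (n + 1), |g i| ≤ B')
    (hG : ∀ X : ℝ, (∀ j ≤ n, (p : ℝ) ^ j * X ≠ 1) →
      G X = ∑ i ∈ Finset.range (n + 1), g i * simplePole p i X) :
    HasPartialFractions p D n (σ + 1) (P * Q) (4 ^ σ * (B * B')) (fun X => F X * G X) := by
  obtain ⟨b, h1, h2, h3⟩ := hF
  have hterm : ∀ s ∈ Finset.Icc 1 σ, ∀ j ∈ Finset.range (n + 1), ∀ i ∈ Finset.range (n + 1),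
      HasPartialFractions p D n (σ + 1) (P * Q) (|b s j * g i| * 4 ^ σ)
        (fun X => b s j * g i * (simplePole p j X ^ s * simplePole p i X)) := by
    intro s hs j hj i hi
    have hs' := Finset.mem_Icc.1 hs
    have hi' := Finset.mem_range.1 hi
    have hj' := Finset.mem_range.1 hj
    have h := (simplePole_pow_mul hp hD (show i ≤ n by omega) (show j ≤ n by omega) s).mono
      (pow_le_pow_right₀ (by norm_num) hs'.2 : (4 : ℝ) ^ s ≤ 4 ^ σ)
    have := h.smul (Q := P * Q) (c := b s j * g i) (τ := σ + 1) (by omega) (by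
      obtain ⟨z, hz⟩ := h1 s hs j hj
      obtain ⟨w, hw⟩ := hg i hi
      refine ⟨z * w, ?_⟩
      push_cast
      rw [← hz, ← hw]; ring)
    rwa [one_mul] at this
  have hsum := HasPartialFractions.sum (Finset.Icc 1 σ) fun s hs =>
    HasPartialFractions.sum (Finset.range (n + 1)) fun j hj =>
      HasPartialFractions.sum (Finset.range (n + 1)) fun i hi => hterm s hs j hj i hi
  refine (hsum.congr fun X hX => ?_).mono ?_
  · rw [h3 X hX, hG X hX]
    simp only [Finset.sum_mul]
    refine Finset.sum_congr rfl fun s _ => Finset.sum_congr rfl fun j _ => ?_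
    rw [Finset.mul_sum]
    exact Finset.sum_congr rfl fun i _ => by ring
  · simp only [abs_mul, ← Finset.sum_mul, ← Finset.mul_sum]
    rw [mul_comm]
    refine mul_le_mul_of_nonneg_left ?_ (by positivity)
    have h0 : 0 ≤ ∑ i ∈ Finset.range (n + 1), |g i| := Finset.sum_nonneg fun _ _ => abs_nonneg _
    have hB0 : 0 ≤ B := le_trans
      (Finset.sum_nonneg fun _ _ => Finset.sum_nonneg fun _ _ => abs_nonneg _) h2
    exact mul_le_mul h2 hgB h0 hB0

end HasPartialFractions

/-- The product `(p - 1) (p ^ 2 - 1) ⋯ (p ^ n - 1)`. -/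
def qFactorial (p : ℤ) (n : ℕ) : ℤ := ∏ i ∈ Finset.range n, (p ^ (i + 1) - 1)

theorem qFactorial_succ (p : ℤ) (n : ℕ) :
    qFactorial p (n + 1) = qFactorial p n * (p ^ (n + 1) - 1) := Finset.prod_range_succ _ _

/-- Gaussian binomial coefficients are integers. -/
theorem qFactorial_mul_dvd (p : ℤ) (j k : ℕ) : qFactorial p j * qFactorial p k ∣
    qFactorial p (j + k) := by
  induction h : j + k generalizing j k with
  | zero => obtain ⟨rfl, rfl⟩ : j = 0 ∧ k = 0 := by omega
            simp [qFactorial]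
  | succ n ih =>
    rcases Nat.eq_zero_or_pos j with rfl | hj
    · simp only [zero_add] at h; subst h; simp [qFactorial]
    rcases Nat.eq_zero_or_pos k with rfl | hk
    · simp only [add_zero] at h; subst h; simp [qFactorial]
    obtain ⟨j, rfl⟩ := Nat.exists_eq_succ_of_ne_zero hj.ne'
    obtain ⟨k, rfl⟩ := Nat.exists_eq_succ_of_ne_zero hk.ne'
    have h1 := ih (j + 1) k (by omega)
    have h2 := ih j (k + 1) (by omega)
    have e : qFactorial p (n + 1)
        = qFactorial p n * (p ^ (k + 1) - 1) + qFactorial p n * (p ^ (j + 1) - 1) * p ^ (k + 1) := by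
      have : n = j + (k + 1) := by omega
      rw [qFactorial_succ, this]; ring
    rw [e]
    refine dvd_add ?_ (Dvd.dvd.mul_right ?_ _)
    · simp only [Nat.succ_eq_add_one, qFactorial_succ p k, ← mul_assoc]
      exact mul_dvd_mul_right h1 _
    · simp only [Nat.succ_eq_add_one, qFactorial_succ p j]
      rw [mul_right_comm]
      exact mul_dvd_mul_right h2 _

theorem qFactorial_ne_zero {p : ℤ} (hp : 2 ≤ |p|) (n : ℕ) : (qFactorial p n : ℝ) ≠ 0 := by
  simp only [qFactorial]; push_cast
  exact Finset.prod_ne_zero_iff.2 fun i _ => pow_sub_one_ne_zero hp (Nat.succ_pos i)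

theorem sum_range_cast_add_one (n : ℕ) :
    ∑ i ∈ Finset.range n, ((i + 1 : ℕ) : ℝ) = (n : ℝ) * (n + 1) / 2 := by
  induction n with
  | zero => simp
  | succ k ih => rw [Finset.sum_range_succ, ih]; push_cast; ring

/-- A product of factors `p ^ e - 1` with distinct exponents `e` is, up to an absolute constant,
the product of the `p ^ e`. -/
theorem abs_log_prod_pow_sub_one_sub_le {p : ℤ} (hp : 2 ≤ |p|) {ι : Type*} (s : Finset ι)
    {e : ι → ℕ} (he : Set.InjOn e s) (he1 : ∀ i ∈ s, 1 ≤ e i) :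
    |Real.log (|∏ i ∈ s, ((p : ℝ) ^ e i - 1)|)
      - (∑ i ∈ s, (e i : ℝ)) * Real.log (|(p : ℝ)|)| ≤ 4 := by
  rw [Finset.abs_prod, Real.log_prod fun i hi =>
    abs_ne_zero.2 (pow_sub_one_ne_zero hp (he1 i hi)), Finset.sum_mul, ← Finset.sum_sub_distrib]
  refine (Finset.abs_sum_le_sum_abs _ _).trans (le_trans (Finset.sum_le_sum fun i hi => ?_)
    (sum_abs_log_abs_one_sub_pow_le s he he1 (inv_abs_le_half hp)))
  rw [log_abs_pow_sub_one hp (he1 i hi), add_sub_cancel_left]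

theorem abs_log_qFactorial_sub_le {p : ℤ} (hp : 2 ≤ |p|) (n : ℕ) :
    |Real.log (|(qFactorial p n : ℝ)|)
      - (n : ℝ) * (n + 1) / 2 * Real.log (|(p : ℝ)|)| ≤ 4 := by
  have := abs_log_prod_pow_sub_one_sub_le hp (Finset.range n) (e := fun i => i + 1)
    (fun a _ b _ h => by simpa using h) (fun i _ => Nat.succ_pos i)
  rw [sum_range_cast_add_one] at this
  simpa [qFactorial] using this

theorem prod_range_pow_add_one (x : ℝ) (j : ℕ) :
    ∏ l ∈ Finset.range j, x ^ (l + 1) = x ^ (j * (j + 1) / 2) := by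
  rw [Finset.prod_pow_eq_pow_sum]
  congr 1
  induction j with
  | zero => simp
  | succ k ih =>
    rw [Finset.sum_range_succ, ih]
    have : (k + 1) * (k + 1 + 1) = k * (k + 1) + 2 * (k + 1) := by ring
    omega

/-- The factors of `∏_{l ≤ n} (p ^ l X - 1)` other than the `j`-th, at `X = p ^ (-j)`, in terms of
`q`-factorials; this makes the residues of a brick Gaussian binomial coefficients times values of its numerator. -/
theorem prod_erase_pow_div_sub_one {p : ℤ} (hp : 2 ≤ |p|) {n j : ℕ} (hj : j ≤ n) :
    (-1) ^ j * (p : ℝ) ^ (j * (j + 1) / 2)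
        * ∏ l ∈ (Finset.range (n + 1)).erase j, ((p : ℝ) ^ l * ((p : ℝ) ^ j)⁻¹ - 1)
      = qFactorial p j * qFactorial p (n - j) := by
  have hp0 := ne_zero_of_two_le_abs hp
  set f : ℕ → ℝ := fun l => if l = j then 1 else (p : ℝ) ^ l * ((p : ℝ) ^ j)⁻¹ - 1 with hf
  have h1 : ∏ l ∈ (Finset.range (n + 1)).erase j, ((p : ℝ) ^ l * ((p : ℝ) ^ j)⁻¹ - 1)
      = ∏ l ∈ Finset.range (j + (1 + (n - j))), f l := by
    rw [show j + (1 + (n - j)) = n + 1 by omega,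
      ← Finset.mul_prod_erase (Finset.range (n + 1)) f (Finset.mem_range.2 (by omega : j < n + 1))]
    simp only [hf, if_true, one_mul]
    exact Finset.prod_congr rfl fun l hl => by rw [if_neg (Finset.ne_of_mem_erase hl)]
  have h2 : ∏ l ∈ Finset.range j, f l
      = (-1) ^ j * (qFactorial p j : ℝ) / (p : ℝ) ^ (j * (j + 1) / 2) := by
    rw [← Finset.prod_range_reflect, ← prod_range_pow_add_one, qFactorial]
    push_cast
    rw [← Finset.card_range j, ← Finset.prod_const, Finset.card_range, ← Finset.prod_mul_distrib,
      ← Finset.prod_div_distrib]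
    refine Finset.prod_congr rfl fun l hl => ?_
    have hl' := Finset.mem_range.1 hl
    have e : (p : ℝ) ^ j = (p : ℝ) ^ (j - 1 - l) * (p : ℝ) ^ (l + 1) := by
      rw [← pow_add]; congr 1; omega
    simp only [hf]
    rw [if_neg (by omega), e]
    field_simp
    ring
  have h3 : ∏ l ∈ Finset.range (n - j), f (j + (1 + l)) = (qFactorial p (n - j) : ℝ) := by
    rw [qFactorial]; push_cast
    refine Finset.prod_congr rfl fun l _ => ?_
    simp only [hf]
    rw [if_neg (by omega), pow_add]
    field_simp
    rw [add_comm]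
  rw [h1, Finset.prod_range_add, Finset.prod_range_add, h2, h3, Finset.prod_range_one]
  simp only [hf, add_zero, if_true]
  field_simp
  rw [← pow_mul, mul_comm j 2, pow_mul]
  norm_num

/-- Partial fractions of `(p - 1) ⋯ (p ^ n - 1) N(X) / ∏_{j ≤ n} (p ^ j X - 1)`, by Lagrange
interpolation; the integer `z j` is, up to sign, a Gaussian binomial coefficient. -/
theorem exists_brick_eq_sum {p : ℤ} (hp : 2 ≤ |p|) (n : ℕ) :
    ∃ z : ℕ → ℤ,
      (∀ j ≤ n, |(z j : ℝ)| ≤ Real.exp 12 * |(p : ℝ)| ^ (j * (n - j))) ∧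
      ∀ N : Polynomial ℝ, N.natDegree ≤ n → ∀ X : ℝ, (∀ j ≤ n, (p : ℝ) ^ j * X ≠ 1) →
        (qFactorial p n : ℝ) * N.eval X / ∏ j ∈ Finset.range (n + 1), ((p : ℝ) ^ j * X - 1)
          = ∑ j ∈ Finset.range (n + 1),
            (z j * (p : ℝ) ^ (j * (j + 1) / 2) * N.eval ((p : ℝ) ^ j)⁻¹) * simplePole p j X := by
  have hp0 := ne_zero_of_two_le_abs hp
  have hdvd : ∀ j, ∃ w : ℤ, j ≤ n → qFactorial p n = qFactorial p j * qFactorial p (n - j) * w := by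
    intro j
    by_cases hj : j ≤ n
    · obtain ⟨w, hw⟩ := qFactorial_mul_dvd p j (n - j)
      rw [Nat.add_sub_cancel' hj] at hw
      exact ⟨w, fun _ => hw⟩
    · exact ⟨0, fun h => absurd h hj⟩
  choose w hw using hdvd
  refine ⟨fun j => (-1) ^ j * w j, fun j hj => ?_, fun N hN X hX => ?_⟩
  · have ha : (1 : ℝ) < |(p : ℝ)| := by
      have : (2 : ℝ) ≤ |(p : ℝ)| := by exact_mod_cast hp
      linarith
    have e : (qFactorial p n : ℝ) = qFactorial p j * qFactorial p (n - j) * w j := by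
      exact_mod_cast hw j hj
    have n0 := qFactorial_ne_zero hp n
    have n1 := qFactorial_ne_zero hp j
    have n2 := qFactorial_ne_zero hp (n - j)
    have hw0 : (w j : ℝ) ≠ 0 := fun h => n0 (by rw [e, h, mul_zero])
    push_cast
    rw [abs_mul, abs_pow, abs_neg, abs_one, one_pow, one_mul,
      ← Real.log_le_log_iff (abs_pos.2 hw0) (by positivity),
      Real.log_mul (Real.exp_pos _).ne' (by positivity), Real.log_exp, Real.log_pow]
    have l := congrArg (fun x => Real.log |x|) e
    simp only [abs_mul] at l
    rw [Real.log_mul (mul_ne_zero (abs_ne_zero.2 n1) (abs_ne_zero.2 n2)) (abs_ne_zero.2 hw0),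
      Real.log_mul (abs_ne_zero.2 n1) (abs_ne_zero.2 n2)] at l
    have b0 := (abs_le.1 (abs_log_qFactorial_sub_le hp n)).2
    have b1 := (abs_le.1 (abs_log_qFactorial_sub_le hp j)).1
    have b2 := (abs_le.1 (abs_log_qFactorial_sub_le hp (n - j))).1
    push_cast [Nat.cast_sub hj] at b0 b1 b2 ⊢
    have : (n : ℝ) * (n + 1) / 2 * Real.log |(p : ℝ)| - (j : ℝ) * (j + 1) / 2 * Real.log |(p : ℝ)|
      - ((n : ℝ) - j) * ((n : ℝ) - j + 1) / 2 * Real.log |(p : ℝ)|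
        = (j * (n - j)) * Real.log |(p : ℝ)| := by ring
    linarith
  · set v : ℕ → ℝ := fun j => ((p : ℝ) ^ j)⁻¹ with hv
    have hinj : Set.InjOn v (Finset.range (n + 1)) := by
      intro a _ b _ hab
      simp only [hv, inv_inj] at hab
      have h2 : (1 : ℝ) < |(p : ℝ)| := by
        have : (2 : ℝ) ≤ |(p : ℝ)| := by exact_mod_cast hp
        linarith
      have := congrArg abs hab
      rw [abs_pow, abs_pow] at this
      exact pow_right_injective₀ (by linarith) h2.ne' this
    have hdeg : N.degree < (Finset.range (n + 1)).card := by
      rw [Finset.card_range]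
      exact lt_of_le_of_lt Polynomial.degree_le_natDegree (by exact_mod_cast Nat.lt_succ_of_le hN)
    have hint := congrArg (Polynomial.eval X) (Lagrange.eq_interpolate hinj hdeg)
    rw [Lagrange.interpolate_apply, Polynomial.eval_finsetSum] at hint
    rw [hint, Finset.mul_sum, Finset.sum_div]
    refine Finset.sum_congr rfl fun j hj => ?_
    have hj' : j ≤ n := by have := Finset.mem_range.1 hj; omega
    have hX0 : ∀ l ∈ Finset.range (n + 1), (p : ℝ) ^ l * X - 1 ≠ 0 := fun l hl =>
      sub_ne_zero.2 (hX l (by have := Finset.mem_range.1 hl; omega))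
    have hB : Polynomial.eval X (Lagrange.basis (Finset.range (n + 1)) v j)
        = (∏ l ∈ (Finset.range (n + 1)).erase j, ((p : ℝ) ^ l * X - 1))
          / ∏ l ∈ (Finset.range (n + 1)).erase j, ((p : ℝ) ^ l * ((p : ℝ) ^ j)⁻¹ - 1) := by
      rw [Lagrange.basis, Polynomial.eval_prod, ← Finset.prod_div_distrib]
      refine Finset.prod_congr rfl fun l _ => ?_
      simp only [Lagrange.basisDivisor, Polynomial.eval_mul, Polynomial.eval_C, Polynomial.eval_sub,
        Polynomial.eval_X, hv]
      have hl : (p : ℝ) ^ l ≠ 0 := pow_ne_zero _ hp0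
      have e1 : X - ((p : ℝ) ^ l)⁻¹ = ((p : ℝ) ^ l)⁻¹ * ((p : ℝ) ^ l * X - 1) := by
        field_simp
      have e2 : ((p : ℝ) ^ j)⁻¹ - ((p : ℝ) ^ l)⁻¹
          = ((p : ℝ) ^ l)⁻¹ * ((p : ℝ) ^ l * ((p : ℝ) ^ j)⁻¹ - 1) := by
        field_simp
      rw [e1, e2, mul_inv, inv_inv, div_eq_mul_inv]
      field_simp
    rw [Polynomial.eval_mul, Polynomial.eval_C, hB, ← Finset.mul_prod_erase _ _ hj]
    have hprod := prod_erase_pow_div_sub_one hp hj'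
    have e : (qFactorial p n : ℝ) = qFactorial p j * qFactorial p (n - j) * w j := by
      exact_mod_cast hw j hj'
    have hne1 : ∏ l ∈ (Finset.range (n + 1)).erase j, ((p : ℝ) ^ l * ((p : ℝ) ^ j)⁻¹ - 1) ≠ 0 := by
      intro h
      rw [h, mul_zero] at hprod
      exact mul_ne_zero (qFactorial_ne_zero hp j) (qFactorial_ne_zero hp (n - j)) hprod.symm
    have hne2 : ∏ l ∈ (Finset.range (n + 1)).erase j, ((p : ℝ) ^ l * X - 1) ≠ 0 :=
      Finset.prod_ne_zero_iff.2 fun l hl => hX0 l (Finset.mem_of_mem_erase hl)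
    have hne3 := hX0 j hj
    rw [e, ← hprod]
    simp only [simplePole]
    push_cast
    generalize ∏ l ∈ (Finset.range (n + 1)).erase j, ((p : ℝ) ^ l * ((p : ℝ) ^ j)⁻¹ - 1) = a at *
    generalize ∏ l ∈ (Finset.range (n + 1)).erase j, ((p : ℝ) ^ l * X - 1) = b at *
    field_simp
    simp only [hv, one_div]

/-! ### `q`-zeta values as Lambert series -/

/-- The polynomials `g k` with `∑_{m ≥ 1} m ^ k x ^ m = g k (x / (1 - x))`; the recursion expresses
the operator `x d/dx` in the variable `u = x / (1 - x)`. -/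
noncomputable def polylogPoly : ℕ → Polynomial ℤ
  | 0 => Polynomial.X
  | k + 1 => Polynomial.X * (Polynomial.X + 1) * Polynomial.derivative (polylogPoly k)

theorem natDegree_polylogPoly_le (k : ℕ) : (polylogPoly k).natDegree ≤ k + 1 := by
  induction k with
  | zero => exact Polynomial.natDegree_X_le
  | succ k ih =>
    refine Polynomial.natDegree_mul_le.trans ?_
    have h1 := Polynomial.natDegree_derivative_le (polylogPoly k)
    have h2 : (Polynomial.X * (Polynomial.X + 1) : Polynomial ℤ).natDegree ≤ 2 :=
      Polynomial.natDegree_mul_le.trans (by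
        have h3 := Polynomial.natDegree_X_le (R := ℤ)
        have h4 : (Polynomial.X + 1 : Polynomial ℤ).natDegree ≤ 1 :=
          (Polynomial.natDegree_add_le _ _).trans (by simp)
        omega)
    omega

/-- The inversion `x ↦ 1 / x` becomes `u ↦ -1 - u` in the variable `u = x / (1 - x)`. -/
theorem polylogPoly_comp (k : ℕ) : (polylogPoly (k + 1)).comp (-1 - Polynomial.X)
    = (-1) ^ k * polylogPoly (k + 1) := by
  induction k with
  | zero => simp [polylogPoly]; ring
  | succ k ih =>
    have h := congrArg Polynomial.derivative ih
    rw [Polynomial.derivative_comp, show ((-1 : Polynomial ℤ) ^ k) = Polynomial.C ((-1) ^ k) by simp,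
      Polynomial.derivative_C_mul] at h
    simp only [Polynomial.derivative_sub, Polynomial.derivative_neg, Polynomial.derivative_one,
      Polynomial.derivative_X, neg_zero, zero_sub] at h
    rw [polylogPoly, Polynomial.mul_comp, Polynomial.mul_comp, Polynomial.add_comp,
      Polynomial.X_comp, Polynomial.one_comp]
    simp only [map_pow, map_neg, map_one] at h
    rw [pow_succ]
    linear_combination (-(Polynomial.X * (Polynomial.X + 1) : Polynomial ℤ)) * h

theorem aeval_polylogPoly_reflect (k : ℕ) (u : ℝ) :
    Polynomial.aeval (-1 - u) (polylogPoly k)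
      = (-1) ^ (k + 1) * Polynomial.aeval u (polylogPoly k) - if k = 0 then 1 else 0 := by
  cases k with
  | zero => simp [polylogPoly]; ring
  | succ k =>
    have h := congrArg (Polynomial.aeval u) (polylogPoly_comp k)
    rw [Polynomial.aeval_comp] at h
    simp only [map_sub, map_neg, map_one, Polynomial.aeval_X, map_mul, map_pow] at h
    rw [h, pow_succ, pow_succ]; simp

theorem aeval_neg_one_polylogPoly (k : ℕ) :
    Polynomial.aeval (-1 : ℝ) (polylogPoly k) = if k = 0 then -1 else 0 := by
  cases k with
  | zero => simp [polylogPoly]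
  | succ k => simp [polylogPoly]

/-- The expansion of a power of `u = x / (1 - x)` in powers of `x`. -/
theorem hasSum_choose_mul_pow {x : ℝ} (hx : |x| < 1) (s : ℕ) :
    HasSum (fun m : ℕ => (m.choose s : ℝ) * x ^ (m + 1)) ((x / (1 - x)) ^ (s + 1)) := by
  have h := (hasSum_choose_mul_geometric_of_norm_lt_one s (r := x) hx).mul_right (x ^ (s + 1))
  have e : 1 / (1 - x) ^ (s + 1) * x ^ (s + 1) = (x / (1 - x)) ^ (s + 1) := by
    rw [div_pow]; ring
  rw [e] at h
  have := (add_left_injective s).hasSum_iff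
    (f := fun m : ℕ => (m.choose s : ℝ) * x ^ (m + 1)) (a := (x / (1 - x)) ^ (s + 1)) (by
      intro m hm
      have : m < s := by
        by_contra hge
        exact hm ⟨m - s, by simp; omega⟩
      simp [Nat.choose_eq_zero_of_lt this])
  rw [← this]
  refine h.congr_fun fun m => ?_
  simp only [Function.comp]
  rw [mul_assoc, ← pow_add]
  ring_nf

/-- The polynomial `polylogPoly k` in `u` and the coefficients `(m + 1) ^ k` have the same expansion,
respectively in the powers `u ^ (s + 1)` and in their coefficients `m.choose s`, because `x d/dx`
acts in the same way on both. -/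
theorem polylogPoly_mem_span (k : ℕ) :
    ((polylogPoly k).map (Int.castRingHom ℝ), fun m : ℕ => ((m : ℝ) + 1) ^ k) ∈
      Submodule.span ℝ (Set.range fun s : ℕ =>
        ((Polynomial.X ^ (s + 1) : Polynomial ℝ), fun m : ℕ => (m.choose s : ℝ))) := by
  induction k with
  | zero =>
    refine Submodule.subset_span ⟨0, ?_⟩
    simp [polylogPoly]
  | succ k ih =>
    -- the operator `x d/dx` on both components
    let T : (Polynomial ℝ × (ℕ → ℝ)) →ₗ[ℝ] (Polynomial ℝ × (ℕ → ℝ)) :=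
      LinearMap.prodMap
        (LinearMap.mulLeft ℝ (Polynomial.X * (Polynomial.X + 1)) ∘ₗ Polynomial.derivative)
        (LinearMap.mulLeft ℝ (fun m : ℕ => (m : ℝ) + 1))
    have hT := Submodule.mem_map_of_mem (f := T) ih
    have hle : Submodule.map T (Submodule.span ℝ (Set.range fun s : ℕ =>
        ((Polynomial.X ^ (s + 1) : Polynomial ℝ), fun m : ℕ => (m.choose s : ℝ)))) ≤
        Submodule.span ℝ (Set.range fun s : ℕ =>
          ((Polynomial.X ^ (s + 1) : Polynomial ℝ), fun m : ℕ => (m.choose s : ℝ))) := by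
      rw [Submodule.map_span_le]
      rintro _ ⟨s, rfl⟩
      have e : T ((Polynomial.X ^ (s + 1) : Polynomial ℝ), fun m : ℕ => (m.choose s : ℝ))
          = ((s : ℝ) + 1) • ((Polynomial.X ^ (s + 1 + 1) : Polynomial ℝ),
              fun m : ℕ => (m.choose (s + 1) : ℝ))
            + ((s : ℝ) + 1) • ((Polynomial.X ^ (s + 1) : Polynomial ℝ),
              fun m : ℕ => (m.choose s : ℝ)) := by
        refine Prod.ext ?_ ?_
        · simp only [T, LinearMap.prodMap_apply, LinearMap.comp_apply, LinearMap.mulLeft_apply,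
            Polynomial.derivative_X_pow, Prod.fst_add, Prod.smul_fst]
          simp only [Polynomial.smul_eq_C_mul, map_add, map_natCast, map_one, Nat.cast_add,
            Nat.cast_one, Nat.add_sub_cancel]
          ring
        · funext m
          simp only [T, LinearMap.prodMap_apply, LinearMap.mulLeft_apply, Pi.mul_apply,
            Prod.snd_add, Prod.smul_snd, Pi.add_apply, Pi.smul_apply, smul_eq_mul]
          have h : ((m : ℝ) + 1) * (m.choose s : ℝ)
              = ((m + 1).choose (s + 1) : ℝ) * ((s : ℝ) + 1) := by
            exact_mod_cast Nat.add_one_mul_choose_eq m s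
          rw [h, Nat.choose_succ_succ]; push_cast; ring
      rw [e]
      exact add_mem (Submodule.smul_mem _ _ (Submodule.subset_span ⟨s + 1, rfl⟩))
        (Submodule.smul_mem _ _ (Submodule.subset_span ⟨s, rfl⟩))
    have h := hle hT
    convert h using 1
    refine Prod.ext ?_ ?_
    · simp [T, polylogPoly, Polynomial.derivative_map, mul_assoc]
    · funext m; simp [T, pow_succ, mul_comm]

theorem hasSum_polylogPoly {x : ℝ} (hx : |x| < 1) (k : ℕ) :
    HasSum (fun m : ℕ => ((m : ℝ) + 1) ^ k * x ^ (m + 1))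
      (Polynomial.aeval (x / (1 - x)) (polylogPoly k)) := by
  have h := Submodule.span_induction
    (p := fun (y : Polynomial ℝ × (ℕ → ℝ)) _ => HasSum (fun m : ℕ => y.2 m * x ^ (m + 1))
      (y.1.eval (x / (1 - x)))) ?_ ?_ ?_ ?_ (polylogPoly_mem_span k)
  · simp only [Polynomial.eval_map] at h
    simpa [Polynomial.aeval_def] using h
  · rintro _ ⟨s, rfl⟩
    simpa using hasSum_choose_mul_pow hx s
  · simp
  · intro y z _ _ hy hz
    simpa [add_mul] using hy.add hz
  · intro c y _ hy
    simpa [mul_assoc] using hy.mul_left c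

/-- The real version of `qZeta`, indexed by `k = s - 1`. -/
noncomputable def realQZeta (q : ℝ) (k : ℕ) : ℝ :=
  ∑' m : ℕ+, (ArithmeticFunction.sigma k (m : ℕ) : ℝ) * q ^ (m : ℕ)

theorem qZeta_ofReal (q : ℝ) (s : ℕ) : qZeta (q : ℂ) s = (realQZeta q (s - 1) : ℂ) := by
  simp [qZeta, realQZeta, Complex.ofReal_tsum]

/-- The Lambert series `∑_{l ≥ 1} ∑_{c ≥ 1} c ^ k q ^ (l c)` summed first over `c`. -/
theorem hasSum_realQZeta {p : ℤ} (hp : 2 ≤ |p|) (k : ℕ) :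
    HasSum (fun l : ℕ => Polynomial.aeval (((p : ℝ) ^ (l + 1) - 1)⁻¹) (polylogPoly k))
      (realQZeta ((p : ℝ)⁻¹) k) := by
  set q : ℝ := (p : ℝ)⁻¹ with hq
  have hq2 : |q| ≤ 1 / 2 := inv_abs_le_half hp
  have hq1 : ‖q‖ < 1 := by rw [Real.norm_eq_abs]; linarith
  have hsum := (summable_prod_mul_pow k hq1).hasSum
  rw [(summable_prod_mul_pow k hq1).tsum_prod, tsum_prod_pow_eq_tsum_sigma k hq1] at hsum
  have hfib : ∀ d : ℕ+, HasSum (fun c : ℕ+ => (c : ℝ) ^ k * q ^ ((d : ℕ) * (c : ℕ)))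
      (Polynomial.aeval (((p : ℝ) ^ (d : ℕ) - 1)⁻¹) (polylogPoly k)) := by
    intro d
    have hd : |q ^ (d : ℕ)| < 1 := by
      rw [abs_pow]; exact pow_lt_one₀ (abs_nonneg _) (by linarith) d.pos.ne'
    have h1 := hasSum_polylogPoly hd k
    have e : q ^ (d : ℕ) / (1 - q ^ (d : ℕ)) = ((p : ℝ) ^ (d : ℕ) - 1)⁻¹ := by
      have h0 := ne_zero_of_two_le_abs hp
      have h2 := pow_sub_one_ne_zero hp d.pos
      have h3 : 1 - q ^ (d : ℕ) ≠ 0 := by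
        intro h; rw [sub_eq_zero] at h; rw [← h] at hd; simp at hd
      rw [hq, inv_pow] at h3 ⊢
      have : 1 - ((p : ℝ) ^ (d : ℕ))⁻¹ = ((p : ℝ) ^ (d : ℕ))⁻¹ * ((p : ℝ) ^ (d : ℕ) - 1) := by
        field_simp
      rw [this]
      field_simp
    rw [e] at h1
    rw [← Equiv.pnatEquivNat.symm.hasSum_iff]
    refine h1.congr_fun fun m => ?_
    simp [Function.comp, pow_mul]
  have h := HasSum.prod_fiberwise hsum hfib
  rw [← Equiv.pnatEquivNat.symm.hasSum_iff] at h
  refine h.congr_fun fun m => ?_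
  simp [Function.comp]

/-- Summing at the pole of index `j` only drops the first `j` terms of the Lambert series. -/
theorem hasSum_realQZeta_shift {p : ℤ} (hp : 2 ≤ |p|) (k j : ℕ) :
    HasSum (fun l : ℕ => Polynomial.aeval (simplePole p j ((p : ℝ) ^ (l + 1))) (polylogPoly k))
      (realQZeta ((p : ℝ)⁻¹) k
        - ∑ l ∈ Finset.range j, Polynomial.aeval (((p : ℝ) ^ (l + 1) - 1)⁻¹) (polylogPoly k)) := by
  have h := (hasSum_nat_add_iff' j).2 (hasSum_realQZeta hp k)
  refine h.congr_fun fun l => ?_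
  rw [simplePole, ← pow_add]
  ring_nf

/-- Powers of `u` are rational combinations of the `polylogPoly k`. -/
theorem exists_X_pow_eq_sum_polylogPoly (s : ℕ) : ∃ c : ℕ → ℚ, (∀ k, s < k → c k = 0) ∧
    ∀ N, s < N → (Polynomial.X ^ (s + 1) : Polynomial ℚ)
      = ∑ k ∈ Finset.range N, Polynomial.C (c k) * (polylogPoly k).map (Int.castRingHom ℚ) := by
  induction s with
  | zero =>
    refine ⟨fun k => if k = 0 then 1 else 0, fun k hk => if_neg (by omega), fun N hN => ?_⟩
    rw [Finset.sum_eq_single_of_mem 0 (Finset.mem_range.2 hN) fun b _ hb => by simp [hb]]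
    simp [polylogPoly]
  | succ s ih =>
    obtain ⟨c, hc0, hc⟩ := ih
    refine ⟨fun k => (if k = 0 then 0 else c (k - 1) / (s + 1)) - c k, fun k hk => ?_,
      fun N hN => ?_⟩
    · simp only
      rw [if_neg (by omega), hc0 (k - 1) (by omega), hc0 k (by omega)]; simp
    · obtain ⟨N, rfl⟩ : ∃ M, N = M + 1 := ⟨N - 1, by omega⟩
      have h1 := congrArg Polynomial.derivative (hc N (by omega))
      rw [Polynomial.derivative_X_pow, Polynomial.derivative_sum] at h1
      simp only [Polynomial.derivative_C_mul, Nat.add_sub_cancel] at h1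
      have h2 : ∑ k ∈ Finset.range (N + 1), Polynomial.C (if k = 0 then (0 : ℚ) else c (k - 1) / (s + 1))
          * (polylogPoly k).map (Int.castRingHom ℚ)
          = Polynomial.C (1 / ((s : ℚ) + 1)) * (Polynomial.X * (Polynomial.X + 1)) *
            ∑ k ∈ Finset.range N, Polynomial.C (c k)
              * Polynomial.derivative ((polylogPoly k).map (Int.castRingHom ℚ)) := by
        rw [Finset.sum_range_succ', Finset.mul_sum]
        simp only [if_true, map_zero, zero_mul, add_zero]
        refine Finset.sum_congr rfl fun k _ => ?_
        rw [if_neg (Nat.succ_ne_zero k), Nat.add_sub_cancel, polylogPoly]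
        simp only [Polynomial.map_mul, Polynomial.map_add, Polynomial.map_X, Polynomial.map_one,
          Polynomial.derivative_map, div_eq_mul_one_div (c k), Polynomial.C_mul]
        ring
      simp only [Polynomial.C_sub, sub_mul, Finset.sum_sub_distrib]
      rw [h2, ← h1, ← hc (N + 1) (by omega)]
      have h3 : (Polynomial.C (1 / ((s : ℚ) + 1)) : Polynomial ℚ)
          * Polynomial.C (((s + 1 : ℕ) : ℚ)) = 1 := by
        rw [← Polynomial.C_mul]
        push_cast
        rw [one_div, inv_mul_cancel₀ (by positivity), Polynomial.C_1]
      linear_combination (-(Polynomial.X * (Polynomial.X + 1) * Polynomial.X ^ s : Polynomial ℚ)) * h3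

/-! ### Linear forms in `q`-zeta values of one parity -/

/-- The symmetry `X ↦ p ^ (-n) / X` exchanges the poles `p ^ (-j)` and `p ^ (j - n)`, and acts on
`u = 1 / (p ^ j X - 1)` as the inversion `u ↦ -1 - u`. -/
theorem simplePole_reflect {p : ℤ} (hp0 : (p : ℝ) ≠ 0) {n j : ℕ} (hj : j ≤ n) {X : ℝ}
    (hX0 : X ≠ 0) (hX : (p : ℝ) ^ (n - j) * X ≠ 1) :
    simplePole p j (((p : ℝ) ^ n * X)⁻¹) = -1 - simplePole p (n - j) X := by
  have h1 : (p : ℝ) ^ n = (p : ℝ) ^ j * (p : ℝ) ^ (n - j) := by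
    rw [← pow_add, Nat.add_sub_cancel' hj]
  have hj0 : (p : ℝ) ^ j ≠ 0 := pow_ne_zero _ hp0
  have hnj : (p : ℝ) ^ (n - j) ≠ 0 := pow_ne_zero _ hp0
  simp only [simplePole]
  rw [h1]
  generalize (p : ℝ) ^ j = a at *
  generalize (p : ℝ) ^ (n - j) = b at *
  have hW : b * X - 1 ≠ 0 := sub_ne_zero.2 hX
  have e : a * (a * b * X)⁻¹ - 1 = -(b * X - 1) / (b * X) := by field_simp; ring
  rw [e, inv_div]
  have e2 : b * X / -(b * X - 1) = -(b * X / (b * X - 1)) := by rw [div_neg]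
  rw [e2, eq_sub_iff_add_eq, inv_eq_one_div]
  field_simp
  ring

theorem exists_int_pow_mul_aeval {P : Polynomial ℤ} {k : ℕ} (hP : P.natDegree ≤ k) {D : ℤ} {u : ℝ}
    (hu : ∃ z : ℤ, (D : ℝ) * u = z) : ∃ z : ℤ, (D : ℝ) ^ k * Polynomial.aeval u P = z := by
  obtain ⟨z, hz⟩ := hu
  refine ⟨∑ i ∈ Finset.range (k + 1), P.coeff i * D ^ (k - i) * z ^ i, ?_⟩
  rw [Polynomial.aeval_eq_sum_range' (Nat.lt_succ_of_le hP), Finset.mul_sum]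
  push_cast
  refine Finset.sum_congr rfl fun i hi => ?_
  have hi' : i ≤ k := by have := Finset.mem_range.1 hi; omega
  rw [← hz, zsmul_eq_mul, mul_pow]
  have : (D : ℝ) ^ k = (D : ℝ) ^ (k - i) * (D : ℝ) ^ i := by
    rw [← pow_add, Nat.sub_add_cancel hi']
  rw [this]; ring

/-- Powers of a pole, rewritten in the basis `polylogPoly k`, with a common denominator. -/
theorem exists_rat_pow_eq_sum_polylogPoly (A : ℕ) : ∃ (w : ℕ → ℕ → ℝ) (L : ℤ), 0 < L ∧
    (∀ s ∈ Finset.Icc 1 A, ∀ k ∈ Finset.range A, ∃ z : ℤ, (L : ℝ) * w s k = z) ∧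
    (∀ s k, s ≤ k → 1 ≤ s → w s k = 0) ∧
    ∀ s ∈ Finset.Icc 1 A, ∀ u : ℝ,
      u ^ s = ∑ k ∈ Finset.range A, w s k * Polynomial.aeval u (polylogPoly k) := by
  choose c hc0 hc using exists_X_pow_eq_sum_polylogPoly
  obtain ⟨L, hL, hL'⟩ := exists_common_denominator (Finset.Icc 1 A ×ˢ Finset.range A)
    (fun x : ℕ × ℕ => c (x.1 - 1) x.2)
  refine ⟨fun s k => (c (s - 1) k : ℝ), L, hL, fun s hs k hk => ?_, fun s k hsk hs => ?_,
    fun s hs u => ?_⟩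
  · exact hL' (s, k) (Finset.mem_product.2 ⟨hs, hk⟩)
  · simp only; rw [hc0 (s - 1) k (by omega)]; simp
  · have hs' := Finset.mem_Icc.1 hs
    have h := congrArg (Polynomial.aeval u) (hc (s - 1) A (by omega))
    rw [Nat.sub_add_cancel hs'.1] at h
    simp only [map_pow, Polynomial.aeval_X, map_sum, map_mul, Polynomial.aeval_C] at h
    rw [h]
    refine Finset.sum_congr rfl fun k _ => ?_
    congr 1
    rw [Polynomial.aeval_def, Polynomial.aeval_def, Polynomial.eval₂_map]
    congr 1

/-- A function with controlled partial fractions, vanishing at `0` and (anti)symmetric under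
`X ↦ p ^ (-n) / X`, sums over `X = p, p ^ 2, …` to a linear form in `1` and the `q`-zeta values of
one parity.  Averaging the expansions of `F (X)` and `± F (p ^ (-n) / X)` cancels the
other parity, and `F 0 = 0` cancels the coefficient of index `1`. -/
theorem exists_linear_form (A : ℕ) : ∃ (L : ℤ) (C : ℝ), 0 < L ∧ 0 < C ∧
    ∀ (p D : ℤ) (n : ℕ) (P : ℤ) (B : ℝ) (F : ℝ → ℝ) (ε : ℝ) (T : Finset ℕ) (S : ℝ),
      2 ≤ |p| → (∀ i, 0 < i → i ≤ n → p ^ i - 1 ∣ D) → HasPartialFractions p D n A P B F →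
      F 0 = 0 → (ε = 1 ∨ ε = -1) →
      (∀ X : ℝ, X ≠ 0 → (∀ j ≤ n, (p : ℝ) ^ j * X ≠ 1) → F (((p : ℝ) ^ n * X)⁻¹) = ε * F X) →
      T ⊆ Finset.Icc 2 A → (∀ t ∈ Finset.Icc 2 A, t ∉ T → ε * (-1) ^ t = -1) →
      HasSum (fun l : ℕ => F ((p : ℝ) ^ (l + 1))) S →
      ∃ (c₀ : ℤ) (c : ℕ → ℤ),
        (2 * L * P * D ^ A : ℤ) * S = c₀ + ∑ t ∈ T, (c t : ℝ) * realQZeta ((p : ℝ)⁻¹) (t - 1) ∧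
        ∀ t ∈ T, |(c t : ℝ)| ≤ C * |(P : ℝ)| * |(D : ℝ)| ^ A * B := by
  obtain ⟨w, L, hL, hwL, hw0, hw⟩ := exists_rat_pow_eq_sum_polylogPoly A
  set W : ℝ := 1 + ∑ s ∈ Finset.Icc 1 A, ∑ k ∈ Finset.range A, |w s k| with hW
  have hWpos : 0 < W := by
    have : 0 ≤ ∑ s ∈ Finset.Icc 1 A, ∑ k ∈ Finset.range A, |w s k| :=
      Finset.sum_nonneg fun _ _ => Finset.sum_nonneg fun _ _ => abs_nonneg _
    linarith
  have hwW : ∀ s ∈ Finset.Icc 1 A, ∀ k ∈ Finset.range A, |w s k| ≤ W := by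
    intro s hs k hk
    have h1 := Finset.single_le_sum (f := fun k => |w s k|) (fun _ _ => abs_nonneg _) hk
    have h2 := Finset.single_le_sum (f := fun s => ∑ k ∈ Finset.range A, |w s k|)
      (fun _ _ => Finset.sum_nonneg fun _ _ => abs_nonneg _) hs
    linarith
  have hLpos : (0 : ℝ) < L := by exact_mod_cast hL
  refine ⟨L, 2 * L * W, hL, by positivity, ?_⟩
  intro p D n P B F ε T S hp hD hF hF0 hε hsym hT hpar hS
  obtain ⟨b, hbz, hbB, hbF⟩ := hF
  have hp0 := ne_zero_of_two_le_abs hp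
  set R := Finset.range (n + 1) with hR
  have hRn : ∀ j ∈ R, j ≤ n := fun j hj => by have := Finset.mem_range.1 hj; omega
  -- the coefficients in the basis `polylogPoly k`
  set a : ℕ → ℕ → ℝ := fun k j => ∑ s ∈ Finset.Icc 1 A, w s k * b s j with ha
  have haz : ∀ k ∈ Finset.range A, ∀ j ∈ R, ∃ z : ℤ, (L * P * D ^ (A - 1 - k) : ℝ) * a k j = z := by
    intro k hk j hj
    have : ∀ s ∈ Finset.Icc 1 A, ∃ z : ℤ,
        (L * P * D ^ (A - 1 - k) : ℝ) * (w s k * b s j) = z := by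
      intro s hs
      have hs' := Finset.mem_Icc.1 hs
      by_cases hsk : s ≤ k
      · exact ⟨0, by rw [hw0 s k hsk hs'.1]; simp⟩
      · obtain ⟨z₁, h1⟩ := hwL s hs k hk
        obtain ⟨z₂, h2⟩ := hbz s hs j hj
        refine ⟨z₁ * z₂ * D ^ (s - 1 - k), ?_⟩
        push_cast
        rw [← h1, ← h2, show A - 1 - k = (A - s) + (s - 1 - k) by omega, pow_add]
        ring
    choose! z hz using this
    exact ⟨∑ s ∈ Finset.Icc 1 A, z s, by
      rw [ha]; push_cast; rw [Finset.mul_sum]; exact Finset.sum_congr rfl hz⟩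
  have haF : ∀ X : ℝ, (∀ j ≤ n, (p : ℝ) ^ j * X ≠ 1) →
      F X = ∑ k ∈ Finset.range A, ∑ j ∈ R,
        a k j * Polynomial.aeval (simplePole p j X) (polylogPoly k) := by
    intro X hX
    rw [hbF X hX]
    calc _ = ∑ s ∈ Finset.Icc 1 A, ∑ j ∈ R, ∑ k ∈ Finset.range A,
          w s k * b s j * Polynomial.aeval (simplePole p j X) (polylogPoly k) := by
          refine Finset.sum_congr rfl fun s hs => Finset.sum_congr rfl fun j _ => ?_
          rw [hw s hs, Finset.mul_sum]
          exact Finset.sum_congr rfl fun k _ => by ring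
      _ = _ := by
          simp only [ha, Finset.sum_mul]
          rw [Finset.sum_comm, Finset.sum_comm (s := Finset.range A)]
          exact Finset.sum_congr rfl fun j _ => Finset.sum_comm
  have hzero : 0 < A → ∑ j ∈ R, a 0 j = 0 := by
    intro hA
    have h := haF 0 (fun j _ => by simp)
    rw [hF0] at h
    have e : ∀ j, simplePole p j 0 = -1 := fun j => by simp [simplePole]
    simp only [e, aeval_neg_one_polylogPoly] at h
    rw [Finset.sum_eq_single_of_mem 0 (Finset.mem_range.2 hA) fun k _ hk => by simp [hk]] at h
    simp at h
    exact h
  -- the domain contains `p, p², …`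
  have hdom : ∀ l j : ℕ, (p : ℝ) ^ j * (p : ℝ) ^ (l + 1) ≠ 1 := fun l j => by
    rw [← pow_add]; exact sub_ne_zero.1 (pow_sub_one_ne_zero hp (by omega))
  have hdom' : ∀ l : ℕ, ∀ j ≤ n, (p : ℝ) ^ j * ((p : ℝ) ^ n * (p : ℝ) ^ (l + 1))⁻¹ ≠ 1 := by
    intro l j hj h
    have h1 : (p : ℝ) ^ n = (p : ℝ) ^ j * (p : ℝ) ^ (n - j) := by
      rw [← pow_add, Nat.add_sub_cancel' hj]
    refine hdom l (n - j) ?_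
    rw [h1] at h
    field_simp at h
    exact h.symm
  set g : ℕ → ℕ → ℕ → ℝ := fun k j l =>
    Polynomial.aeval (simplePole p j ((p : ℝ) ^ (l + 1))) (polylogPoly k) with hg
  have hFl : ∀ l : ℕ, F ((p : ℝ) ^ (l + 1)) = ∑ k ∈ Finset.range A, ∑ j ∈ R,
      a k j / 2 * (g k j l + ε * (-1) ^ (k + 1) * g k (n - j) l) := by
    intro l
    have hX0 : (p : ℝ) ^ (l + 1) ≠ 0 := pow_ne_zero _ hp0
    have h1 := haF _ (fun j _ => hdom l j)
    have h2 := haF _ (hdom' l)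
    have h3 := hsym _ hX0 (fun j _ => hdom l j)
    have h4 : ∑ k ∈ Finset.range A, ∑ j ∈ R, a k j * Polynomial.aeval
        (simplePole p j (((p : ℝ) ^ n * (p : ℝ) ^ (l + 1))⁻¹)) (polylogPoly k)
        = ∑ k ∈ Finset.range A, ∑ j ∈ R, a k j * ((-1) ^ (k + 1) * g k (n - j) l) := by
      refine Finset.sum_congr rfl fun k hk => ?_
      have e : ∀ j ∈ R, a k j * Polynomial.aeval
          (simplePole p j (((p : ℝ) ^ n * (p : ℝ) ^ (l + 1))⁻¹)) (polylogPoly k)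
          = a k j * ((-1) ^ (k + 1) * g k (n - j) l) - a k j * (if k = 0 then 1 else 0) := by
        intro j hj
        rw [simplePole_reflect hp0 (hRn j hj) hX0 (hdom l _), aeval_polylogPoly_reflect]
        ring
      rw [Finset.sum_congr rfl e, Finset.sum_sub_distrib, ← Finset.sum_mul]
      rcases eq_or_ne k 0 with rfl | hk0
      · rw [hzero (by have := Finset.mem_range.1 hk; omega)]; ring
      · rw [if_neg hk0]; ring
    rw [h4] at h2
    have hε2 : ε * ε = 1 := by rcases hε with rfl | rfl <;> norm_num
    have h5 : F ((p : ℝ) ^ (l + 1)) = F ((p : ℝ) ^ (l + 1)) / 2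
        + ε * F ((((p : ℝ) ^ n * (p : ℝ) ^ (l + 1))⁻¹)) / 2 := by
      rw [h3]; linear_combination (-(F ((p : ℝ) ^ (l + 1)) / 2)) * hε2
    rw [h5, h1, h2, Finset.mul_sum, Finset.sum_div, Finset.sum_div, ← Finset.sum_add_distrib]
    refine Finset.sum_congr rfl fun k _ => ?_
    rw [Finset.mul_sum, Finset.sum_div, Finset.sum_div, ← Finset.sum_add_distrib]
    refine Finset.sum_congr rfl fun j _ => ?_
    simp only [hg]; ring
  -- summation over `l`
  set z : ℕ → ℝ := fun k => realQZeta ((p : ℝ)⁻¹) k with hz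
  set r : ℕ → ℕ → ℝ := fun k j =>
    ∑ l ∈ Finset.range j, Polynomial.aeval (((p : ℝ) ^ (l + 1) - 1)⁻¹) (polylogPoly k) with hr
  have hSval : S = ∑ k ∈ Finset.range A, ∑ j ∈ R,
      a k j / 2 * ((z k - r k j) + ε * (-1) ^ (k + 1) * (z k - r k (n - j))) := by
    refine hS.unique ?_
    simp only [hFl]
    refine hasSum_sum fun k _ => hasSum_sum fun j _ => ?_
    exact ((hasSum_realQZeta_shift hp k j).add
      ((hasSum_realQZeta_shift hp k (n - j)).mul_left _)).mul_left _
  have hrz : ∀ k, ∀ j ≤ n, ∃ y : ℤ, (D : ℝ) ^ (k + 1) * r k j = y := by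
    intro k j hj
    have : ∀ l ∈ Finset.range j, ∃ y : ℤ, (D : ℝ) ^ (k + 1)
        * Polynomial.aeval (((p : ℝ) ^ (l + 1) - 1)⁻¹) (polylogPoly k) = y := by
      intro l hl
      have hl' := Finset.mem_range.1 hl
      refine exists_int_pow_mul_aeval (natDegree_polylogPoly_le k) ?_
      obtain ⟨e, he⟩ := hD (l + 1) (Nat.succ_pos l) (by omega)
      refine ⟨e, ?_⟩
      have hne := pow_sub_one_ne_zero hp (Nat.succ_pos l)
      rw [he]; push_cast; field_simp
    choose! y hy using this
    exact ⟨∑ l ∈ Finset.range j, y l, by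
      rw [hr]; push_cast; rw [Finset.mul_sum]; exact Finset.sum_congr rfl hy⟩
  choose! za hza using haz
  choose! zr hzr using hrz
  obtain ⟨e, he⟩ : ∃ e : ℤ, ε = e := by
    rcases hε with h | h
    · exact ⟨1, by simp [h]⟩
    · exact ⟨-1, by simp [h]⟩
  refine ⟨-∑ k ∈ Finset.range A, ∑ j ∈ R,
      za k j * (zr k j + e * (-1) ^ (k + 1) * zr k (n - j)),
    fun t => D ^ t * (1 + e * (-1) ^ t) * ∑ j ∈ R, za (t - 1) j, ?_, fun t ht => ?_⟩
  · -- only the indices of the right parity survive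
    have hTsum : ∑ t ∈ T, (((D ^ t * (1 + e * (-1) ^ t) * ∑ j ∈ R, za (t - 1) j : ℤ)) : ℝ)
          * z (t - 1)
        = ∑ k ∈ Finset.range A, (D : ℝ) ^ (k + 1) * (1 + ε * (-1) ^ (k + 1))
          * (∑ j ∈ R, (za k j : ℝ)) * z k := by
      have h1 : ∑ t ∈ T, (((D ^ t * (1 + e * (-1) ^ t) * ∑ j ∈ R, za (t - 1) j : ℤ)) : ℝ)
          * z (t - 1)
          = ∑ t ∈ Finset.Icc 1 A, (D : ℝ) ^ t * (1 + ε * (-1) ^ t)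
            * (∑ j ∈ R, (za (t - 1) j : ℝ)) * z (t - 1) := by
        have hT' : T ⊆ Finset.Icc 1 A := hT.trans (Finset.Icc_subset_Icc_left (by norm_num))
        rw [← Finset.sum_subset hT']
        · refine Finset.sum_congr rfl fun t _ => ?_
          push_cast; rw [← he]
        · intro t ht htT
          have ht' := Finset.mem_Icc.1 ht
          rcases Nat.lt_or_ge 1 t with h | h
          · rw [hpar t (Finset.mem_Icc.2 ⟨h, ht'.2⟩) htT]; ring
          · obtain rfl : t = 1 := by omega
            have h0 : (L * P * D ^ (A - 1 - 0) : ℝ) * ∑ j ∈ R, a 0 j = ∑ j ∈ R, (za 0 j : ℝ) := by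
              rw [Finset.mul_sum]
              exact Finset.sum_congr rfl fun j hj =>
                hza 0 (Finset.mem_range.2 (by omega)) j hj
            rw [hzero (by omega), mul_zero] at h0
            rw [show 1 - 1 = 0 from rfl, ← h0]; ring
      have hIcc : Finset.Icc 1 A = Finset.Ico (0 + 1) (A + 1) := by
        ext t; simp only [Finset.mem_Icc, Finset.mem_Ico]; omega
      rw [h1, hIcc, ← Finset.sum_Ico_add', Finset.range_eq_Ico]
      rfl
    rw [hTsum, hSval]
    push_cast
    rw [← he, neg_add_eq_sub, ← Finset.sum_sub_distrib, Finset.mul_sum]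
    refine Finset.sum_congr rfl fun k hk => ?_
    rw [Finset.mul_sum, Finset.mul_sum, Finset.sum_mul, ← Finset.sum_sub_distrib]
    refine Finset.sum_congr rfl fun j hj => ?_
    have hA : (D : ℝ) ^ A = (D : ℝ) ^ (A - 1 - k) * (D : ℝ) ^ (k + 1) := by
      rw [← pow_add]; congr 1; have := Finset.mem_range.1 hk; omega
    rw [← hza k hk j hj, ← hzr k j (hRn j hj), ← hzr k (n - j) (by omega), hA]
    ring
  · have ht' := Finset.mem_Icc.1 (hT ht)
    have hk : t - 1 ∈ Finset.range A := Finset.mem_range.2 (by omega)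
    have h1 : |1 + ε * (-1) ^ t| ≤ 2 := by
      rcases hε with rfl | rfl <;> rcases neg_one_pow_eq_or ℝ t with h | h <;> rw [h] <;> norm_num
    have h2 : ∑ j ∈ R, (za (t - 1) j : ℝ)
        = (L * P * D ^ (A - 1 - (t - 1)) : ℝ) * ∑ j ∈ R, a (t - 1) j := by
      rw [Finset.mul_sum]
      exact (Finset.sum_congr rfl fun j hj => (hza (t - 1) hk j hj)).symm
    have h3 : |∑ j ∈ R, a (t - 1) j| ≤ W * B := by
      calc |∑ j ∈ R, a (t - 1) j| ≤ ∑ j ∈ R, ∑ s ∈ Finset.Icc 1 A, W * |b s j| := by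
            refine (Finset.abs_sum_le_sum_abs _ _).trans (Finset.sum_le_sum fun j _ => ?_)
            refine (Finset.abs_sum_le_sum_abs _ _).trans (Finset.sum_le_sum fun s hs => ?_)
            rw [abs_mul]
            exact mul_le_mul_of_nonneg_right (hwW s hs _ hk) (abs_nonneg _)
        _ = W * ∑ s ∈ Finset.Icc 1 A, ∑ j ∈ R, |b s j| := by
            rw [Finset.sum_comm, Finset.mul_sum]
            exact Finset.sum_congr rfl fun s _ => by rw [Finset.mul_sum]
        _ ≤ W * B := mul_le_mul_of_nonneg_left hbB hWpos.le
    push_cast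
    rw [← he, h2, show A - 1 - (t - 1) = A - t by omega]
    have hA : |(D : ℝ)| ^ A = |(D : ℝ)| ^ t * |(D : ℝ)| ^ (A - t) := by
      rw [← pow_add]; congr 1; omega
    rw [abs_mul, abs_mul, abs_pow, abs_mul, abs_mul, abs_mul, abs_pow, abs_of_pos hLpos, hA]
    have h4 : |1 + ε * (-1) ^ t| * |∑ j ∈ R, a (t - 1) j| ≤ 2 * (W * B) :=
      mul_le_mul h1 h3 (abs_nonneg _) (by norm_num)
    calc _ = (|(D : ℝ)| ^ t * (L * |(P : ℝ)| * |(D : ℝ)| ^ (A - t)))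
          * (|1 + ε * (-1) ^ t| * |∑ j ∈ R, a (t - 1) j|) := by ring
      _ ≤ (|(D : ℝ)| ^ t * (L * |(P : ℝ)| * |(D : ℝ)| ^ (A - t))) * (2 * (W * B)) :=
          mul_le_mul_of_nonneg_left h4 (by positivity)
      _ = _ := by ring

/-! ### The kernel and its partial fractions -/

/-- The rational function `(p - 1) ⋯ (p ^ n - 1) N(X) / ∏_{j ≤ n} (p ^ j X - 1)`. -/
noncomputable def brick (p : ℤ) (n : ℕ) (N : Polynomial ℝ) (X : ℝ) : ℝ :=
  (qFactorial p n : ℝ) * N.eval X / ∏ j ∈ Finset.range (n + 1), ((p : ℝ) ^ j * X - 1)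

/-- The values of `N` at the points `p ^ (-j)`, with the weights with which they enter the partial
fractions of `brick p n N`, have denominators dividing `Q` and are bounded by `M`. -/
def BrickBound (p : ℤ) (n : ℕ) (N : Polynomial ℝ) (Q : ℤ) (M : ℝ) : Prop :=
  N.natDegree ≤ n ∧ ∀ j ≤ n,
    (∃ y : ℤ, (Q : ℝ) * ((p : ℝ) ^ (j * (j + 1) / 2) * N.eval ((p : ℝ) ^ j)⁻¹) = y) ∧
    |(p : ℝ)| ^ (j * (n - j)) * |(p : ℝ) ^ (j * (j + 1) / 2) * N.eval ((p : ℝ) ^ j)⁻¹| ≤ M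

theorem BrickBound.exists_coeffs {p : ℤ} (hp : 2 ≤ |p|) {n : ℕ} {N : Polynomial ℝ} {Q : ℤ} {M : ℝ}
    (h : BrickBound p n N Q M) : ∃ g : ℕ → ℝ,
      (∀ i ∈ Finset.range (n + 1), ∃ z : ℤ, (Q : ℝ) * g i = z) ∧
      ∑ i ∈ Finset.range (n + 1), |g i| ≤ ((n : ℝ) + 1) * Real.exp 12 * M ∧
      ∀ X : ℝ, (∀ j ≤ n, (p : ℝ) ^ j * X ≠ 1) →
        brick p n N X = ∑ i ∈ Finset.range (n + 1), g i * simplePole p i X := by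
  obtain ⟨z, hz, hN⟩ := exists_brick_eq_sum hp n
  refine ⟨fun j => z j * (p : ℝ) ^ (j * (j + 1) / 2) * N.eval ((p : ℝ) ^ j)⁻¹, fun j hj => ?_, ?_,
    hN N h.1⟩
  · have hj' : j ≤ n := by have := Finset.mem_range.1 hj; omega
    obtain ⟨y, hy⟩ := (h.2 j hj').1
    exact ⟨z j * y, by push_cast; rw [← hy]; ring⟩
  · have : ∀ j ∈ Finset.range (n + 1),
        |z j * (p : ℝ) ^ (j * (j + 1) / 2) * N.eval ((p : ℝ) ^ j)⁻¹| ≤ Real.exp 12 * M := by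
      intro j hj
      have hj' : j ≤ n := by have := Finset.mem_range.1 hj; omega
      rw [mul_assoc, abs_mul]
      calc _ ≤ (Real.exp 12 * |(p : ℝ)| ^ (j * (n - j)))
            * |(p : ℝ) ^ (j * (j + 1) / 2) * N.eval ((p : ℝ) ^ j)⁻¹| :=
            mul_le_mul_of_nonneg_right (hz j hj') (abs_nonneg _)
        _ ≤ Real.exp 12 * M := by
            rw [mul_assoc]
            exact mul_le_mul_of_nonneg_left (h.2 j hj').2 (Real.exp_pos _).le
    refine (Finset.sum_le_sum this).trans (le_of_eq ?_)
    simp; ring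

theorem BrickBound.nonneg {p : ℤ} {n : ℕ} {N : Polynomial ℝ} {Q : ℤ} {M : ℝ}
    (h : BrickBound p n N Q M) : 0 ≤ M :=
  le_trans (by positivity) (h.2 0 (Nat.zero_le n)).2

theorem BrickBound.hasPartialFractions {p D : ℤ} (hp : 2 ≤ |p|) {n A : ℕ} {N : Polynomial ℝ}
    {Q : ℤ} {M : ℝ} (h : BrickBound p n N Q M) :
    HasPartialFractions p D n 1 Q ((4 ^ A * ((n : ℝ) + 1) * Real.exp 12) * M) (brick p n N) := by
  obtain ⟨g, h1, h2, h3⟩ := h.exists_coeffs hp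
  have hterm : ∀ i ∈ Finset.range (n + 1), HasPartialFractions p D n 1 Q (|g i|)
      (fun X => g i * simplePole p i X) := by
    intro i hi
    have := (HasPartialFractions.simplePole_pow (p := p) (D := D) (n := n) (j := i) (s := 1)
      (by have := Finset.mem_range.1 hi; omega) le_rfl).smul (Q := Q) (c := g i) le_rfl
      (by simpa using h1 i hi)
    simpa using this
  refine ((HasPartialFractions.sum _ hterm).congr h3).mono (h2.trans ?_)
  refine mul_le_mul_of_nonneg_right ?_ h.nonneg
  rw [mul_assoc]
  exact le_mul_of_one_le_left (by positivity) (one_le_pow₀ (by norm_num))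

theorem HasPartialFractions.mul_brick {p D : ℤ} (hp : 2 ≤ |p|) {n σ A : ℕ}
    (hD : ∀ i, 0 < i → i ≤ n → p ^ i - 1 ∣ D) {P : ℤ} {B : ℝ} {F : ℝ → ℝ}
    (hF : HasPartialFractions p D n σ P B F) (hB : 0 ≤ B) (hσ : σ ≤ A) {N : Polynomial ℝ} {Q : ℤ}
    {M : ℝ} (h : BrickBound p n N Q M) :
    HasPartialFractions p D n (σ + 1) (P * Q) (B * ((4 ^ A * ((n : ℝ) + 1) * Real.exp 12) * M))
      (fun X => F X * brick p n N X) := by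
  obtain ⟨g, h1, h2, h3⟩ := h.exists_coeffs hp
  refine (hF.mul_simplePoles hp hD h1 h2 h3).mono ?_
  have h4 : (4 : ℝ) ^ σ ≤ 4 ^ A := pow_le_pow_right₀ (by norm_num) hσ
  have hM := h.nonneg
  calc (4 : ℝ) ^ σ * (B * (((n : ℝ) + 1) * Real.exp 12 * M))
      ≤ 4 ^ A * (B * (((n : ℝ) + 1) * Real.exp 12 * M)) :=
        mul_le_mul_of_nonneg_right h4 (by positivity)
    _ = _ := by ring

/-- The numerator `X ^ (m + 1)`. -/
noncomputable def monomialNum (m : ℕ) : Polynomial ℝ := Polynomial.X ^ (m + 1)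

/-- The numerator `X ^ m (p ^ (2 m + 1) X ^ 2 - 1)`, which makes the kernel antisymmetric. -/
noncomputable def oddNum (p : ℤ) (m : ℕ) : Polynomial ℝ :=
  Polynomial.X ^ m * (Polynomial.C ((p : ℝ) ^ (2 * m + 1)) * Polynomial.X ^ 2 - 1)

/-- The numerator `X ∏ (X - p ^ e)` over the `t`-th block `2 m t < e ≤ 2 m (t + 1)`. -/
noncomputable def lowNum (p : ℤ) (m t : ℕ) : Polynomial ℝ :=
  Polynomial.X * ∏ i ∈ Finset.range (2 * m),
    (Polynomial.X - Polynomial.C ((p : ℝ) ^ (t * (2 * m) + i + 1)))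

/-- The reflection `X ∏ (p ^ (2 m + 1 + e) X - 1)` of `lowNum p m t`. -/
noncomputable def highNum (p : ℤ) (m t : ℕ) : Polynomial ℝ :=
  Polynomial.X * ∏ i ∈ Finset.range (2 * m),
    (Polynomial.C ((p : ℝ) ^ (2 * m + 1 + (t * (2 * m) + i + 1))) * Polynomial.X - 1)

theorem two_mul_triangle (j : ℕ) : 2 * (j * (j + 1) / 2) = j * (j + 1) :=
  Nat.mul_div_cancel' (Nat.even_mul_succ_self j).two_dvd

/-- The difference of the two sides is `(m - j) (m + 1 - j) / 2`. -/
theorem monomial_exponent_le (m j : ℕ) :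
    j * (m + 1) ≤ m * (m + 1) / 2 + j * (j + 1) / 2 := by
  have h1 := two_mul_triangle m
  have h2 := two_mul_triangle j
  have : 2 * (j * (m + 1)) ≤ m * (m + 1) + j * (j + 1) := by
    rcases le_total j m with h | h
    · obtain ⟨d, rfl⟩ := Nat.exists_eq_add_of_le h; nlinarith
    · obtain ⟨d, rfl⟩ := Nat.exists_eq_add_of_le h
      have : d ≤ d * d := Nat.le_mul_self d
      nlinarith
  omega

/-- The difference of the two sides is again `(m - j) (m + 1 - j) / 2`. -/
theorem monomial_exponent_le' {m j : ℕ} (hj : j ≤ 2 * m + 1) :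
    j * (2 * m + 1 - j) + j * (j + 1) / 2 ≤ m * (m + 1) / 2 + j * (m + 1) := by
  have h1 := two_mul_triangle m
  have h2 := two_mul_triangle j
  obtain ⟨d, hd⟩ := Nat.exists_eq_add_of_le hj
  rw [hd, Nat.add_sub_cancel_left]
  have : 2 * (j * d) + j * (j + 1) ≤ m * (m + 1) + 2 * (j * (m + 1)) := by
    have h3 := monomial_exponent_le m j
    have h4 : j * (2 * m + 1) = j * j + j * d := by rw [hd]; ring
    nlinarith
  omega

theorem one_lt_abs_cast {p : ℤ} (hp : 2 ≤ |p|) : (1 : ℝ) < |(p : ℝ)| := by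
  have : (2 : ℝ) ≤ |(p : ℝ)| := by exact_mod_cast hp
  linarith

theorem pow_add_one_le_pow_succ {a : ℝ} (ha : 2 ≤ a) (e : ℕ) : a ^ e + 1 ≤ a ^ (e + 1) := by
  have : (1 : ℝ) ≤ a ^ e := one_le_pow₀ (by linarith)
  rw [pow_succ]; nlinarith

theorem pow_mul_inv_pow_eq {x : ℝ} (hx : x ≠ 0) {c j k : ℕ} (h : j * k ≤ c) :
    x ^ c * ((x ^ j)⁻¹) ^ k = x ^ (c - j * k) := by
  rw [inv_pow, ← pow_mul, pow_sub₀ _ hx h]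

theorem brickBound_monomialNum {p : ℤ} (hp : 2 ≤ |p|) (m : ℕ) :
    BrickBound p (2 * m + 1) (monomialNum m) (p ^ (m * (m + 1) / 2))
      (|(p : ℝ)| ^ (m * (m + 1) / 2)) := by
  have hp0 := ne_zero_of_two_le_abs hp
  have ha := one_lt_abs_cast hp
  refine ⟨by simp only [monomialNum, Polynomial.natDegree_X_pow]; omega, fun j hj => ⟨?_, ?_⟩⟩
  · refine ⟨p ^ (m * (m + 1) / 2 + j * (j + 1) / 2 - j * (m + 1)), ?_⟩
    simp only [monomialNum, Polynomial.eval_pow, Polynomial.eval_X]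
    push_cast
    rw [← mul_assoc, ← pow_add, pow_mul_inv_pow_eq hp0 (monomial_exponent_le m j)]
  · simp only [monomialNum, Polynomial.eval_pow, Polynomial.eval_X]
    rw [abs_mul, abs_pow, ← mul_assoc, ← pow_add, abs_pow, abs_inv, abs_pow, inv_pow, ← pow_mul,
      ← div_eq_mul_inv, div_le_iff₀ (by positivity), ← pow_add]
    exact pow_le_pow_right₀ ha.le (monomial_exponent_le' hj)

theorem brickBound_oddNum {p : ℤ} (hp : 2 ≤ |p|) {m : ℕ} (hm : 1 ≤ m) :
    BrickBound p (2 * m + 1) (oddNum p m) (p ^ (m * (m + 1) / 2))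
      (2 * |(p : ℝ)| ^ (2 * m + 1) * |(p : ℝ)| ^ (m * (m + 1) / 2)) := by
  have hp0 := ne_zero_of_two_le_abs hp
  have ha := one_lt_abs_cast hp
  have hev : ∀ j ≤ 2 * m + 1, (oddNum p m).eval ((p : ℝ) ^ j)⁻¹
      = (monomialNum m).eval ((p : ℝ) ^ j)⁻¹ * ((p : ℝ) ^ (2 * m + 1 - j) - (p : ℝ) ^ j) := by
    intro j hj
    simp only [oddNum, monomialNum, Polynomial.eval_mul, Polynomial.eval_pow, Polynomial.eval_X,
      Polynomial.eval_sub, Polynomial.eval_C, Polynomial.eval_one]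
    rw [pow_sub₀ _ hp0 hj, pow_succ _ m]
    have : (p : ℝ) ^ j ≠ 0 := pow_ne_zero _ hp0
    field_simp
  have hmono := brickBound_monomialNum hp m
  refine ⟨?_, fun j hj => ⟨?_, ?_⟩⟩
  · have h1 : (Polynomial.C ((p : ℝ) ^ (2 * m + 1)) * Polynomial.X ^ 2 - 1 :
        Polynomial ℝ).natDegree ≤ 2 :=
      (Polynomial.natDegree_sub_le _ _).trans (by
        simp only [Polynomial.natDegree_one]
        exact max_le (Polynomial.natDegree_C_mul_X_pow_le _ _) (by norm_num))
    have h2 : (Polynomial.X ^ m : Polynomial ℝ).natDegree = m := Polynomial.natDegree_X_pow m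
    exact Polynomial.natDegree_mul_le.trans (by omega)
  · obtain ⟨y, hy⟩ := (hmono.2 j hj).1
    refine ⟨y * (p ^ (2 * m + 1 - j) - p ^ j), ?_⟩
    rw [hev j hj]; push_cast; rw [← hy]; push_cast; ring
  · rw [hev j hj, ← mul_assoc ((p : ℝ) ^ (j * (j + 1) / 2)), abs_mul, ← mul_assoc,
      mul_comm (2 * |(p : ℝ)| ^ (2 * m + 1))]
    refine mul_le_mul (hmono.2 j hj).2 ?_ (abs_nonneg _) (by positivity)
    refine (abs_sub _ _).trans ?_
    rw [abs_pow, abs_pow, two_mul (|(p : ℝ)| ^ (2 * m + 1))]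
    exact add_le_add (pow_le_pow_right₀ ha.le (by omega)) (pow_le_pow_right₀ ha.le hj)

/-- A crude bound for the two kinds of numerators with many factors; only its dependence on `t`
matters, since there are few of them. -/
theorem mul_prod_bound {p : ℤ} (hp : 2 ≤ |p|) {m t j : ℕ} (hj : j ≤ 2 * m + 1) {v : ℝ} (hv : |v| ≤ 1)
    {f : ℕ → ℝ} (hf : ∀ i ∈ Finset.range (2 * m),
      |f i| ≤ |(p : ℝ)| ^ (2 * m + 1 + ((t + 1) * (2 * m) + 1))) :
    |(p : ℝ)| ^ (j * (2 * m + 1 - j))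
      * |(p : ℝ) ^ (j * (j + 1) / 2) * (v * ∏ i ∈ Finset.range (2 * m), f i)|
        ≤ |(p : ℝ)| ^ ((t + 3) * (2 * m + 1) ^ 2) := by
  have ha := one_lt_abs_cast hp
  have h1 : |v * ∏ i ∈ Finset.range (2 * m), f i|
      ≤ |(p : ℝ)| ^ ((2 * m + 1 + ((t + 1) * (2 * m) + 1)) * (2 * m)) := by
    rw [abs_mul, Finset.abs_prod]
    have h2 := Finset.prod_le_prod (fun i _ => abs_nonneg (f i)) hf
    rw [Finset.prod_const, Finset.card_range, ← pow_mul] at h2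
    exact (mul_le_of_le_one_left (Finset.prod_nonneg fun _ _ => abs_nonneg _) hv).trans h2
  rw [abs_mul, abs_pow, ← mul_assoc, ← pow_add]
  refine (mul_le_mul_of_nonneg_left h1 (by positivity)).trans ?_
  rw [← pow_add]
  refine pow_le_pow_right₀ ha.le ?_
  have h3 := two_mul_triangle j
  have h4 : j * (2 * m + 1 - j) + j * (j + 1) / 2 ≤ (2 * m + 1) ^ 2 := by
    obtain ⟨d, hd⟩ := Nat.exists_eq_add_of_le hj
    rw [hd, Nat.add_sub_cancel_left]
    rcases Nat.eq_zero_or_pos j with rfl | h0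
    · simp
    · have : j ≤ j * j := Nat.le_mul_self j
      nlinarith
  nlinarith

theorem brickBound_lowNum {p : ℤ} (hp : 2 ≤ |p|) (m t : ℕ) :
    BrickBound p (2 * m + 1) (lowNum p m t) (p ^ ((2 * m + 1) ^ 2))
      (|(p : ℝ)| ^ ((t + 3) * (2 * m + 1) ^ 2)) := by
  have hp0 := ne_zero_of_two_le_abs hp
  have ha := one_lt_abs_cast hp
  have ha2 : (2 : ℝ) ≤ |(p : ℝ)| := by exact_mod_cast hp
  have hev : ∀ v : ℝ, (lowNum p m t).eval v
      = v * ∏ i ∈ Finset.range (2 * m), (v - (p : ℝ) ^ (t * (2 * m) + i + 1)) := by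
    intro v
    simp only [lowNum, Polynomial.eval_mul, Polynomial.eval_X, Polynomial.eval_prod,
      Polynomial.eval_sub, Polynomial.eval_C]
  refine ⟨?_, fun j hj => ⟨?_, ?_⟩⟩
  · refine Polynomial.natDegree_mul_le.trans ?_
    rw [Polynomial.natDegree_X, add_comm]
    refine Nat.add_le_add_right ((Polynomial.natDegree_prod_le _ _).trans ?_) 1
    refine (Finset.sum_le_card_nsmul _ _ 1 fun i _ => ?_).trans (by simp)
    exact Polynomial.natDegree_X_sub_C_le _
  · refine ⟨p ^ ((2 * m + 1) ^ 2 + j * (j + 1) / 2 - j * (2 * m + 1))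
      * ∏ i ∈ Finset.range (2 * m), (1 - p ^ (t * (2 * m) + i + 1 + j)), ?_⟩
    have hprod : ∏ i ∈ Finset.range (2 * m), (((p : ℝ) ^ j)⁻¹ - (p : ℝ) ^ (t * (2 * m) + i + 1))
        = (((p : ℝ) ^ j)⁻¹) ^ (2 * m)
          * ∏ i ∈ Finset.range (2 * m), (1 - (p : ℝ) ^ (t * (2 * m) + i + 1 + j)) := by
      rw [Finset.pow_eq_prod_const (((p : ℝ) ^ j)⁻¹) (2 * m), ← Finset.prod_mul_distrib]
      refine Finset.prod_congr rfl fun i _ => ?_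
      rw [pow_add _ _ j]
      have : (p : ℝ) ^ j ≠ 0 := pow_ne_zero _ hp0
      field_simp
    rw [hev, hprod]
    push_cast
    have hle : j * (2 * m + 1) ≤ (2 * m + 1) ^ 2 + j * (j + 1) / 2 :=
      le_add_right (by rw [sq]; exact Nat.mul_le_mul_right _ hj)
    rw [← pow_mul_inv_pow_eq hp0 hle, pow_add, pow_succ _ (2 * m)]
    ring
  · rw [hev]
    have hv : |((p : ℝ) ^ j)⁻¹| ≤ 1 := by
      rw [abs_inv, abs_pow]; exact inv_le_one_of_one_le₀ (one_le_pow₀ ha.le)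
    refine mul_prod_bound hp hj hv fun i hi => ?_
    have hi' := Finset.mem_range.1 hi
    refine (abs_sub _ _).trans ?_
    rw [abs_pow (p : ℝ) (t * (2 * m) + i + 1), add_comm]
    refine (add_le_add_right hv _).trans ((pow_add_one_le_pow_succ ha2 _).trans ?_)
    exact pow_le_pow_right₀ ha.le (by nlinarith)

theorem brickBound_highNum {p : ℤ} (hp : 2 ≤ |p|) (m t : ℕ) :
    BrickBound p (2 * m + 1) (highNum p m t) (p ^ ((2 * m + 1) ^ 2))
      (|(p : ℝ)| ^ ((t + 3) * (2 * m + 1) ^ 2)) := by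
  have hp0 := ne_zero_of_two_le_abs hp
  have ha := one_lt_abs_cast hp
  have ha2 : (2 : ℝ) ≤ |(p : ℝ)| := by exact_mod_cast hp
  have hev : ∀ v : ℝ, (highNum p m t).eval v = v * ∏ i ∈ Finset.range (2 * m),
      ((p : ℝ) ^ (2 * m + 1 + (t * (2 * m) + i + 1)) * v - 1) := by
    intro v
    simp only [highNum, Polynomial.eval_mul, Polynomial.eval_X, Polynomial.eval_prod,
      Polynomial.eval_sub, Polynomial.eval_C, Polynomial.eval_one]
  have hfac : ∀ j ≤ 2 * m + 1, ∀ i, (p : ℝ) ^ (2 * m + 1 + (t * (2 * m) + i + 1)) * ((p : ℝ) ^ j)⁻¹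
      = (p : ℝ) ^ (2 * m + 1 + (t * (2 * m) + i + 1) - j) := by
    intro j hj i
    rw [pow_sub₀ _ hp0 (by omega)]
  refine ⟨?_, fun j hj => ⟨?_, ?_⟩⟩
  · refine Polynomial.natDegree_mul_le.trans ?_
    rw [Polynomial.natDegree_X, add_comm]
    refine Nat.add_le_add_right ((Polynomial.natDegree_prod_le _ _).trans ?_) 1
    refine (Finset.sum_le_card_nsmul _ _ 1 fun i _ => ?_).trans (by simp)
    refine (Polynomial.natDegree_sub_le _ _).trans ?_
    simp only [Polynomial.natDegree_one]
    exact max_le ((Polynomial.natDegree_C_mul_le _ _).trans Polynomial.natDegree_X_le)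
      (by norm_num)
  · refine ⟨p ^ ((2 * m + 1) ^ 2 + j * (j + 1) / 2 - j * 1) * ∏ i ∈ Finset.range (2 * m),
      (p ^ (2 * m + 1 + (t * (2 * m) + i + 1) - j) - 1), ?_⟩
    rw [hev]
    simp only [hfac j hj]
    push_cast
    have hle : j * 1 ≤ (2 * m + 1) ^ 2 + j * (j + 1) / 2 :=
      le_add_right (by rw [sq]; exact Nat.mul_le_mul hj (by omega))
    rw [← pow_mul_inv_pow_eq hp0 hle, pow_add, pow_one]
    ring
  · rw [hev]
    have hv : |((p : ℝ) ^ j)⁻¹| ≤ 1 := by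
      rw [abs_inv, abs_pow]; exact inv_le_one_of_one_le₀ (one_le_pow₀ ha.le)
    refine mul_prod_bound hp hj hv fun i hi => ?_
    have hi' := Finset.mem_range.1 hi
    rw [hfac j hj]
    refine (abs_sub _ _).trans ?_
    rw [abs_pow, abs_one]
    refine (pow_add_one_le_pow_succ ha2 _).trans ?_
    exact pow_le_pow_right₀ ha.le (by
      have : t * (2 * m) + i + 1 ≤ (t + 1) * (2 * m) := by nlinarith
      omega)

/-- The kernel: a well-poised product of `G + 1 + 2 r` bricks with the first numerator `N`. -/
noncomputable def kernelFun (p : ℤ) (m G r : ℕ) (N : Polynomial ℝ) (X : ℝ) : ℝ :=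
  brick p (2 * m + 1) N X * brick p (2 * m + 1) (monomialNum m) X ^ G
    * ∏ t ∈ Finset.range r, (brick p (2 * m + 1) (lowNum p m t) X
      * brick p (2 * m + 1) (highNum p m t) X)

theorem hasPartialFractions_kernelFun {p D : ℤ} (hp : 2 ≤ |p|) {m : ℕ}
    (hD : ∀ i, 0 < i → i ≤ 2 * m + 1 → p ^ i - 1 ∣ D) {N : Polynomial ℝ}
    (hN : BrickBound p (2 * m + 1) N (p ^ (m * (m + 1) / 2))
      (2 * |(p : ℝ)| ^ (2 * m + 1) * |(p : ℝ)| ^ (m * (m + 1) / 2))) (G r : ℕ) :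
    HasPartialFractions p D (2 * m + 1) (G + 1 + 2 * r)
      (p ^ (m * (m + 1) / 2 * (G + 1) + 2 * (2 * m + 1) ^ 2 * r))
      ((4 ^ (G + 1 + 2 * r) * (((2 * m + 1 : ℕ) : ℝ) + 1) * Real.exp 12) ^ (G + 1 + 2 * r)
        * (2 * |(p : ℝ)| ^ (2 * m + 1 + m * (m + 1) / 2 * (G + 1)
          + (r ^ 2 + 5 * r) * (2 * m + 1) ^ 2)))
      (kernelFun p m G r N) := by
  set A := G + 1 + 2 * r with hA
  set H : ℝ := 4 ^ A * (((2 * m + 1 : ℕ) : ℝ) + 1) * Real.exp 12 with hH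
  have hH0 : 0 ≤ H := by positivity
  set a : ℝ := |(p : ℝ)|
  have ha0 : 0 ≤ a := abs_nonneg _
  set c := m * (m + 1) / 2
  -- the bricks with monomial numerators
  have h1 : ∀ k ≤ G, HasPartialFractions p D (2 * m + 1) (k + 1) (p ^ (c * (k + 1)))
      (H ^ (k + 1) * (2 * a ^ (2 * m + 1 + c * (k + 1))))
      (fun X => brick p (2 * m + 1) N X * brick p (2 * m + 1) (monomialNum m) X ^ k) := by
    intro k
    induction k with
    | zero =>
      intro _
      have h := hN.hasPartialFractions (D := D) (A := A) hp
      simp only [pow_zero, mul_one, zero_add, pow_one, pow_add]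
      refine h.mono (le_of_eq ?_)
      ring
    | succ k ih =>
      intro hk
      have h := (ih (by omega)).mul_brick hp hD (A := A) (by positivity) (by omega)
        (brickBound_monomialNum hp m)
      rw [← pow_add] at h
      rw [show c * (k + 1 + 1) = c * (k + 1) + c by ring]
      refine (h.congr fun X _ => ?_).mono (le_of_eq ?_)
      · rw [pow_succ]; ring
      · rw [show 2 * m + 1 + (c * (k + 1) + c) = 2 * m + 1 + c * (k + 1) + c by ring,
          pow_add a _ c, pow_succ H (k + 1)]
        ring
  -- the blocks
  have h2 : ∀ k ≤ r, HasPartialFractions p D (2 * m + 1) (G + 1 + 2 * k)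
      (p ^ (c * (G + 1) + 2 * (2 * m + 1) ^ 2 * k))
      (H ^ (G + 1 + 2 * k) * (2 * a ^ (2 * m + 1 + c * (G + 1)
          + (k ^ 2 + 5 * k) * (2 * m + 1) ^ 2)))
      (kernelFun p m G k N) := by
    intro k
    induction k with
    | zero =>
      intro _
      refine ((h1 G le_rfl).congr fun X _ => by simp [kernelFun]).mono (le_of_eq ?_)
      simp
    | succ k ih =>
      intro hk
      have h := ((ih (by omega)).mul_brick hp hD (A := A) (by positivity) (by omega)
        (brickBound_lowNum hp m k)).mul_brick hp hD (A := A) (by positivity) (by omega)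
        (brickBound_highNum hp m k)
      rw [← pow_add, ← pow_add] at h
      rw [show c * (G + 1) + 2 * (2 * m + 1) ^ 2 * (k + 1)
        = c * (G + 1) + 2 * (2 * m + 1) ^ 2 * k + (2 * m + 1) ^ 2 + (2 * m + 1) ^ 2 by ring]
      refine (h.congr fun X _ => ?_).mono (le_of_eq ?_)
      · simp only [kernelFun, Finset.prod_range_succ]; ring
      · rw [show 2 * m + 1 + c * (G + 1) + ((k + 1) ^ 2 + 5 * (k + 1)) * (2 * m + 1) ^ 2
          = 2 * m + 1 + c * (G + 1) + (k ^ 2 + 5 * k) * (2 * m + 1) ^ 2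
            + (k + 3) * (2 * m + 1) ^ 2 + (k + 3) * (2 * m + 1) ^ 2 by ring,
          pow_add a _ ((k + 3) * (2 * m + 1) ^ 2), pow_add a _ ((k + 3) * (2 * m + 1) ^ 2),
          show G + 1 + 2 * (k + 1) = G + 1 + 2 * k + 1 + 1 by ring, pow_succ H (_ + 1), pow_succ H]
        ring
  exact h2 r le_rfl

/-- A brick is invariant under `X ↦ p ^ (-(2 m + 1)) / X` up to the effect on its numerator: the
factors of the denominator are permuted, and `∏_{j ≤ 2 m + 1} p ^ j X` is a power of
`p ^ (2 m + 1) X ^ 2`. -/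
theorem brick_reflect {p : ℤ} (hp0 : (p : ℝ) ≠ 0) (m : ℕ) {X : ℝ} (hX : X ≠ 0) {N N' : Polynomial ℝ}
    {e : ℝ} (hN : N.eval (((p : ℝ) ^ (2 * m + 1) * X)⁻¹) * ((p : ℝ) ^ (2 * m + 1) * X ^ 2) ^ (m + 1)
      = e * N'.eval X) :
    brick p (2 * m + 1) N (((p : ℝ) ^ (2 * m + 1) * X)⁻¹) = e * brick p (2 * m + 1) N' X := by
  set w : ℝ := (p : ℝ) ^ (2 * m + 1) * X ^ 2 with hw
  have hw0 : w ≠ 0 := mul_ne_zero (pow_ne_zero _ hp0) (pow_ne_zero _ hX)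
  have hden : (∏ j ∈ Finset.range (2 * m + 1 + 1),
        ((p : ℝ) ^ j * ((p : ℝ) ^ (2 * m + 1) * X)⁻¹ - 1)) * w ^ (m + 1)
      = ∏ j ∈ Finset.range (2 * m + 1 + 1), ((p : ℝ) ^ j * X - 1) := by
    have h1 : ∏ j ∈ Finset.range (2 * m + 1 + 1), ((p : ℝ) ^ j * X) = w ^ (m + 1) := by
      rw [Finset.prod_mul_distrib, Finset.prod_pow_eq_pow_sum, Finset.prod_const,
        Finset.card_range, Finset.sum_range_id, hw, mul_pow, ← pow_mul, ← pow_mul,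
        Nat.add_sub_cancel, show (2 * m + 1 + 1) * (2 * m + 1) / 2 = (2 * m + 1) * (m + 1) by
          rw [show (2 * m + 1 + 1) * (2 * m + 1) = 2 * ((2 * m + 1) * (m + 1)) by ring]; omega,
        show 2 * m + 1 + 1 = 2 * (m + 1) by ring]
    rw [← h1, ← Finset.prod_range_reflect (fun j => (p : ℝ) ^ j * X),
      ← Finset.prod_range_reflect (fun j => (p : ℝ) ^ j * X - 1), ← Finset.prod_mul_distrib]
    -- the number of factors is even, so all the signs can be changed
    have h2 : ∏ j ∈ Finset.range (2 * m + 1 + 1), (-1 : ℝ) = 1 := by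
      rw [Finset.prod_const, Finset.card_range, show 2 * m + 1 + 1 = 2 * (m + 1) by ring, pow_mul]
      norm_num
    refine Eq.trans ?_ ((congrArg (· * _) h2).trans (one_mul _))
    rw [← Finset.prod_mul_distrib]
    refine Finset.prod_congr rfl fun j hj => ?_
    have hj' := Finset.mem_range.1 hj
    have e1 : (p : ℝ) ^ (2 * m + 1) = (p : ℝ) ^ j * (p : ℝ) ^ (2 * m + 1 + 1 - 1 - j) := by
      rw [← pow_add]; congr 1; omega
    rw [e1]
    have e2 : (p : ℝ) ^ j ≠ 0 := pow_ne_zero _ hp0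
    have e3 : (p : ℝ) ^ (2 * m + 1 + 1 - 1 - j) ≠ 0 := pow_ne_zero _ hp0
    generalize (p : ℝ) ^ (2 * m + 1 + 1 - 1 - j) = y at *
    field_simp
    ring
  simp only [brick]
  rw [← hden, ← mul_div_assoc, mul_left_comm, ← hN]
  rw [← mul_assoc, mul_div_mul_right _ _ (pow_ne_zero _ hw0)]

theorem monomialNum_reflect {p : ℤ} (hp0 : (p : ℝ) ≠ 0) (m : ℕ) {X : ℝ} (hX : X ≠ 0) :
    (monomialNum m).eval (((p : ℝ) ^ (2 * m + 1) * X)⁻¹) * ((p : ℝ) ^ (2 * m + 1) * X ^ 2) ^ (m + 1)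
      = 1 * (monomialNum m).eval X := by
  simp only [monomialNum, Polynomial.eval_pow, Polynomial.eval_X]
  rw [← mul_pow, one_mul]
  congr 1
  have : (p : ℝ) ^ (2 * m + 1) ≠ 0 := pow_ne_zero _ hp0
  field_simp

theorem oddNum_reflect {p : ℤ} (hp0 : (p : ℝ) ≠ 0) (m : ℕ) {X : ℝ} (hX : X ≠ 0) :
    (oddNum p m).eval (((p : ℝ) ^ (2 * m + 1) * X)⁻¹) * ((p : ℝ) ^ (2 * m + 1) * X ^ 2) ^ (m + 1)
      = -1 * (oddNum p m).eval X := by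
  simp only [oddNum, Polynomial.eval_pow, Polynomial.eval_X, Polynomial.eval_mul,
    Polynomial.eval_sub, Polynomial.eval_C, Polynomial.eval_one]
  have h0 : (p : ℝ) ^ (2 * m + 1) ≠ 0 := pow_ne_zero _ hp0
  generalize (p : ℝ) ^ (2 * m + 1) = y at *
  have h1 : ((y * X)⁻¹) ^ m * (y * X ^ 2) ^ m = X ^ m := by
    rw [← mul_pow]; congr 1; field_simp
  have h2 : (y * ((y * X)⁻¹) ^ 2 - 1) * (y * X ^ 2) = -1 * (y * X ^ 2 - 1) := by
    field_simp; ring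
  rw [pow_succ]
  linear_combination (y * ((y * X)⁻¹) ^ 2 - 1) * (y * X ^ 2) * h1 + X ^ m * h2

/-- The symmetry exchanges the factors of the two numerators of one block, so only their product
is invariant. -/
theorem lowNum_mul_highNum_reflect {p : ℤ} (hp0 : (p : ℝ) ≠ 0) (m t : ℕ) {X : ℝ} (hX : X ≠ 0) :
    ((lowNum p m t).eval (((p : ℝ) ^ (2 * m + 1) * X)⁻¹) * ((p : ℝ) ^ (2 * m + 1) * X ^ 2) ^ (m + 1))
      * ((highNum p m t).eval (((p : ℝ) ^ (2 * m + 1) * X)⁻¹)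
        * ((p : ℝ) ^ (2 * m + 1) * X ^ 2) ^ (m + 1))
      = (lowNum p m t).eval X * (highNum p m t).eval X := by
  simp only [lowNum, highNum, Polynomial.eval_mul, Polynomial.eval_X, Polynomial.eval_prod,
    Polynomial.eval_sub, Polynomial.eval_C, Polynomial.eval_one]
  have h0 : (p : ℝ) ^ (2 * m + 1) ≠ 0 := pow_ne_zero _ hp0
  simp only [pow_add (p : ℝ) (2 * m + 1)]
  generalize (p : ℝ) ^ (2 * m + 1) = y at *
  have h1 : (∏ i ∈ Finset.range (2 * m), ((y * X)⁻¹ - (p : ℝ) ^ (t * (2 * m) + i + 1)))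
      * (∏ i ∈ Finset.range (2 * m), (y * (p : ℝ) ^ (t * (2 * m) + i + 1) * (y * X)⁻¹ - 1))
      * (y * X ^ 2) ^ (2 * m)
      = (∏ i ∈ Finset.range (2 * m), (X - (p : ℝ) ^ (t * (2 * m) + i + 1)))
        * ∏ i ∈ Finset.range (2 * m), (y * (p : ℝ) ^ (t * (2 * m) + i + 1) * X - 1) := by
    rw [Finset.pow_eq_prod_const (y * X ^ 2) (2 * m), ← Finset.prod_mul_distrib,
      ← Finset.prod_mul_distrib,
      ← Finset.prod_mul_distrib]
    refine Finset.prod_congr rfl fun i _ => ?_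
    field_simp
    ring
  have h2 : (y * X)⁻¹ ^ 2 * (y * X ^ 2) ^ 2 = X ^ 2 := by field_simp
  have h3 : (y * X ^ 2) ^ (m + 1) * (y * X ^ 2) ^ (m + 1)
      = (y * X ^ 2) ^ (2 * m) * (y * X ^ 2) ^ 2 := by
    rw [← pow_add, ← pow_add]; congr 1; ring
  generalize (y * X ^ 2) ^ (m + 1) = w1 at *
  generalize (y * X ^ 2) ^ (2 * m) = w2 at *
  generalize (∏ i ∈ Finset.range (2 * m), ((y * X)⁻¹ - (p : ℝ) ^ (t * (2 * m) + i + 1))) = a1 at *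
  generalize (∏ i ∈ Finset.range (2 * m),
    (y * (p : ℝ) ^ (t * (2 * m) + i + 1) * (y * X)⁻¹ - 1)) = a2 at *
  generalize (y * X)⁻¹ = z at *
  linear_combination z ^ 2 * a1 * a2 * h3 + z ^ 2 * (y * X ^ 2) ^ 2 * h1
    + ((∏ i ∈ Finset.range (2 * m), (X - (p : ℝ) ^ (t * (2 * m) + i + 1)))
        * ∏ i ∈ Finset.range (2 * m), (y * (p : ℝ) ^ (t * (2 * m) + i + 1) * X - 1)) * h2

theorem kernelFun_reflect {p : ℤ} (hp0 : (p : ℝ) ≠ 0) (m G r : ℕ) {N : Polynomial ℝ} {ε : ℝ} {X : ℝ}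
    (hX : X ≠ 0)
    (hN : N.eval (((p : ℝ) ^ (2 * m + 1) * X)⁻¹) * ((p : ℝ) ^ (2 * m + 1) * X ^ 2) ^ (m + 1)
      = ε * N.eval X) :
    kernelFun p m G r N (((p : ℝ) ^ (2 * m + 1) * X)⁻¹) = ε * kernelFun p m G r N X := by
  have h3 : ∀ t, brick p (2 * m + 1) (lowNum p m t) (((p : ℝ) ^ (2 * m + 1) * X)⁻¹)
      * brick p (2 * m + 1) (highNum p m t) (((p : ℝ) ^ (2 * m + 1) * X)⁻¹)
      = brick p (2 * m + 1) (lowNum p m t) X * brick p (2 * m + 1) (highNum p m t) X := by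
    intro t
    have hl := brick_reflect hp0 m hX (N := lowNum p m t) (N' := 1)
      (e := (lowNum p m t).eval (((p : ℝ) ^ (2 * m + 1) * X)⁻¹)
        * ((p : ℝ) ^ (2 * m + 1) * X ^ 2) ^ (m + 1)) (by simp)
    have hh := brick_reflect hp0 m hX (N := highNum p m t) (N' := 1)
      (e := (highNum p m t).eval (((p : ℝ) ^ (2 * m + 1) * X)⁻¹)
        * ((p : ℝ) ^ (2 * m + 1) * X ^ 2) ^ (m + 1)) (by simp)
    rw [hl, hh]
    have := lowNum_mul_highNum_reflect hp0 m t hX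
    simp only [brick, Polynomial.eval_one]
    linear_combination ((qFactorial p (2 * m + 1) : ℝ) * 1
      / ∏ j ∈ Finset.range (2 * m + 1 + 1), ((p : ℝ) ^ j * X - 1)) ^ 2 * this
  simp only [kernelFun]
  rw [brick_reflect hp0 m hX hN, brick_reflect hp0 m hX (monomialNum_reflect hp0 m hX),
    Finset.prod_congr rfl fun t _ => h3 t]
  ring

theorem kernelFun_zero (p : ℤ) (m G r : ℕ) {N : Polynomial ℝ} (hN : N.eval 0 = 0) :
    kernelFun p m G r N 0 = 0 := by
  simp [kernelFun, brick, hN]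

/-! ### The size of the series -/

/-- At `p ^ k` the factors `p ^ i - 1` of a brick may all be replaced by `p ^ i`; the `q`-factorial
and the denominator contribute an error of at most `4` each. -/
theorem log_brick_sub_le {p : ℤ} (hp : 2 ≤ |p|) {n k : ℕ} (hk : 1 ≤ k) {N : Polynomial ℝ} {l c : ℝ}
    (hN0 : N.eval ((p : ℝ) ^ k) ≠ 0)
    (hN : |Real.log (|N.eval ((p : ℝ) ^ k)|) - l * Real.log (|(p : ℝ)|)| ≤ c) :
    brick p n N ((p : ℝ) ^ k) ≠ 0 ∧
    |Real.log (|brick p n N ((p : ℝ) ^ k)|) - (l - (n + 1) * k) * Real.log (|(p : ℝ)|)|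
      ≤ c + 8 := by
  have hden := abs_log_prod_pow_sub_one_sub_le hp (Finset.range (n + 1)) (e := fun j => j + k)
    (fun a _ b _ h => by simpa using h) (fun j _ => by omega)
  have hden0 : ∏ j ∈ Finset.range (n + 1), ((p : ℝ) ^ (j + k) - 1) ≠ 0 :=
    Finset.prod_ne_zero_iff.2 fun j _ => pow_sub_one_ne_zero hp (by omega)
  have hsum : ∑ j ∈ Finset.range (n + 1), ((j + k : ℕ) : ℝ)
      = (n + 1) * k + (n : ℝ) * (n + 1) / 2 := by
    have h := sum_range_cast_add_one n
    push_cast at h ⊢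
    rw [Finset.sum_add_distrib, Finset.sum_range_succ', Finset.sum_const, Finset.card_range]
    push_cast
    rw [h, nsmul_eq_mul]; push_cast; ring
  rw [hsum] at hden
  have hq := abs_log_qFactorial_sub_le hp n
  have hq0 := qFactorial_ne_zero hp n
  have e : brick p n N ((p : ℝ) ^ k) = (qFactorial p n : ℝ) * N.eval ((p : ℝ) ^ k)
      / ∏ j ∈ Finset.range (n + 1), ((p : ℝ) ^ (j + k) - 1) := by
    simp only [brick, pow_add]
  rw [e]
  refine ⟨div_ne_zero (mul_ne_zero hq0 hN0) hden0, ?_⟩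
  rw [abs_div, abs_mul, Real.log_div (mul_ne_zero (abs_ne_zero.2 hq0) (abs_ne_zero.2 hN0))
    (abs_ne_zero.2 hden0), Real.log_mul (abs_ne_zero.2 hq0) (abs_ne_zero.2 hN0)]
  rw [abs_le] at *
  constructor <;> nlinarith

theorem log_monomialNum {p : ℤ} (hp : 2 ≤ |p|) (m : ℕ) {k : ℕ} (hk : 1 ≤ k) :
    brick p (2 * m + 1) (monomialNum m) ((p : ℝ) ^ k) ≠ 0 ∧
    |Real.log (|brick p (2 * m + 1) (monomialNum m) ((p : ℝ) ^ k)|)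
      - (0 - (m + 1) * k) * Real.log (|(p : ℝ)|)| ≤ 8 := by
  have h := log_brick_sub_le hp (n := 2 * m + 1) hk (N := monomialNum m) (l := (m + 1) * k) (c := 0)
    (by simp [monomialNum, ne_zero_of_two_le_abs hp]) (by
      simp only [monomialNum, Polynomial.eval_pow, Polynomial.eval_X, abs_pow, Real.log_pow]
      push_cast
      rw [← mul_assoc]
      simp)
  refine ⟨h.1, ?_⟩
  convert h.2 using 4
  · push_cast; ring
  · norm_num

theorem log_oddNum {p : ℤ} (hp : 2 ≤ |p|) (m : ℕ) {k : ℕ} (hk : 1 ≤ k) :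
    brick p (2 * m + 1) (oddNum p m) ((p : ℝ) ^ k) ≠ 0 ∧
    |Real.log (|brick p (2 * m + 1) (oddNum p m) ((p : ℝ) ^ k)|)
      - ((2 * m + 1) - m * k) * Real.log (|(p : ℝ)|)| ≤ 12 := by
  have hp0 := ne_zero_of_two_le_abs hp
  have hev : (oddNum p m).eval ((p : ℝ) ^ k)
      = (p : ℝ) ^ (k * m) * ((p : ℝ) ^ (2 * m + 1 + 2 * k) - 1) := by
    simp only [oddNum, Polynomial.eval_mul, Polynomial.eval_pow, Polynomial.eval_X,
      Polynomial.eval_sub, Polynomial.eval_C, Polynomial.eval_one, ← pow_mul, ← pow_add]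
    rw [mul_comm 2 k]
  have h1 := pow_sub_one_ne_zero hp (show 0 < 2 * m + 1 + 2 * k by omega)
  have h2 := abs_log_prod_pow_sub_one_sub_le hp {0} (e := fun _ : ℕ => 2 * m + 1 + 2 * k)
    (by simp) (fun _ _ => by omega)
  simp only [Finset.prod_singleton, Finset.sum_singleton] at h2
  have h := log_brick_sub_le hp (n := 2 * m + 1) hk (N := oddNum p m)
    (l := k * m + (2 * m + 1 + 2 * k)) (c := 4)
    (by rw [hev]; exact mul_ne_zero (pow_ne_zero _ hp0) h1) (by
      rw [hev, abs_mul, Real.log_mul (abs_ne_zero.2 (pow_ne_zero _ hp0)) (abs_ne_zero.2 h1),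
        abs_pow, Real.log_pow]
      refine le_trans (le_of_eq ?_) h2
      push_cast; congr 1; ring)
  refine ⟨h.1, ?_⟩
  convert h.2 using 4
  · push_cast; ring
  · norm_num

theorem log_lowNum {p : ℤ} (hp : 2 ≤ |p|) (m t : ℕ) {k : ℕ} (hk : (t + 1) * (2 * m) < k) :
    brick p (2 * m + 1) (lowNum p m t) ((p : ℝ) ^ k) ≠ 0 ∧
    |Real.log (|brick p (2 * m + 1) (lowNum p m t) ((p : ℝ) ^ k)|)
      - (0 - k) * Real.log (|(p : ℝ)|)| ≤ 12 := by
  have hp0 := ne_zero_of_two_le_abs hp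
  have hlt : ∀ i ∈ Finset.range (2 * m), t * (2 * m) + i + 1 < k := by
    intro i hi; have := Finset.mem_range.1 hi; rw [add_mul] at hk; omega
  have hev : (lowNum p m t).eval ((p : ℝ) ^ k)
      = (p : ℝ) ^ (k + ∑ i ∈ Finset.range (2 * m), (t * (2 * m) + i + 1))
        * ∏ i ∈ Finset.range (2 * m), ((p : ℝ) ^ (k - (t * (2 * m) + i + 1)) - 1) := by
    simp only [lowNum, Polynomial.eval_mul, Polynomial.eval_X, Polynomial.eval_prod,
      Polynomial.eval_sub, Polynomial.eval_C]
    rw [pow_add, ← Finset.prod_pow_eq_pow_sum, mul_assoc, ← Finset.prod_mul_distrib]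
    congr 1
    refine Finset.prod_congr rfl fun i hi => ?_
    rw [mul_sub, ← pow_add, Nat.add_sub_cancel' (hlt i hi).le, mul_one]
  have hinj : Set.InjOn (fun i => k - (t * (2 * m) + i + 1)) (Finset.range (2 * m)) := by
    intro a ha b hb hab
    have := hlt a ha
    have := hlt b hb
    simp only at hab
    omega
  have hpos : ∀ i ∈ Finset.range (2 * m), 1 ≤ k - (t * (2 * m) + i + 1) := fun i hi => by
    have := hlt i hi; omega
  have h2 := abs_log_prod_pow_sub_one_sub_le hp (Finset.range (2 * m)) hinj hpos
  have h1 : ∏ i ∈ Finset.range (2 * m), ((p : ℝ) ^ (k - (t * (2 * m) + i + 1)) - 1) ≠ 0 :=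
    Finset.prod_ne_zero_iff.2 fun i hi => pow_sub_one_ne_zero hp (hpos i hi)
  have hsum : ∑ i ∈ Finset.range (2 * m), (((k - (t * (2 * m) + i + 1) : ℕ)) : ℝ)
      = 2 * m * k - ((∑ i ∈ Finset.range (2 * m), (t * (2 * m) + i + 1) : ℕ) : ℝ) := by
    rw [Finset.sum_congr rfl fun i hi => Nat.cast_sub (R := ℝ) (hlt i hi).le,
      Finset.sum_sub_distrib, Finset.sum_const, Finset.card_range, nsmul_eq_mul, Nat.cast_sum]
    push_cast; ring
  rw [hsum] at h2
  have h := log_brick_sub_le hp (n := 2 * m + 1) (show 1 ≤ k by omega) (N := lowNum p m t)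
    (l := k + 2 * m * k) (c := 4)
    (by rw [hev]; exact mul_ne_zero (pow_ne_zero _ hp0) h1) (by
      rw [hev, abs_mul, Real.log_mul (abs_ne_zero.2 (pow_ne_zero _ hp0)) (abs_ne_zero.2 h1),
        abs_pow, Real.log_pow]
      refine le_trans (le_of_eq ?_) h2
      rw [Nat.cast_add]; congr 1; ring)
  refine ⟨h.1, ?_⟩
  convert h.2 using 4
  · push_cast; ring
  · norm_num

theorem log_highNum {p : ℤ} (hp : 2 ≤ |p|) (m t : ℕ) {k : ℕ} (hk : 1 ≤ k) :
    brick p (2 * m + 1) (highNum p m t) ((p : ℝ) ^ k) ≠ 0 ∧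
    |Real.log (|brick p (2 * m + 1) (highNum p m t) ((p : ℝ) ^ k)|)
      - ((2 * m * (2 * m + 1 + t * (2 * m)) + m * (2 * m + 1)) - k) * Real.log (|(p : ℝ)|)|
        ≤ 12 := by
  have hp0 := ne_zero_of_two_le_abs hp
  have hev : (highNum p m t).eval ((p : ℝ) ^ k) = (p : ℝ) ^ k * ∏ i ∈ Finset.range (2 * m),
      ((p : ℝ) ^ (2 * m + 1 + (t * (2 * m) + i + 1) + k) - 1) := by
    simp only [highNum, Polynomial.eval_mul, Polynomial.eval_X, Polynomial.eval_prod,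
      Polynomial.eval_sub, Polynomial.eval_C, Polynomial.eval_one, pow_add _ _ k]
  have hinj : Set.InjOn (fun i => 2 * m + 1 + (t * (2 * m) + i + 1) + k)
      (Finset.range (2 * m)) := by
    intro a _ b _ hab
    simp only at hab
    omega
  have h2 := abs_log_prod_pow_sub_one_sub_le hp (Finset.range (2 * m)) hinj
    (fun i _ => by omega)
  have h1 : ∏ i ∈ Finset.range (2 * m),
      ((p : ℝ) ^ (2 * m + 1 + (t * (2 * m) + i + 1) + k) - 1) ≠ 0 :=
    Finset.prod_ne_zero_iff.2 fun i hi => pow_sub_one_ne_zero hp (by omega)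
  have hsum : ∑ i ∈ Finset.range (2 * m), (((2 * m + 1 + (t * (2 * m) + i + 1) + k : ℕ)) : ℝ)
      = 2 * m * (2 * m + 1 + t * (2 * m) + k) + m * (2 * m + 1) := by
    have h := sum_range_cast_add_one (2 * m)
    have e : ∀ i : ℕ, ((2 * m + 1 + (t * (2 * m) + i + 1) + k : ℕ) : ℝ)
        = (2 * m + 1 + t * (2 * m) + k) + ((i + 1 : ℕ) : ℝ) := fun i => by push_cast; ring
    simp only [e]
    rw [Finset.sum_add_distrib, h, Finset.sum_const, Finset.card_range, nsmul_eq_mul]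
    push_cast; ring
  rw [hsum] at h2
  have h := log_brick_sub_le hp (n := 2 * m + 1) hk (N := highNum p m t)
    (l := k + (2 * m * (2 * m + 1 + t * (2 * m) + k) + m * (2 * m + 1))) (c := 4)
    (by rw [hev]; exact mul_ne_zero (pow_ne_zero _ hp0) h1) (by
      rw [hev, abs_mul, Real.log_mul (abs_ne_zero.2 (pow_ne_zero _ hp0)) (abs_ne_zero.2 h1),
        abs_pow, Real.log_pow]
      refine le_trans (le_of_eq ?_) h2
      congr 1; ring)
  refine ⟨h.1, ?_⟩
  convert h.2 using 4
  · push_cast; ring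
  · norm_num

/-- Size of the kernel at `p ^ k`, beyond its zeros `p, …, p ^ (2 m r)`. -/
theorem log_kernelFun {p : ℤ} (hp : 2 ≤ |p|) (m G r : ℕ) {N : Polynomial ℝ} {x₀ x₁ : ℝ} {k : ℕ}
    (hk : r * (2 * m) < k) (hN0 : brick p (2 * m + 1) N ((p : ℝ) ^ k) ≠ 0)
    (hN : |Real.log (|brick p (2 * m + 1) N ((p : ℝ) ^ k)|)
      - (x₀ - x₁ * k) * Real.log (|(p : ℝ)|)| ≤ 12) :
    kernelFun p m G r N ((p : ℝ) ^ k) ≠ 0 ∧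
    |Real.log (|kernelFun p m G r N ((p : ℝ) ^ k)|)
      - ((x₀ + (2 * m * r * (2 * m + 1) + m * r * (2 * m * r + 1)))
        - (x₁ + G * (m + 1) + 2 * r) * k) * Real.log (|(p : ℝ)|)| ≤ 12 * (G + 1 + 2 * r) := by
  obtain ⟨h10, h1⟩ := log_monomialNum hp m (show 1 ≤ k by omega)
  set F₀ := brick p (2 * m + 1) N ((p : ℝ) ^ k)
    * brick p (2 * m + 1) (monomialNum m) ((p : ℝ) ^ k) ^ G with hF₀
  have hF₀0 : F₀ ≠ 0 := mul_ne_zero hN0 (pow_ne_zero _ h10)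
  have hF₀l : |Real.log (|F₀|) - (x₀ - (x₁ + G * (m + 1)) * k) * Real.log (|(p : ℝ)|)|
      ≤ 12 + 8 * G := by
    rw [hF₀, abs_mul, Real.log_mul (abs_ne_zero.2 hN0) (abs_ne_zero.2 (pow_ne_zero _ h10)), abs_pow,
      Real.log_pow]
    have h2 := mul_le_mul_of_nonneg_left h1 (Nat.cast_nonneg G : (0 : ℝ) ≤ G)
    rw [← abs_of_nonneg (Nat.cast_nonneg G : (0 : ℝ) ≤ G), ← abs_mul,
      abs_of_nonneg (Nat.cast_nonneg G : (0 : ℝ) ≤ G)] at h2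
    rw [abs_le] at *
    constructor <;> nlinarith
  have hprod : ∀ r' ≤ r,
      ∏ t ∈ Finset.range r', (brick p (2 * m + 1) (lowNum p m t) ((p : ℝ) ^ k)
        * brick p (2 * m + 1) (highNum p m t) ((p : ℝ) ^ k)) ≠ 0 ∧
      |Real.log (|∏ t ∈ Finset.range r', (brick p (2 * m + 1) (lowNum p m t) ((p : ℝ) ^ k)
        * brick p (2 * m + 1) (highNum p m t) ((p : ℝ) ^ k))|)
        - ((2 * m * r' * (2 * m + 1) + m * r' * (2 * m * r' + 1)) - 2 * r' * k)
          * Real.log (|(p : ℝ)|)| ≤ 24 * r' := by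
    intro r'
    induction r' with
    | zero => intro _; simp
    | succ t ih =>
      intro ht
      obtain ⟨i0, i1⟩ := ih (by omega)
      obtain ⟨l0, l1⟩ := log_lowNum hp m t (k := k)
        (lt_of_le_of_lt (Nat.mul_le_mul_right _ ht) hk)
      obtain ⟨u0, u1⟩ := log_highNum hp m t (show 1 ≤ k by omega)
      rw [Finset.prod_range_succ]
      refine ⟨mul_ne_zero i0 (mul_ne_zero l0 u0), ?_⟩
      rw [abs_mul, abs_mul, Real.log_mul (abs_ne_zero.2 i0)
        (mul_ne_zero (abs_ne_zero.2 l0) (abs_ne_zero.2 u0)),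
        Real.log_mul (abs_ne_zero.2 l0) (abs_ne_zero.2 u0)]
      push_cast
      rw [abs_le] at *
      constructor <;> nlinarith
  obtain ⟨hr0, hr⟩ := hprod r le_rfl
  refine ⟨mul_ne_zero hF₀0 hr0, ?_⟩
  rw [kernelFun, ← hF₀, abs_mul, Real.log_mul (abs_ne_zero.2 hF₀0) (abs_ne_zero.2 hr0)]
  have hG : (0 : ℝ) ≤ G := Nat.cast_nonneg G
  rw [abs_le] at *
  constructor <;> nlinarith

/-- The numerators `lowNum p m t` with `t < r` vanish at `p, p ^ 2, …, p ^ (2 m r)`. -/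
theorem kernelFun_eq_zero (p : ℤ) {m : ℕ} (G r : ℕ) (N : Polynomial ℝ) {l : ℕ}
    (hl : l < r * (2 * m)) : kernelFun p m G r N ((p : ℝ) ^ (l + 1)) = 0 := by
  have hm : 0 < 2 * m := Nat.pos_of_ne_zero fun h => by simp [h] at hl
  rw [kernelFun]
  refine mul_eq_zero_of_right _ (Finset.prod_eq_zero
    (Finset.mem_range.2 ((Nat.div_lt_iff_lt_mul hm).2 hl)) (mul_eq_zero_of_left ?_ _))
  simp only [brick, lowNum, Polynomial.eval_mul, Polynomial.eval_X, Polynomial.eval_prod,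
    Polynomial.eval_sub, Polynomial.eval_C]
  rw [Finset.prod_eq_zero (Finset.mem_range.2 (Nat.mod_lt l hm))]
  · simp
  · rw [Nat.div_add_mod']; ring

/-- A series whose first nonzero term dominates has the size of that term. -/
theorem exists_hasSum_of_dominant {f : ℕ → ℝ} {l₀ : ℕ} {x E c : ℝ} (h0 : ∀ l < l₀, f l = 0)
    (h1 : ∀ l, l₀ ≤ l → f l ≠ 0 ∧ |Real.log (|f l|) - (x - E * ((l + 1 : ℕ) : ℝ))| ≤ c)
    (hE : 2 * c + 2 ≤ E) :
    ∃ S, HasSum f S ∧ S ≠ 0 ∧ |Real.log (|S|) - (x - E * (l₀ + 1))| ≤ c + 1 := by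
  obtain ⟨hf0, hl0⟩ := h1 l₀ le_rfl
  have hc : 0 ≤ c := le_trans (abs_nonneg _) hl0
  set ρ := Real.exp (-E) with hρ
  have hexp : Real.exp (2 * c) * ρ ≤ 1 / 4 := by
    rw [hρ, ← Real.exp_add]
    calc Real.exp (2 * c + -E) ≤ Real.exp (-2) := Real.exp_le_exp.2 (by linarith)
      _ ≤ 1 / 4 := by
        rw [Real.exp_neg, one_div]
        refine inv_anti₀ (by norm_num) ?_
        have h2 : Real.exp 2 = Real.exp 1 * Real.exp 1 := by rw [← Real.exp_add]; norm_num
        have := Real.exp_one_gt_d9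
        nlinarith
  have hρ0 : 0 < ρ := Real.exp_pos _
  have hρ1 : ρ ≤ 1 / 4 := by
    have : 1 ≤ Real.exp (2 * c) := Real.one_le_exp (by linarith)
    nlinarith
  have hterm : ∀ i : ℕ, |f (i + (l₀ + 1))| ≤ |f l₀| * (1 / 4) * ρ ^ i := by
    intro i
    obtain ⟨hfi, hli⟩ := h1 (i + (l₀ + 1)) (by omega)
    have h2 : Real.log (|f (i + (l₀ + 1))|) ≤ Real.log (|f l₀|) + (2 * c + -E * (i + 1)) := by
      push_cast at hli hl0
      rw [abs_le] at hli hl0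
      nlinarith
    have h3 := Real.exp_le_exp.2 h2
    rw [Real.exp_log (abs_pos.2 hfi), Real.exp_add, Real.exp_log (abs_pos.2 hf0), Real.exp_add,
      show -E * ((i : ℝ) + 1) = ((i + 1 : ℕ) : ℝ) * (-E) by push_cast; ring, Real.exp_nat_mul,
      ← hρ, pow_succ] at h3
    refine h3.trans ?_
    rw [mul_assoc]
    refine mul_le_mul_of_nonneg_left ?_ (abs_nonneg _)
    have := pow_pos hρ0 i
    nlinarith
  have hgeo : HasSum (fun i : ℕ => |f l₀| * (1 / 4) * ρ ^ i) (|f l₀| * (1 / 4) * (1 - ρ)⁻¹) :=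
    (hasSum_geometric_of_lt_one hρ0.le (by linarith)).mul_left _
  have hsum : Summable (fun i : ℕ => f (i + (l₀ + 1))) :=
    Summable.of_norm_bounded hgeo.summable hterm
  have htail : |∑' i : ℕ, f (i + (l₀ + 1))| ≤ |f l₀| * (1 / 3) := by
    refine (tsum_of_norm_bounded (f := fun i : ℕ => f (i + (l₀ + 1))) hgeo hterm).trans ?_
    rw [mul_assoc]
    refine mul_le_mul_of_nonneg_left ?_ (abs_nonneg _)
    rw [← div_eq_mul_inv, div_le_iff₀ (by linarith)]
    linarith
  have hS : HasSum f (f l₀ + ∑' i : ℕ, f (i + (l₀ + 1))) := by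
    have h := (hasSum_nat_add_iff (l₀ + 1)).1 hsum.hasSum
    rw [Finset.sum_range_succ, Finset.sum_eq_zero fun l hl => h0 l (Finset.mem_range.1 hl),
      zero_add, add_comm] at h
    exact h
  have hf0' : 0 < |f l₀| := abs_pos.2 hf0
  set τ := ∑' i : ℕ, f (i + (l₀ + 1))
  have hlow : |f l₀| * (2 / 3) ≤ |f l₀ + τ| := by
    have := abs_sub_abs_le_abs_sub (f l₀) (-τ)
    rw [abs_neg, sub_neg_eq_add] at this
    linarith
  have hup : |f l₀ + τ| ≤ |f l₀| * (4 / 3) := by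
    have := abs_add_le (f l₀) τ
    linarith
  have hpos : 0 < |f l₀ + τ| := lt_of_lt_of_le (by positivity) hlow
  refine ⟨_, hS, abs_pos.1 hpos, ?_⟩
  have a1 := Real.log_le_log (by positivity) hlow
  have a2 := Real.log_le_log hpos hup
  rw [Real.log_mul hf0'.ne' (by norm_num)] at a1 a2
  have b1 : -1 ≤ Real.log (2 / 3) := by
    have := Real.one_sub_inv_le_log_of_pos (show (0 : ℝ) < 2 / 3 by norm_num)
    norm_num at this ⊢; linarith
  have b2 : Real.log (4 / 3) ≤ 1 := by
    have := Real.log_le_sub_one_of_pos (show (0 : ℝ) < 4 / 3 by norm_num)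
    linarith
  push_cast at hl0
  rw [abs_le] at *
  constructor <;> linarith

/-! ### The dimension bound -/

theorem tendsto_log_two_mul_add_two_div_sq :
    Tendsto (fun m : ℕ => Real.log (((2 * m + 1 : ℕ) : ℝ) + 1) / (m : ℝ) ^ 2) atTop (𝓝 0) := by
  have hu := tendsto_one_div_atTop_nhds_zero_nat (𝕜 := ℝ)
  have hlim : Tendsto (fun m : ℕ => 2 * (1 / (m : ℝ)) + (1 / (m : ℝ)) ^ 2) atTop (𝓝 0) := by
    simpa using (hu.const_mul 2).add (hu.pow 2)
  refine squeeze_zero' (Eventually.of_forall fun m => ?_) ?_ hlim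
  · have : (1 : ℝ) ≤ ((2 * m + 1 : ℕ) : ℝ) + 1 := by push_cast; linarith [Nat.cast_nonneg (α := ℝ) m]
    exact div_nonneg (Real.log_nonneg this) (by positivity)
  · filter_upwards [eventually_gt_atTop 0] with m hm
    have hm' : (0 : ℝ) < m := by exact_mod_cast hm
    have h := Real.log_le_sub_one_of_pos (show (0 : ℝ) < ((2 * m + 1 : ℕ) : ℝ) + 1 by positivity)
    rw [div_le_iff₀ (by positivity)]
    refine h.trans (le_of_eq ?_)
    push_cast; field_simp; ring

/-- The dimension bound furnished by the kernel with `A = G + 1 + 2 r` bricks, whose first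
numerator `N m` makes a brick of size `|p| ^ (x₀ - x₁ k)` at `p ^ k` and determines the sign `ε` of
the symmetry of the kernel.  The left side is, on the scale `m ^ 2 log |p|`, the decay of the
linear forms, and the second factor on the right the growth of their coefficients. -/
theorem le_finrank_sub_one_mul {p : ℤ} (hp : 2 ≤ |p|) (G r : ℕ) (N : ℕ → Polynomial ℝ)
    (x₀ x₁ : ℕ → ℝ) (ε : ℝ) (T : Finset ℕ)
    (hN : ∀ m, 1 ≤ m → BrickBound p (2 * m + 1) (N m) (p ^ (m * (m + 1) / 2))
      (2 * |(p : ℝ)| ^ (2 * m + 1) * |(p : ℝ)| ^ (m * (m + 1) / 2)))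
    (hNl : ∀ m k : ℕ, 1 ≤ k → brick p (2 * m + 1) (N m) ((p : ℝ) ^ k) ≠ 0 ∧
      |Real.log (|brick p (2 * m + 1) (N m) ((p : ℝ) ^ k)|)
        - (x₀ m - x₁ m * k) * Real.log (|(p : ℝ)|)| ≤ 12)
    (hx₀ : Tendsto (fun m : ℕ => x₀ m / (m : ℝ) ^ 2) atTop (𝓝 0))
    (hx₁ : Tendsto (fun m : ℕ => x₁ m / (m : ℝ)) atTop (𝓝 1)) (hx₁m : ∀ m : ℕ, (m : ℝ) ≤ x₁ m)
    (hε : ε = 1 ∨ ε = -1)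
    (hrefl : ∀ (m : ℕ) (X : ℝ), X ≠ 0 →
      (N m).eval (((p : ℝ) ^ (2 * m + 1) * X)⁻¹) * ((p : ℝ) ^ (2 * m + 1) * X ^ 2) ^ (m + 1)
        = ε * (N m).eval X)
    (hN0 : ∀ m, 1 ≤ m → (N m).eval 0 = 0)
    (hT : T ⊆ Finset.Icc 2 (G + 1 + 2 * r))
    (hpar : ∀ t ∈ Finset.Icc 2 (G + 1 + 2 * r), t ∉ T → ε * (-1) ^ t = -1) :
    (2 * r * (G + 1) - 2 * r ^ 2 - 12 * r - (G + 1) / 2 - 12 * (G + 1 + 2 * r) / Real.pi ^ 2 : ℝ)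
      ≤ ((Module.finrank ℚ (Submodule.span ℚ (insert 1
          ((fun t => realQZeta ((p : ℝ)⁻¹) (t - 1)) '' (T : Set ℕ)))) : ℝ) - 1)
        * (G + 1 + 28 * r + 4 * r ^ 2 + 12 * (G + 1 + 2 * r) / Real.pi ^ 2) := by
  set z : ℕ → ℝ := fun t => realQZeta ((p : ℝ)⁻¹) (t - 1) with hz
  set A := G + 1 + 2 * r with hA
  have hAR : (A : ℝ) = G + 1 + 2 * r := by rw [hA]; push_cast; ring
  set a : ℝ := |(p : ℝ)| with ha
  have ha1 : 1 < a := one_lt_abs_cast hp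
  set lam := Real.log a with hlam
  have hlam0 : 0 < lam := Real.log_pos ha1
  rw [← hAR]
  set α₀ : ℝ := 2 * r * (G + 1) - 2 * r ^ 2 - 12 * r - (G + 1) / 2 - 12 * A / Real.pi ^ 2 with hα₀
  set β₀ : ℝ := G + 1 + 28 * r + 4 * r ^ 2 + 12 * A / Real.pi ^ 2 with hβ₀
  have hβ₀0 : 0 ≤ β₀ := by positivity
  have hfin : (1 : ℝ) ≤ Module.finrank ℚ (Submodule.span ℚ (insert (1 : ℝ) (z '' (T : Set ℕ)))) := by
    obtain ⟨d, hd, -⟩ := exists_rational_coordinates T z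
    exact_mod_cast (show 1 ≤ Module.finrank ℚ (Submodule.span ℚ (insert (1 : ℝ)
      (z '' (T : Set ℕ)))) by omega)
  rcases le_or_gt α₀ 0 with hα | hα
  · exact hα.trans (mul_nonneg (by linarith) hβ₀0)
  have hp0 := ne_zero_of_two_le_abs hp
  obtain ⟨L, C, hL, hC, hform⟩ := exists_linear_form A
  -- the series: its first nonzero term is the one of index `2 m r`
  have hser : ∀ᶠ m : ℕ in atTop, 1 ≤ m ∧ ∃ S,
      HasSum (fun l : ℕ => kernelFun p m G r (N m) ((p : ℝ) ^ (l + 1))) S ∧ S ≠ 0 ∧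
      |Real.log (|S|) - ((x₀ m + (2 * m * r * (2 * m + 1) + m * r * (2 * m * r + 1)))
        - (x₁ m + G * (m + 1) + 2 * r) * (2 * m * r + 1)) * lam| ≤ 12 * A + 1 := by
    have hbig : ∀ᶠ m : ℕ in atTop, 2 * (12 * (A : ℝ)) + 2 ≤ lam * m :=
      (tendsto_natCast_atTop_atTop.const_mul_atTop hlam0).eventually_ge_atTop _
    filter_upwards [hbig, eventually_ge_atTop 1] with m hm hm1
    refine ⟨hm1, ?_⟩
    obtain ⟨S, h1, h2, h3⟩ := exists_hasSum_of_dominant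
      (f := fun l : ℕ => kernelFun p m G r (N m) ((p : ℝ) ^ (l + 1))) (l₀ := r * (2 * m))
      (x := (x₀ m + (2 * m * r * (2 * m + 1) + m * r * (2 * m * r + 1))) * lam)
      (E := (x₁ m + G * (m + 1) + 2 * r) * lam) (c := 12 * A)
      (fun l hl => kernelFun_eq_zero p G r (N m) hl)
      (fun l hl => by
        obtain ⟨k1, k2⟩ := hNl m (l + 1) (by omega)
        obtain ⟨h1, h2⟩ := log_kernelFun hp m G r (show r * (2 * m) < l + 1 by omega) k1 k2
        refine ⟨h1, ?_⟩
        rw [hAR]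
        refine le_trans (le_of_eq ?_) h2
        congr 1; ring)
      (by
        refine hm.trans ?_
        rw [mul_comm]
        refine mul_le_mul_of_nonneg_right ?_ hlam0.le
        have := hx₁m m
        have : (0 : ℝ) ≤ G * (m + 1) + 2 * r := by positivity
        linarith)
    refine ⟨S, h1, h2, ?_⟩
    refine le_trans (le_of_eq ?_) h3
    congr 1; push_cast; ring
  -- `2 L P D ^ A` is the integer multiplier, and `B` bounds the partial fraction coefficients
  set P : ℕ → ℤ := fun m => p ^ (m * (m + 1) / 2 * (G + 1) + 2 * (2 * m + 1) ^ 2 * r) with hP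
  set D : ℕ → ℤ := fun m => cyclotomicProd p (2 * m + 1) with hD
  set B : ℕ → ℝ := fun m =>
    (4 ^ A * (((2 * m + 1 : ℕ) : ℝ) + 1) * Real.exp 12) ^ A
        * (2 * a ^ (2 * m + 1 + m * (m + 1) / 2 * (G + 1) + (r ^ 2 + 5 * r) * (2 * m + 1) ^ 2))
    with hB
  have hlin : ∀ m : ℕ, ∃ (S : ℝ) (c₀ : ℤ) (c : ℕ → ℤ), (1 ≤ m ∧ ∃ S,
      HasSum (fun l : ℕ => kernelFun p m G r (N m) ((p : ℝ) ^ (l + 1))) S ∧ S ≠ 0 ∧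
      |Real.log (|S|) - ((x₀ m + (2 * m * r * (2 * m + 1) + m * r * (2 * m * r + 1)))
        - (x₁ m + G * (m + 1) + 2 * r) * (2 * m * r + 1)) * lam| ≤ 12 * A + 1) →
      S ≠ 0 ∧ |Real.log (|S|) - ((x₀ m + (2 * m * r * (2 * m + 1) + m * r * (2 * m * r + 1)))
        - (x₁ m + G * (m + 1) + 2 * r) * (2 * m * r + 1)) * lam| ≤ 12 * A + 1 ∧
      (2 * L * P m * D m ^ A : ℤ) * S = c₀ + ∑ t ∈ T, (c t : ℝ) * z t ∧
      ∀ t ∈ T, |(c t : ℝ)| ≤ C * |(P m : ℝ)| * |(D m : ℝ)| ^ A * B m := by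
    intro m
    by_cases h : 1 ≤ m ∧ ∃ S,
      HasSum (fun l : ℕ => kernelFun p m G r (N m) ((p : ℝ) ^ (l + 1))) S ∧ S ≠ 0 ∧
      |Real.log (|S|) - ((x₀ m + (2 * m * r * (2 * m + 1) + m * r * (2 * m * r + 1)))
        - (x₁ m + G * (m + 1) + 2 * r) * (2 * m * r + 1)) * lam| ≤ 12 * A + 1
    · obtain ⟨hm, S, hS, hS0, hSl⟩ := h
      have hdvd : ∀ i, 0 < i → i ≤ 2 * m + 1 → p ^ i - 1 ∣ D m := fun i hi hin =>
        pow_sub_one_dvd_cyclotomicProd p hi hin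
      obtain ⟨c₀, c, h1, h2⟩ := hform p (D m) (2 * m + 1) (P m) (B m) (kernelFun p m G r (N m)) ε T S
        hp hdvd (hasPartialFractions_kernelFun hp hdvd (hN m hm) G r)
        (kernelFun_zero p m G r (hN0 m hm)) hε
        (fun X hX _ => kernelFun_reflect hp0 m G r hX (hrefl m X hX)) hT hpar hS
      exact ⟨S, c₀, c, fun _ => ⟨hS0, hSl, h1, h2⟩⟩
    · exact ⟨0, 0, 0, fun h' => absurd h' h⟩
  -- the forms with small index are irrelevant, and set to zero
  choose S c₀ c hlin using hlin
  have hev := hser.mono fun m hm => hlin m hm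
  -- limits of the logarithms
  have hu := tendsto_one_div_atTop_nhds_zero_nat (𝕜 := ℝ)
  have hu2 : Tendsto (fun m : ℕ => 1 / (m : ℝ) ^ 2) atTop (𝓝 0) := by
    simpa using hu.pow 2
  have hconst : ∀ x : ℝ, Tendsto (fun m : ℕ => x / (m : ℝ) ^ 2) atTop (𝓝 0) := fun x => by
    simpa [div_eq_mul_inv] using hu2.const_mul x
  have htri : ∀ m : ℕ, ((m * (m + 1) / 2 : ℕ) : ℝ) = (m : ℝ) * (m + 1) / 2 := fun m => by
    have h := two_mul_triangle m
    have h' : (2 : ℝ) * ((m * (m + 1) / 2 : ℕ) : ℝ) = m * (m + 1) := by exact_mod_cast h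
    linarith
  have hlogP : Tendsto (fun m : ℕ => Real.log (|(P m : ℝ)|) / (m : ℝ) ^ 2) atTop
      (𝓝 (((G + 1) / 2 + 8 * r) * lam)) := by
    have h : Tendsto (fun m : ℕ => ((1 + 1 / (m : ℝ)) / 2 * (G + 1) + 2 * (2 + 1 / (m : ℝ)) ^ 2 * r)
        * lam) atTop (𝓝 (((1 + 0) / 2 * (G + 1) + 2 * (2 + 0) ^ 2 * r) * lam)) :=
      (((((hu.const_add 1).div_const 2).mul_const _).add
        ((((hu.const_add 2).pow 2).const_mul 2).mul_const _)).mul_const _)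
    rw [show ((1 + 0) / 2 * ((G : ℝ) + 1) + 2 * (2 + 0) ^ 2 * r) * lam
      = ((G + 1) / 2 + 8 * r) * lam by ring] at h
    refine h.congr' ?_
    filter_upwards [eventually_gt_atTop 0] with m hm
    have hm' : (m : ℝ) ≠ 0 := by exact_mod_cast hm.ne'
    simp only [hP]
    rw [Int.cast_pow, abs_pow, Real.log_pow, ← ha, ← hlam]
    rw [Nat.cast_add, Nat.cast_mul, htri]
    push_cast
    field_simp
  have hlogD : Tendsto (fun m : ℕ => Real.log (|(D m : ℝ)|) / (m : ℝ) ^ 2) atTop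
      (𝓝 (12 / Real.pi ^ 2 * lam)) := by
    have h1 : Tendsto (fun m : ℕ => 2 * m + 1) atTop atTop :=
      tendsto_atTop_mono (fun m => (show m ≤ 2 * m + 1 by omega)) tendsto_id
    have h2 := ((tendsto_log_cyclotomicProd_div_sq hp).comp h1).mul ((hu.const_add 2).pow 2)
    rw [show 3 / Real.pi ^ 2 * Real.log |(p : ℝ)| * (2 + 0) ^ 2 = 12 / Real.pi ^ 2 * lam by
      rw [hlam, ha]; ring] at h2
    refine h2.congr' ?_
    filter_upwards [eventually_gt_atTop 0] with m hm
    have hm' : (m : ℝ) ≠ 0 := by exact_mod_cast hm.ne'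
    have hm2 : (2 * (m : ℝ) + 1) ≠ 0 := by positivity
    simp only [Function.comp, hD]
    push_cast
    field_simp
  have hlogS : Tendsto (fun m : ℕ => Real.log (|S m|) / (m : ℝ) ^ 2) atTop
      (𝓝 ((4 * r + 2 * r ^ 2 - (1 + G) * (2 * r)) * lam)) := by
    have h : Tendsto (fun m : ℕ => ((x₀ m / (m : ℝ) ^ 2 + (2 * r * (2 + 1 / (m : ℝ))
          + r * (2 * r + 1 / (m : ℝ)))) - (x₁ m / (m : ℝ) + G * (1 + 1 / (m : ℝ))
          + 2 * r * (1 / (m : ℝ))) * (2 * r + 1 / (m : ℝ))) * lam) atTop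
        (𝓝 (((0 + (2 * r * (2 + 0) + r * (2 * r + 0))) - (1 + G * (1 + 0)
          + 2 * r * 0) * (2 * r + 0)) * lam)) :=
      ((hx₀.add (((hu.const_add 2).const_mul _).add ((hu.const_add _).const_mul _))).sub
        (((hx₁.add ((hu.const_add 1).const_mul _)).add (hu.const_mul _)).mul
          (hu.const_add _))).mul_const _
    rw [show ((0 + (2 * (r : ℝ) * (2 + 0) + r * (2 * r + 0))) - (1 + (G : ℝ) * (1 + 0)
          + 2 * r * 0) * (2 * r + 0)) * lam = (4 * r + 2 * r ^ 2 - (1 + G) * (2 * r)) * lam by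
      ring] at h
    have hdiff : Tendsto (fun m : ℕ => (Real.log (|S m|)
        - ((x₀ m + (2 * m * r * (2 * m + 1) + m * r * (2 * m * r + 1)))
        - (x₁ m + G * (m + 1) + 2 * r) * (2 * m * r + 1)) * lam) / (m : ℝ) ^ 2) atTop (𝓝 0) := by
      refine squeeze_zero_norm' ?_ (hconst (12 * A + 1))
      filter_upwards [hev] with m hm
      rw [Real.norm_eq_abs, abs_div, abs_of_nonneg (sq_nonneg (m : ℝ))]
      exact div_le_div_of_nonneg_right hm.2.1 (sq_nonneg _)
    have h3 := hdiff.add h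
    rw [zero_add] at h3
    refine h3.congr' ?_
    filter_upwards [eventually_gt_atTop 0] with m hm
    have hm' : (m : ℝ) ≠ 0 := by exact_mod_cast hm.ne'
    field_simp
    ring
  have hlogB : Tendsto (fun m : ℕ => Real.log (B m) / (m : ℝ) ^ 2) atTop
      (𝓝 (((G + 1) / 2 + 4 * (r ^ 2 + 5 * r)) * lam)) := by
    have h : Tendsto (fun m : ℕ => A * (A * Real.log 4 / (m : ℝ) ^ 2
          + Real.log (((2 * m + 1 : ℕ) : ℝ) + 1) / (m : ℝ) ^ 2 + 12 / (m : ℝ) ^ 2)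
        + (Real.log 2 / (m : ℝ) ^ 2 + (2 * (1 / (m : ℝ)) + (1 / (m : ℝ)) ^ 2
          + (1 + 1 / (m : ℝ)) / 2 * (G + 1) + (r ^ 2 + 5 * r) * (2 + 1 / (m : ℝ)) ^ 2) * lam))
        atTop (𝓝 (A * (0 + 0 + 0) + (0 + (2 * 0 + 0 ^ 2 + (1 + 0) / 2 * (G + 1)
          + (r ^ 2 + 5 * r) * (2 + 0) ^ 2) * lam))) :=
      ((((hconst _).add tendsto_log_two_mul_add_two_div_sq).add (hconst _)).const_mul _).add
        ((hconst _).add (((((hu.const_mul 2).add (hu.pow 2)).add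
          (((hu.const_add 1).div_const 2).mul_const _)).add
          (((hu.const_add 2).pow 2).const_mul _)).mul_const _))
    rw [show (A : ℝ) * (0 + 0 + 0) + (0 + (2 * 0 + 0 ^ 2 + (1 + 0) / 2 * ((G : ℝ) + 1)
          + ((r : ℝ) ^ 2 + 5 * r) * (2 + 0) ^ 2) * lam)
        = ((G + 1) / 2 + 4 * (r ^ 2 + 5 * r)) * lam by ring] at h
    refine h.congr' ?_
    filter_upwards [eventually_gt_atTop 0] with m hm
    have hm' : (m : ℝ) ≠ 0 := by exact_mod_cast hm.ne'
    have e1 : (((2 * m + 1 : ℕ) : ℝ) + 1) ≠ 0 := by positivity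
    have e2 : (0 : ℝ) < a := by linarith
    simp only [hB]
    rw [Real.log_mul (by positivity) (by positivity), Real.log_pow,
      Real.log_mul (by positivity) (Real.exp_pos _).ne', Real.log_mul (by positivity) e1,
      Real.log_pow, Real.log_exp, Real.log_mul two_ne_zero (by positivity), Real.log_pow, ← hlam]
    rw [Nat.cast_add (2 * m + 1 + _), Nat.cast_add (2 * m + 1), Nat.cast_mul (m * (m + 1) / 2),
      htri]
    push_cast
    field_simp
  have hL' : (0 : ℝ) < L := by exact_mod_cast hL
  have hP0 : ∀ m, 0 < |(P m : ℝ)| := fun m => abs_pos.2 (by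
    simp only [hP]; push_cast; exact pow_ne_zero _ hp0)
  have hD0 : ∀ m, 0 < |(D m : ℝ)| := fun m => abs_pos.2 (by
    exact_mod_cast cyclotomicProd_ne_zero hp (2 * m + 1))
  have hB0 : ∀ m, 0 < B m := fun m => by simp only [hB]; positivity
  -- the criterion
  have hmain := nesterenko_criterion T z c₀ c (α := α₀ * lam) (β := β₀ * lam) (mul_pos hα hlam0)
    (mul_nonneg hβ₀0 hlam0.le) ?_ ?_
  · rw [← mul_assoc] at hmain
    exact le_of_mul_le_mul_right hmain hlam0
  · have h := (((hconst (Real.log (2 * L))).add hlogP).add (hlogD.const_mul (A : ℝ))).add hlogS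
    rw [show 0 + ((G + 1) / 2 + 8 * r) * lam + (A : ℝ) * (12 / Real.pi ^ 2 * lam)
      + (4 * r + 2 * r ^ 2 - (1 + G) * (2 * r)) * lam = -(α₀ * lam) by rw [hα₀]; ring] at h
    refine h.congr' ?_
    filter_upwards [hev] with m hm
    obtain ⟨hS0, -, hval, -⟩ := hm
    rw [← hval]
    push_cast
    rw [abs_mul, abs_mul, abs_mul, abs_pow, abs_of_pos (by positivity : (0 : ℝ) < 2 * L),
      Real.log_mul (mul_pos (mul_pos (by positivity) (hP0 m)) (pow_pos (hD0 m) A)).ne'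
        (abs_ne_zero.2 hS0),
      Real.log_mul (mul_pos (by positivity) (hP0 m)).ne' (pow_pos (hD0 m) A).ne',
      Real.log_mul (by positivity) (hP0 m).ne', Real.log_pow]
    ring
  · intro η hη
    have h := (((hconst (Real.log C)).add hlogP).add (hlogD.const_mul (A : ℝ))).add hlogB
    rw [show 0 + ((G + 1) / 2 + 8 * r) * lam + (A : ℝ) * (12 / Real.pi ^ 2 * lam)
      + ((G + 1) / 2 + 4 * (r ^ 2 + 5 * r)) * lam = β₀ * lam by rw [hβ₀]; ring] at h
    filter_upwards [hev, eventually_gt_atTop 0,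
      h.eventually (gt_mem_nhds (show β₀ * lam < β₀ * lam + η by linarith))] with m hm hm0 hlt t ht
    refine (hm.2.2.2 t ht).trans ?_
    have hm' : (0 : ℝ) < m := by exact_mod_cast hm0
    have h1 : 0 < C * |(P m : ℝ)| := mul_pos hC (hP0 m)
    have h2 : 0 < |(D m : ℝ)| ^ A := pow_pos (hD0 m) A
    rw [← Real.log_le_iff_le_exp (mul_pos (mul_pos h1 h2) (hB0 m)),
      Real.log_mul (mul_pos h1 h2).ne' (hB0 m).ne', Real.log_mul h1.ne' h2.ne',
      Real.log_mul hC.ne' (hP0 m).ne', Real.log_pow]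
    have hsq : (0 : ℝ) < (m : ℝ) ^ 2 := by positivity
    have e : Real.log C / (m : ℝ) ^ 2 + Real.log |(P m : ℝ)| / (m : ℝ) ^ 2
        + (A : ℝ) * (Real.log |(D m : ℝ)| / (m : ℝ) ^ 2) + Real.log (B m) / (m : ℝ) ^ 2
        = (Real.log C + Real.log |(P m : ℝ)| + A * Real.log |(D m : ℝ)| + Real.log (B m))
          / (m : ℝ) ^ 2 := by ring
    rw [e, div_lt_iff₀ hsq] at hlt
    exact hlt.le

/-! ### Asymptotics in `A` -/

/-- Optimisation of the dimension bound: with `r ∼ √(π ^ 2 + 12) / (2 π) * √A` the quotient of the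
two sides is asymptotic to `π / (2 √(π ^ 2 + 12)) * √A`. -/
theorem exists_tendsto_zero_of_quotient_bound (h : ℕ → ℝ) (h0 : ∀ A, 0 ≤ h A)
    (hb : ∀ A r : ℕ, Even A → 2 * r + 1 ≤ A →
      2 * r * (A - 2 * r) - 2 * r ^ 2 - 12 * r - (A - 2 * r) / 2 - 12 * A / Real.pi ^ 2
        ≤ (h A - 1) * (A - 2 * r + 28 * r + 4 * r ^ 2 + 12 * A / Real.pi ^ 2)) :
    ∃ ε : ℕ → ℝ, Tendsto ε atTop (𝓝 0) ∧ ∀ A : ℕ, Even A →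
      (Real.pi + ε A) / (2 * Real.sqrt (Real.pi ^ 2 + 12)) * Real.sqrt (A : ℝ) ≤ h A := by
  have hpi := Real.pi_pos
  set w := Real.sqrt (Real.pi ^ 2 + 12) with hw
  have hw0 : 0 < w := Real.sqrt_pos.2 (by positivity)
  have hww : w ^ 2 = Real.pi ^ 2 + 12 := Real.sq_sqrt (by positivity)
  set c : ℝ := w / (2 * Real.pi) with hc
  have hc0 : 0 < c := by positivity
  set r : ℕ → ℕ := fun A => ⌊c * Real.sqrt (A : ℝ)⌋₊ with hr
  set ρ : ℕ → ℝ := fun A => r A / Real.sqrt (A : ℝ) with hρ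
  set v : ℕ → ℝ := fun A => 1 / Real.sqrt (A : ℝ) with hv
  have hsq : Tendsto (fun A : ℕ => Real.sqrt (A : ℝ)) atTop atTop :=
    Real.tendsto_sqrt_atTop.comp tendsto_natCast_atTop_atTop
  have hv0 : Tendsto v atTop (𝓝 0) := by
    simpa only [hv, one_div, Function.comp_def] using tendsto_inv_atTop_zero.comp hsq
  have hρc : Tendsto ρ atTop (𝓝 c) := (tendsto_nat_floor_mul_div_atTop hc0.le).comp hsq
  -- the quotient of the two sides, divided by `√A`, in terms of `ρ = r / √A` and `v = 1 / √A`
  set g : ℕ → ℝ := fun A =>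
    (2 * ρ A * (1 - 2 * (ρ A * v A)) - 2 * (ρ A ^ 2 * v A) - 12 * (ρ A * v A ^ 2)
        - (1 - 2 * (ρ A * v A)) * v A / 2 - 12 / Real.pi ^ 2 * v A)
      / (1 - 2 * (ρ A * v A) + 28 * (ρ A * v A) + 4 * ρ A ^ 2 + 12 / Real.pi ^ 2) with hg
  have hglim : Tendsto g atTop (𝓝 (Real.pi / (2 * w))) := by
    have hρv := hρc.mul hv0
    have hden : (1 - 2 * (c * 0) + 28 * (c * 0) + 4 * c ^ 2 + 12 / Real.pi ^ 2) ≠ 0 := by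
      have : 0 < 4 * c ^ 2 + 12 / Real.pi ^ 2 := by positivity
      linarith
    have h1 := ((((((hρc.const_mul 2).mul ((hρv.const_mul 2).const_sub 1)).sub
      (((hρc.pow 2).mul hv0).const_mul 2)).sub ((hρc.mul (hv0.pow 2)).const_mul 12)).sub
      ((((hρv.const_mul 2).const_sub 1).mul hv0).div_const 2)).sub
      (hv0.const_mul (12 / Real.pi ^ 2))).div
      (((((hρv.const_mul 2).const_sub 1).add (hρv.const_mul 28)).add
        ((hρc.pow 2).const_mul 4)).add_const (12 / Real.pi ^ 2)) hden
    -- `4 c ^ 2 = 1 + 12 / π ^ 2` is the condition for a maximum of the limit `2 c / (…)`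
    have e : 1 - 2 * (c * 0) + 28 * (c * 0) + 4 * c ^ 2 + 12 / Real.pi ^ 2 = 8 * c ^ 2 := by
      have : 4 * c ^ 2 = 1 + 12 / Real.pi ^ 2 := by
        rw [hc, div_pow, hww]; field_simp; norm_num
      linarith
    rw [e] at h1
    have e' : (2 * c * (1 - 2 * (c * 0)) - 2 * (c ^ 2 * 0) - 12 * (c * 0 ^ 2)
        - (1 - 2 * (c * 0)) * 0 / 2 - 12 / Real.pi ^ 2 * 0) / (8 * c ^ 2)
        = Real.pi / (2 * w) := by
      rw [hc]; field_simp; ring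
    rwa [e'] at h1
  have hbound : ∀ᶠ A : ℕ in atTop, Even A → g A ≤ h A / Real.sqrt (A : ℝ) := by
    filter_upwards [hsq.eventually_ge_atTop (2 * c + 1), eventually_gt_atTop 0] with A hA hA0 hev
    set s := Real.sqrt (A : ℝ) with hs
    have hs0 : 0 < s := by linarith
    have hss : (A : ℝ) = s ^ 2 := (Real.sq_sqrt (Nat.cast_nonneg A)).symm
    have hrle : (r A : ℝ) ≤ c * s := Nat.floor_le (by positivity)
    have hrA : 2 * r A + 1 ≤ A := by
      have : (2 * (r A : ℝ) + 1) ≤ A := by rw [hss]; nlinarith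
      exact_mod_cast this
    have hb' := hb A (r A) hev hrA
    have hr0 : (0 : ℝ) ≤ r A := Nat.cast_nonneg _
    have hβ : 0 < (A : ℝ) - 2 * r A + 28 * r A + 4 * (r A : ℝ) ^ 2 + 12 * A / Real.pi ^ 2 := by
      have : (0 : ℝ) < A := by exact_mod_cast hA0
      have : 0 < 12 * (A : ℝ) / Real.pi ^ 2 := by positivity
      nlinarith
    have e : g A = (2 * r A * (A - 2 * r A) - 2 * (r A : ℝ) ^ 2 - 12 * r A - (A - 2 * r A) / 2
        - 12 * A / Real.pi ^ 2)
        / (A - 2 * r A + 28 * r A + 4 * (r A : ℝ) ^ 2 + 12 * A / Real.pi ^ 2) / s := by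
      have e2 : 1 - 2 * (ρ A * v A) + 28 * (ρ A * v A) + 4 * ρ A ^ 2 + 12 / Real.pi ^ 2
          = (A - 2 * r A + 28 * r A + 4 * (r A : ℝ) ^ 2 + 12 * A / Real.pi ^ 2) / s ^ 2 := by
        simp only [hρ, hv, ← hs]; rw [hss]; field_simp
      have e1 : 2 * ρ A * (1 - 2 * (ρ A * v A)) - 2 * (ρ A ^ 2 * v A) - 12 * (ρ A * v A ^ 2)
          - (1 - 2 * (ρ A * v A)) * v A / 2 - 12 / Real.pi ^ 2 * v A
          = (2 * r A * (A - 2 * r A) - 2 * (r A : ℝ) ^ 2 - 12 * r A - (A - 2 * r A) / 2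
            - 12 * A / Real.pi ^ 2) / s ^ 3 := by
        simp only [hρ, hv, ← hs]; rw [hss]; field_simp
      simp only [hg]
      rw [e1, e2]
      field_simp
    rw [e]
    refine div_le_div_of_nonneg_right ?_ hs0.le
    rw [div_le_iff₀ hβ]
    refine hb'.trans (mul_le_mul_of_nonneg_right ?_ hβ.le)
    linarith
  -- for even `A > 0`, `ε A` is negative only where the bound fails without error term
  refine ⟨fun A => if Even A then min 0 (2 * w * (h A / Real.sqrt (A : ℝ)) - Real.pi) else 0, ?_, ?_⟩
  · have hlow : Tendsto (fun A => min 0 (2 * w * g A - Real.pi)) atTop (𝓝 0) := by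
      have h1 := (tendsto_const_nhds (x := (0 : ℝ))).min
        ((hglim.const_mul (2 * w)).sub_const Real.pi)
      rwa [show 2 * w * (Real.pi / (2 * w)) - Real.pi = 0 by field_simp; ring, min_self] at h1
    refine tendsto_of_tendsto_of_tendsto_of_le_of_le' hlow tendsto_const_nhds ?_
      (Eventually.of_forall fun A => ?_)
    · filter_upwards [hbound] with A hA
      split_ifs with hev
      · refine min_le_min le_rfl (sub_le_sub_right ?_ _)
        exact mul_le_mul_of_nonneg_left (hA hev) (by positivity)
      · exact min_le_left _ _
    · split_ifs
      · exact min_le_left _ _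
      · exact le_rfl
  · intro A hev
    simp only [if_pos hev]
    rcases (Real.sqrt_nonneg (A : ℝ)).eq_or_lt with hs | hs
    · rw [← hs, mul_zero]; exact h0 A
    · rw [div_mul_eq_mul_div, div_le_iff₀ (by positivity), ← le_div_iff₀ hs]
      refine le_trans (add_le_add_right (min_le_right _ _) _) (le_of_eq ?_)
      field_simp
      ring

/-- Real and complex `q`-zeta values span spaces of the same dimension over `ℚ`. -/
theorem finrank_span_qZeta_eq (x : ℝ) (T : Finset ℕ) :
    Module.finrank ℚ (Submodule.span ℚ (insert (1 : ℂ) (qZeta (x : ℂ) '' (T : Set ℕ))))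
      = Module.finrank ℚ (Submodule.span ℚ (insert (1 : ℝ)
          ((fun t => realQZeta x (t - 1)) '' (T : Set ℕ)))) := by
  set f : ℝ →ₗ[ℚ] ℂ := (Algebra.linearMap ℝ ℂ).restrictScalars ℚ with hf
  have hinj : Function.Injective f := Complex.ofReal_injective
  rw [(Submodule.equivMapOfInjective f hinj _).finrank_eq, Submodule.map_span, Set.image_insert_eq,
    Set.image_image]
  have h1 : f 1 = 1 := by simp [hf]
  have h2 : (fun t => f (realQZeta x (t - 1))) = qZeta (x : ℂ) := by
    funext t; rw [qZeta_ofReal]; rfl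
  rw [h1, h2]

/-- The dimension bound for the even `q`-zeta values, from the first numerator `X ^ (m + 1)`. -/
theorem le_finrank_evenQZetaSpan {p : ℤ} (hp : 2 ≤ |p|) {A r : ℕ} (hr : 2 * r + 1 ≤ A) :
    (2 * r * (A - 2 * r) - 2 * r ^ 2 - 12 * r - (A - 2 * r) / 2 - 12 * A / Real.pi ^ 2 : ℝ)
      ≤ ((Module.finrank ℚ (evenQZetaSpan (((p : ℝ)⁻¹ : ℝ) : ℂ) A) : ℝ) - 1)
        * (A - 2 * r + 28 * r + 4 * r ^ 2 + 12 * A / Real.pi ^ 2) := by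
  obtain ⟨G, rfl⟩ : ∃ G, A = G + 1 + 2 * r := ⟨A - 1 - 2 * r, by omega⟩
  have hp0 := ne_zero_of_two_le_abs hp
  have hu := tendsto_one_div_atTop_nhds_zero_nat (𝕜 := ℝ)
  have h := le_finrank_sub_one_mul hp G r monomialNum (fun _ => 0) (fun m => m + 1) 1
    ((Finset.Icc 2 (G + 1 + 2 * r)).filter Even)
    (fun m _ => by
      obtain ⟨h1, h2⟩ := brickBound_monomialNum hp m
      refine ⟨h1, fun j hj => ⟨(h2 j hj).1, (h2 j hj).2.trans ?_⟩⟩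
      refine le_mul_of_one_le_left (by positivity) ?_
      have := one_le_pow₀ (one_lt_abs_cast hp).le (n := 2 * m + 1)
      linarith)
    (fun m k hk => ⟨(log_monomialNum hp m hk).1, (log_monomialNum hp m hk).2.trans (by norm_num)⟩)
    (by simp)
    (by
      have h1 := hu.const_add 1
      rw [add_zero] at h1
      refine h1.congr' ?_
      filter_upwards [eventually_gt_atTop 0] with m hm
      have : (m : ℝ) ≠ 0 := by exact_mod_cast hm.ne'
      field_simp)
    (fun m => by linarith) (Or.inl rfl) (fun m X hX => monomialNum_reflect hp0 m hX)
    (fun m _ => by simp [monomialNum]) (Finset.filter_subset _ _)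
    (fun t ht htT => by
      have : Odd t := by
        rw [← Nat.not_even_iff_odd]
        exact fun he => htT (Finset.mem_filter.2 ⟨ht, he⟩)
      rw [this.neg_one_pow, one_mul])
  rw [← finrank_span_qZeta_eq] at h
  have hset : ((((Finset.Icc 2 (G + 1 + 2 * r)).filter Even : Finset ℕ)) : Set ℕ)
      = {s : ℕ | Even s ∧ 2 ≤ s ∧ s ≤ G + 1 + 2 * r} := by
    ext s; simp; tauto
  rw [hset] at h
  rw [evenQZetaSpan]
  convert h using 2 <;> push_cast <;> ring

/-- The dimension bound for the odd `q`-zeta values, from the first numerator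
`X ^ m (p ^ (2 m + 1) X ^ 2 - 1)`. -/
theorem le_finrank_oddQZetaSpan {p : ℤ} (hp : 2 ≤ |p|) {A r : ℕ} (hA : Even A)
    (hr : 2 * r + 1 ≤ A) :
    (2 * r * (A - 2 * r) - 2 * r ^ 2 - 12 * r - (A - 2 * r) / 2 - 12 * A / Real.pi ^ 2 : ℝ)
      ≤ ((Module.finrank ℚ (oddQZetaSpan (((p : ℝ)⁻¹ : ℝ) : ℂ) A) : ℝ) - 1)
        * (A - 2 * r + 28 * r + 4 * r ^ 2 + 12 * A / Real.pi ^ 2) := by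
  obtain ⟨G, rfl⟩ : ∃ G, A = G + 1 + 2 * r := ⟨A - 1 - 2 * r, by omega⟩
  have hp0 := ne_zero_of_two_le_abs hp
  have hu := tendsto_one_div_atTop_nhds_zero_nat (𝕜 := ℝ)
  have h := le_finrank_sub_one_mul hp G r (oddNum p) (fun m => 2 * m + 1) (fun m => m) (-1)
    ((Finset.Icc 2 (G + 1 + 2 * r)).filter Odd)
    (fun m hm => brickBound_oddNum hp hm) (fun m k hk => log_oddNum hp m hk)
    (by
      have h1 := (hu.const_mul 2).add (hu.pow 2)
      rw [show (2 : ℝ) * 0 + 0 ^ 2 = 0 by norm_num] at h1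
      refine h1.congr' ?_
      filter_upwards [eventually_gt_atTop 0] with m hm
      have : (m : ℝ) ≠ 0 := by exact_mod_cast hm.ne'
      field_simp)
    (by
      refine tendsto_const_nhds.congr' ?_
      filter_upwards [eventually_gt_atTop 0] with m hm
      have : (m : ℝ) ≠ 0 := by exact_mod_cast hm.ne'
      field_simp)
    (fun m => le_rfl) (Or.inr rfl) (fun m X hX => oddNum_reflect hp0 m hX)
    (fun m hm => by simp [oddNum, show m ≠ 0 by omega]) (Finset.filter_subset _ _)
    (fun t ht htT => by
      have : Even t := by
        rw [← Nat.not_odd_iff_even]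
        exact fun he => htT (Finset.mem_filter.2 ⟨ht, he⟩)
      rw [this.neg_one_pow, mul_one])
  rw [← finrank_span_qZeta_eq] at h
  have hset : ((((Finset.Icc 2 (G + 1 + 2 * r)).filter Odd : Finset ℕ)) : Set ℕ)
      = {s : ℕ | Odd s ∧ 3 ≤ s ∧ s ≤ G + 1 + 2 * r - 1} := by
    ext s
    simp only [Finset.coe_filter, Finset.mem_Icc, Set.mem_ofPred_eq]
    obtain ⟨a, ha⟩ := hA
    constructor
    · rintro ⟨h1, b, hb⟩
      exact ⟨⟨b, hb⟩, by omega, by omega⟩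
    · rintro ⟨⟨b, hb⟩, h1, h2⟩
      exact ⟨by omega, b, hb⟩
  rw [hset] at h
  rw [oddQZetaSpan]
  convert h using 2 <;> push_cast <;> ring

theorem mainTheorem1 (q : ℂ) (hq0 : q ≠ 0) (hq1 : q ≠ 1) (hq2 : q ≠ -1)
    (hqZ : ∃ N : ℤ, 1 / q = (N : ℂ)) :
    (∃ ε : ℕ → ℝ, Filter.Tendsto ε Filter.atTop (nhds 0) ∧
      ∀ A : ℕ, Even A →
        (Real.pi + ε A) / (2 * Real.sqrt (Real.pi ^ 2 + 12)) * Real.sqrt (A : ℝ) ≤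
          (Module.finrank ℚ (oddQZetaSpan q A) : ℝ)) ∧
    (∃ ε : ℕ → ℝ, Filter.Tendsto ε Filter.atTop (nhds 0) ∧
      ∀ A : ℕ, Even A →
        (Real.pi + ε A) / (2 * Real.sqrt (Real.pi ^ 2 + 12)) * Real.sqrt (A : ℝ) ≤
          (Module.finrank ℚ (evenQZetaSpan q A) : ℝ)) := by
  obtain ⟨p, hqp⟩ := hqZ
  have hq : q = (((p : ℝ)⁻¹ : ℝ) : ℂ) := by
    rw [Complex.ofReal_inv, Complex.ofReal_intCast, ← hqp, one_div, inv_inv]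
  have hp : 2 ≤ |p| := by
    by_contra! hlt
    have : p = 0 ∨ p = 1 ∨ p = -1 := by
      have := abs_lt.1 hlt
      omega
    rcases this with rfl | rfl | rfl
    · exact hq0 (by simpa using hq)
    · exact hq1 (by simpa using hq)
    · exact hq2 (by rw [hq]; norm_num)
  subst hq
  exact ⟨exists_tendsto_zero_of_quotient_bound _ (fun A => Nat.cast_nonneg _)
      fun A r hA hr => le_finrank_oddQZetaSpan hp hA hr,
    exists_tendsto_zero_of_quotient_bound _ (fun A => Nat.cast_nonneg _)
      fun A r _ hr => le_finrank_evenQZetaSpan hp hr⟩
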